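/- Let $M$ be a smooth, Hausdorff, paracompact, finite-dimensional manifold. A distribution $D$ on $M$ is a choice of linear subspaces $D_x\subseteq T_xM$, $x\in M$. A local vector field is a smooth vector field on an open (possibly empty) subset of $M$; a set $\mathcal V$ of local vector fields spans the distribution $x\mapsto\operatorname{span}\{X(x): X\in\mathcal V,\ x\in\operatorname{dom}X\}$. For a distribution $H$, let $\mathfrak X_{loc,H}(M)$ be the set of local vector fields with values in $H$. $H$ is smooth if it is spanned by $\mathfrak X_{loc,H}(M)$, and regular if $\dim H_x$ is locally constant. A set $\mathcal V$ of local vector fields is stable if $(Fl^X_t)^*Y=(T\,Fl^X_t)^{-1}\circ Y\circ Fl^X_t\in\mathcal V$ for all $X,Y\in\mathcal V$ and $t\in\mathbb R$, where $Fl^X$ is the maximal local flow of $X$ and the pullback has its natural domain; $\mathcal S(\mathcal V)$ denotes the smallest stable set containing $\mathcal V$. A continuous curve $\gamma:[a,b]\to M$ is controlled by local vector fields $X_1,\dots,X_k$ defined near $\gamma([a,b])$ if it is absolutely continuous (in every chart) and there are $u_1,\dots,u_k\in L^1([a,b])$ with $\dot\gamma(t)=\sum_{j}u_j(t)X_j(\gamma(t))$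 for almost every $t$. A horizontal curve is a finite concatenation of curves controlled by elements of $\mathfrak X_{loc,H}(M)$, and $Acc(x)$ is the set of all points that can be reached from $x$ by a horizontal curve. An integral manifold of a distribution $D$ is a connected (Hausdorff, paracompact, smooth) manifold $N$ with an injective immersion $i:N\to M$ such that $T_pi(T_pN)=D_{i(p)}$ for all $p\in N$; it is maximal if it is not contained in a strictly larger integral manifold of $D$. $D$ is integrable if every point of $M$ lies on an integral manifold of $D$. A leaf of $D$ through $x$ is a maximal integral manifold of $D$ containing $x$. Theorem. Let $H$ be a smooth regular distribution on $M$ and let $x\in M$. Then the distribution $E$ spanned by $\mathcal S(\mathfrak X_{loc,H}(M))$ is integrable, $E$ has a leaf through $x$, this leaf is unique up to a diffeomorphism commuting with the immersions into $M$, and its underlying subset of $M$ is the accessible set $Acc(x)$. -/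

import Mathlib

open Set Filter Topology MeasureTheory
open scoped Manifold ContDiff

universe u v

namespace SubRiem

section Fields

variable (E : Type v) [NormedAddCommGroup E] [NormedSpace ℝ E]
  (M : Type u) [TopologicalSpace M] [ChartedSpace E M]

/-- A distribution on `M`: a linear subspace `H x` of `T_x M` for every `x` (no regularity). -/
abbrev TangentDistribution : Type (max u v) :=
  (x : M) → Submodule ℝ (TangentSpace 𝓘(ℝ, E) x)

/-- A local vector field: an open (possibly empty) domain together with a smooth vector field on it.
The field is recorded as a function on all of `M`, with value `0` outside of the domain, so that
two local vector fields are equal exactly when they have the same domain and agree on it. -/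
structure LocalVectorField [IsManifold 𝓘(ℝ, E) ∞ M] where
  domain : Set M
  isOpen_domain : IsOpen domain
  toFun : (x : M) → TangentSpace 𝓘(ℝ, E) x
  smooth : ContMDiffOn 𝓘(ℝ, E) 𝓘(ℝ, E).tangent ∞
    (fun x : M => (⟨x, toFun x⟩ : TangentBundle 𝓘(ℝ, E) M)) domain
  eq_zero_of_notMem : ∀ x, x ∉ domain → toFun x = 0

end Fields

variable {E : Type v} [NormedAddCommGroup E] [NormedSpace ℝ E]
  {M : Type u} [TopologicalSpace M] [ChartedSpace E M]

/-- Regular distribution: the dimension of `H x` is locally constant. -/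
def IsRegular (H : TangentDistribution E M) : Prop :=
  ∀ x : M, ∀ᶠ y in 𝓝 x, Module.finrank ℝ (H y) = Module.finrank ℝ (H x)

variable [IsManifold 𝓘(ℝ, E) ∞ M]

/-- The distribution spanned by a set of local vector fields. -/
noncomputable def spannedBy (V : Set (LocalVectorField E M)) : TangentDistribution E M :=
  fun x => Submodule.span ℝ {w | ∃ X ∈ V, x ∈ X.domain ∧ X.toFun x = w}

/-- The set of local vector fields that are horizontal at every point of their domain. -/
def horizontalFields (H : TangentDistribution E M) : Set (LocalVectorField E M) :=
  {X | ∀ x ∈ X.domain, X.toFun x ∈ H x}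

/-- Smooth distribution: spanned by its local horizontal vector fields. -/
def IsSmoothDistribution (H : TangentDistribution E M) : Prop :=
  spannedBy (horizontalFields H) = H

/-! ### Flows and stable sets of local vector fields -/

/-- `X.FlowsTo t y z`: the maximal integral curve of `X` (in the domain of `X`) starting at `y`
is defined at time `t`, where it is at `z`; that is, `Fl^X(t, y)` is defined and equal to `z`. -/
def LocalVectorField.FlowsTo (X : LocalVectorField E M) (t : ℝ) (y z : M) : Prop :=
  ∃ (γ : ℝ → M) (a b : ℝ), 0 ∈ Ioo a b ∧ t ∈ Ioo a b ∧
    (∀ s ∈ Ioo a b, γ s ∈ X.domain) ∧ IsMIntegralCurveOn γ X.toFun (Ioo a b) ∧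
    γ 0 = y ∧ γ t = z

open Classical in
/-- The time-`t` map `Fl^X_t` of the maximal local flow of `X`
(with value `y` at the points `y` where it is not defined). -/
noncomputable def LocalVectorField.flow (X : LocalVectorField E M) (t : ℝ) (y : M) : M :=
  if h : ∃ z, X.FlowsTo t y z then h.choose else y

/-- `Z` is the pullback `(Fl^X_t)^* Y = (T Fl^X_t)⁻¹ ∘ Y ∘ Fl^X_t`, with its natural domain, the set
of all `y` such that `Fl^X_t y` is defined and lies in the domain of `Y`. Flow maps are local
diffeomorphisms, so exactly one local vector field `Z` has this property. -/
def IsFlowPullback (X : LocalVectorField E M) (t : ℝ) (Y Z : LocalVectorField E M) : Prop :=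
  (∀ y, y ∈ Z.domain ↔ ∃ z ∈ Y.domain, X.FlowsTo t y z) ∧
  ∀ y ∈ Z.domain,
    Z.toFun y = VectorField.mpullback 𝓘(ℝ, E) 𝓘(ℝ, E) (X.flow t) Y.toFun y

/-- A set of local vector fields is stable if it is closed under pullback along the flows of
its own members. -/
def IsStable (V : Set (LocalVectorField E M)) : Prop :=
  ∀ X ∈ V, ∀ Y ∈ V, ∀ (t : ℝ) (Z : LocalVectorField E M), IsFlowPullback X t Y Z → Z ∈ V

/-- `𝒮(V)`, the smallest stable set of local vector fields that contains `V`. -/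
def stableHull (V : Set (LocalVectorField E M)) : Set (LocalVectorField E M) :=
  ⋂₀ {W | V ⊆ W ∧ IsStable W}

/-! ### Horizontal curves and the accessible set -/

variable (E) in
/-- `γ : [a, b] → M` is an absolutely continuous curve: it is continuous, and it is absolutely
continuous in every smooth chart on every subinterval that is mapped into the chart domain. -/
def IsAbsContCurve (γ : ℝ → M) (a b : ℝ) : Prop :=
  ContinuousOn γ (Icc a b) ∧
  ∀ e ∈ IsManifold.maximalAtlas 𝓘(ℝ, E) ∞ M, ∀ t₀ t₁ : ℝ, a ≤ t₀ → t₀ ≤ t₁ → t₁ ≤ b →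
    MapsTo γ (Icc t₀ t₁) e.source → AbsolutelyContinuousOnInterval (e ∘ γ) t₀ t₁

/-- `γ : [a, b] → M` is controlled by the local vector fields `X₁, …, X_k`, defined near
`γ([a, b])`: it is absolutely continuous and there are `L¹` functions `u₁, …, u_k` with
`γ'(t) = ∑ j, u_j(t) X_j(γ(t))` for almost every `t`. -/
def IsControlledBy (γ : ℝ → M) (a b : ℝ) {k : ℕ} (X : Fin k → LocalVectorField E M) : Prop :=
  IsAbsContCurve E γ a b ∧ (∀ j, MapsTo γ (Icc a b) (X j).domain) ∧
  ∃ w : Fin k → ℝ → ℝ, (∀ j, IntegrableOn (w j) (Icc a b) volume) ∧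
    ∀ᵐ t ∂(volume.restrict (Icc a b)),
      HasMFDerivAt 𝓘(ℝ, ℝ) 𝓘(ℝ, E) γ t
        ((1 : ℝ →L[ℝ] ℝ).smulRight (∑ j, w j t • (X j).toFun (γ t)))

/-- `γ : [a, b] → M` is a horizontal curve: a (finite) concatenation of curves controlled by
horizontal local vector fields. -/
def IsHorizontalCurve (H : TangentDistribution E M) (γ : ℝ → M) (a b : ℝ) : Prop :=
  ∃ (n : ℕ) (τ : Fin (n + 1) → ℝ), Monotone τ ∧ τ 0 = a ∧ τ (Fin.last n) = b ∧
    ∀ i : Fin n, ∃ (k : ℕ) (X : Fin k → LocalVectorField E M),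
      (∀ j, X j ∈ horizontalFields H) ∧ IsControlledBy γ (τ i.castSucc) (τ i.succ) X

/-- `Acc(x)`, the set of all points that can be reached from `x` by a horizontal curve. -/
def accessibleSet (H : TangentDistribution E M) (x : M) : Set M :=
  {y | ∃ (γ : ℝ → M) (a b : ℝ), a ≤ b ∧ IsHorizontalCurve H γ a b ∧ γ a = x ∧ γ b = y}

/-! ### Integral manifolds and leaves -/

/-- An integral manifold of `D`: a connected (Hausdorff, paracompact, smooth) manifold of some
dimension with an injective immersion into `M` whose differential at `p` has image `D (incl p)`.
Since `incl` is injective, it is no restriction that the carrier is in the universe of `M`. -/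
structure IntegralManifold (D : TangentDistribution E M) where
  carrier : Type u
  dim : ℕ
  [topology : TopologicalSpace carrier]
  [charted : ChartedSpace (EuclideanSpace ℝ (Fin dim)) carrier]
  [manifold : IsManifold (𝓡 dim) ∞ carrier]
  [t2 : T2Space carrier]
  [paracompact : ParacompactSpace carrier]
  [connected : ConnectedSpace carrier]
  incl : carrier → M
  injective : Function.Injective incl
  smooth : ContMDiff (𝓡 dim) 𝓘(ℝ, E) ∞ incl
  immersion : ∀ p, Function.Injective (mfderiv (𝓡 dim) 𝓘(ℝ, E) incl p)
  tangent : ∀ p,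
    LinearMap.range (mfderiv (𝓡 dim) 𝓘(ℝ, E) incl p).toLinearMap = D (incl p)

attribute [instance] IntegralManifold.topology IntegralManifold.charted IntegralManifold.manifold
  IntegralManifold.t2 IntegralManifold.paracompact IntegralManifold.connected

/-- `D` is integrable: every point lies on some integral manifold of `D`. -/
def IsIntegrable (D : TangentDistribution E M) : Prop :=
  ∀ x : M, ∃ N : IntegralManifold D, x ∈ range N.incl

/-- An integral manifold is maximal if it is not contained in a strictly larger one. -/
def IntegralManifold.IsMaximal {D : TangentDistribution E M} (N : IntegralManifold D) : Prop :=
  ∀ N' : IntegralManifold D, range N.incl ⊆ range N'.incl → range N'.incl = range N.incl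

/-- `L` is a leaf of `D` through `x`: a maximal integral manifold of `D` that contains `x`. -/
def IntegralManifold.IsLeafThrough {D : TangentDistribution E M} (L : IntegralManifold D)
    (x : M) : Prop :=
  L.IsMaximal ∧ x ∈ range L.incl

end SubRiem

/-! Let `V` be the stable hull of the horizontal fields and `D` the distribution it spans
(`stableSpan`). Three facts carry the proof.

(1) Orbits contain plaques. Stability makes `D` invariant under the flows of `V`, so its rank is
constant along flow lines. Composing the flows of fields in `V` whose values form a basis of `D` at
`y` parametrizes a piece of integral manifold, a plaque, through `y` (`IsStable.exists_plaque`). The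
flow of a pulled-back field is a conjugate of the original flow, so flow lines of members of `V`
never leave an accessible set (`LocalVectorField.FlowsTo.mem_accessibleSet`), and the plaque through
`y` lies in the accessible set of `y`.

(2) Horizontal curves stay in plaques. A plaque is locally the zero set of the defect `w - f (r w)`,
where `f` is the plaque read in a chart and `r` is a local left inverse of it. The derivative of the
defect along a field tangent to `D` is bounded by a constant times the defect
(`exists_norm_fderiv_defect_le`). Gronwall's lemma with integrable coefficients then keeps the
defect zero along controlled curves (`IsControlledBy.exists_lift`). The same estimate along a second
plaque shows that two plaques through a point factor smoothly through each other
(`exists_plaque_transition`).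

(3) Hence the accessible set, with the plaques as charts, is a manifold. It is Hausdorff because it
injects continuously into `M`, connected because horizontal curves are continuous for its topology,
and paracompact by the theorem of Poincaré and Volterra (`sigmaCompactSpace_of_injective`).

By (2), and since accessibility is an equivalence relation, an integral manifold through `x` meets
the accessible set of `x` in an open and closed set, so it lies inside. The leaves through `x` are
thus the integral manifolds with underlying set the accessible set, and the bijection between two of
them over `M` is smooth both ways by (2). -/

namespace SubRiem

/-! ### The inverse function theorem in smooth form -/

section Inverse

variable {E F : Type*} [NormedAddCommGroup E] [NormedSpace ℝ E] [CompleteSpace E]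
  [NormedAddCommGroup F] [NormedSpace ℝ F]

/-- Inverse function theorem for maps that are smooth on a neighbourhood of `a`. -/
theorem exists_smooth_local_inverse {f : E → F} {a : E}
    (hf : ∀ᶠ x in 𝓝 a, ContDiffAt ℝ ∞ f x) (f' : E ≃L[ℝ] F)
    (hf' : HasFDerivAt f (f' : E →L[ℝ] F) a) :
    ∃ g : F → E, g (f a) = a ∧ (∀ᶠ y in 𝓝 (f a), ContDiffAt ℝ ∞ g y) ∧
      (∀ᶠ y in 𝓝 (f a), f (g y) = y) ∧ ∀ᶠ x in 𝓝 a, g (f x) = x := by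
  have hs : HasStrictFDerivAt f (f' : E →L[ℝ] F) a :=
    hf.self_of_nhds.hasStrictFDerivAt' hf' (by simp)
  set e := hs.toOpenPartialHomeomorph f with he
  have hea : a ∈ e.source := hs.mem_toOpenPartialHomeomorph_source
  have hef : ∀ x, e x = f x := fun x => by rw [he, hs.toOpenPartialHomeomorph_coe]
  have hta : f a ∈ e.target := by rw [← hef]; exact e.map_source hea
  have hsymm : e.symm (f a) = a := by rw [← hef]; exact e.left_inv hea
  have hcont : Tendsto e.symm (𝓝 (f a)) (𝓝 a) := by
    have := e.continuousAt_symm hta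
    rwa [ContinuousAt, hsymm] at this
  -- Invertible operators form an open set; this gives smoothness of the inverse on a whole
  -- neighbourhood of `f a`, not only at `f a`.
  have hinv : ∀ᶠ x in 𝓝 a, fderiv ℝ f x ∈ Set.range
      (ContinuousLinearEquiv.toContinuousLinearMap : (E ≃L[ℝ] F) → (E →L[ℝ] F)) := by
    have hc : ContinuousAt (fderiv ℝ f) a :=
      (hf.self_of_nhds.fderiv_right (m := 0) (by simp)).continuousAt
    rw [ContinuousAt, hf'.fderiv] at hc
    exact hc.eventually (ContinuousLinearEquiv.nhds f')
  refine ⟨e.symm, hsymm, ?_, ?_, ?_⟩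
  · filter_upwards [e.open_target.mem_nhds hta, hcont.eventually hf, hcont.eventually hinv]
      with y hy h1 ⟨A, hA⟩
    have hd : HasFDerivAt e (A : E →L[ℝ] F) (e.symm y) := by
      have := (h1.differentiableAt (by simp)).hasFDerivAt
      rw [← hA] at this
      exact this.congr_of_eventuallyEq (Eventually.of_forall hef)
    exact e.contDiffAt_symm hy hd (h1.congr_of_eventuallyEq (Eventually.of_forall hef))
  · filter_upwards [e.open_target.mem_nhds hta] with y hy
    rw [← hef]; exact e.right_inv hy
  · filter_upwards [e.open_source.mem_nhds hea] with x hx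
    rw [← hef]; exact e.left_inv hx

end Inverse

/-! ### Smoothness of composition operators on spaces of continuous maps -/

section Composition

variable {K : Type*} [TopologicalSpace K] [CompactSpace K]
  {E : Type v} [NormedAddCommGroup E] [NormedSpace ℝ E]

/-- Pointwise application of a continuous family of continuous linear maps. -/
noncomputable def applyFamily (K : Type*) [TopologicalSpace K] [CompactSpace K]
    (E F : Type v) [NormedAddCommGroup E] [NormedSpace ℝ E] [NormedAddCommGroup F]
    [NormedSpace ℝ F] : C(K, E →L[ℝ] F) →L[ℝ] C(K, E) →L[ℝ] C(K, F) :=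
  LinearMap.mkContinuous₂
    (LinearMap.mk₂ ℝ (fun (A : C(K, E →L[ℝ] F)) (h : C(K, E)) =>
      (⟨fun t => A t (h t), by fun_prop⟩ : C(K, F)))
      (fun A B h => by ext t; simp) (fun c A h => by ext t; simp)
      (fun A h k => by ext t; simp) (fun c A h => by ext t; simp)) 1
    (fun A h => by
      rw [one_mul, ContinuousMap.norm_le _ (by positivity)]
      intro t
      exact ((A t).le_opNorm _).trans
        (mul_le_mul (A.norm_coe_le_norm t) (h.norm_coe_le_norm t) (norm_nonneg _)
          ((norm_nonneg _).trans (A.norm_coe_le_norm t))))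

theorem applyFamily_apply {F : Type v} [NormedAddCommGroup F] [NormedSpace ℝ F]
    (A : C(K, E →L[ℝ] F)) (h : C(K, E)) (t : K) : applyFamily K E F A h t = A t (h t) := rfl

/-- The range of `γ` is compact, so `f'` is uniformly continuous there, and the mean value
inequality bounds the remainder by `ε * ‖h‖` uniformly in `t`. -/
theorem hasFDerivAt_postcomp {F : Type v} [NormedAddCommGroup F] [NormedSpace ℝ F]
    (f : C(E, F)) (f' : C(E, E →L[ℝ] F)) (hf : ∀ x, HasFDerivAt f (f' x) x) (γ : C(K, E)) :
    HasFDerivAt (fun γ : C(K, E) => f.comp γ) (applyFamily K E F (f'.comp γ)) γ := by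
  rw [hasFDerivAt_iff_isLittleO_nhds_zero, Asymptotics.isLittleO_iff]
  intro ε hε
  have hK : IsCompact (Set.range γ) := isCompact_range γ.continuous
  have h1 := hK.uniformContinuousAt_of_continuousAt f' (fun a _ => f'.continuous.continuousAt)
    (Metric.dist_mem_uniformity hε)
  obtain ⟨δ, hδ, h2⟩ := Metric.mem_uniformity_dist.1 h1
  filter_upwards [Metric.ball_mem_nhds (0 : C(K, E)) hδ] with h hh
  rw [ContinuousMap.norm_le _ (by positivity)]
  intro t
  have hht : ‖h t‖ < δ := (h.norm_coe_le_norm t).trans_lt (by simpa using hh)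
  have key := Convex.norm_image_sub_le_of_norm_hasFDerivWithin_le' (f := f) (f' := fun x => f' x)
    (φ := f' (γ t)) (C := ε) (s := Metric.ball (γ t) δ) (x := γ t) (y := γ t + h t)
    (fun x _ => (hf x).hasFDerivWithinAt) (fun x hx => by
      have := h2 (a := γ t) (b := x) (by rwa [dist_comm]) ⟨t, rfl⟩
      simp only [Set.mem_ofPred_eq] at this
      rw [← dist_eq_norm, dist_comm]; exact this.le)
    (convex_ball _ _) (Metric.mem_ball_self hδ) (by simpa [dist_eq_norm] using hht)
  have e1 : (f.comp (γ + h) - f.comp γ - (applyFamily K E F (f'.comp γ)) h) t =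
      f (γ t + h t) - f (γ t) - f' (γ t) (γ t + h t - γ t) := by
    simp [applyFamily_apply]
  rw [e1]
  refine key.trans ?_
  simp only [add_sub_cancel_left]
  exact mul_le_mul_of_nonneg_left (h.norm_coe_le_norm t) hε.le

/-- The composition operator `γ ↦ f ∘ γ` on continuous maps from a compact space is smooth. -/
theorem contDiff_postcomp {F : Type v} [NormedAddCommGroup F] [NormedSpace ℝ F]
    (f : C(E, F)) (hf : ContDiff ℝ ∞ f) : ContDiff ℝ ∞ (fun γ : C(K, E) => f.comp γ) := by
  -- The derivative is again a composition operator, for `f'`, followed by the linear map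
  -- `applyFamily`. The target `F` varies in the induction because `f'` takes values in `E →L[ℝ] F`.
  have key : ∀ n : ℕ, ∀ {F : Type v} [NormedAddCommGroup F] [NormedSpace ℝ F] (f : C(E, F)),
      ContDiff ℝ n f → ContDiff ℝ n (fun γ : C(K, E) => f.comp γ) := by
    intro n
    induction n with
    | zero =>
      intro F _ _ f _
      exact contDiff_zero.2 (ContinuousMap.continuous_postcomp f)
    | succ n ih =>
      intro F _ _ f hf
      obtain ⟨f', hf', hd⟩ := contDiff_succ_iff_hasFDerivAt.1 hf
      let g : C(E, E →L[ℝ] F) := ⟨f', hf'.continuous⟩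
      refine contDiff_succ_iff_hasFDerivAt.2 ⟨fun γ => applyFamily K E F (g.comp γ), ?_, ?_⟩
      · exact (applyFamily K E F).contDiff.comp (ih g hf')
      · exact fun γ => hasFDerivAt_postcomp f g hd γ
  exact contDiff_infty.2 fun n => key n f (contDiff_infty.1 hf n)

end Composition

/-! ### Smooth local flows in Banach spaces, by the inverse function theorem -/

section LocalFlow

set_option linter.unusedSectionVars false

variable {E : Type v} [NormedAddCommGroup E] [NormedSpace ℝ E] [CompleteSpace E]

/-- The time interval on which rescaled integral curves live. -/
abbrev UnitTime : Type := Icc (-1 : ℝ) 1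

theorem UnitTime.le : (-1 : ℝ) ≤ 1 := by norm_num

/-- The endpoint `1` of the unit time interval. -/
def UnitTime.one : UnitTime := ⟨1, by norm_num⟩

theorem norm_primitive_le (g : C(UnitTime, E)) (τ : UnitTime) :
    ‖∫ σ in (0 : ℝ)..τ, IccExtend UnitTime.le g σ‖ ≤ ‖g‖ := by
  have h := intervalIntegral.norm_integral_le_of_norm_le_const (a := (0 : ℝ)) (b := τ) (C := ‖g‖)
    (f := fun σ => IccExtend UnitTime.le g σ) (fun σ _ => g.norm_coe_le_norm _)
  refine h.trans ?_
  have : |(τ : ℝ) - 0| ≤ 1 := by rw [sub_zero, abs_le]; exact τ.2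
  nlinarith [norm_nonneg g]

theorem continuous_iccExtend (g : C(UnitTime, E)) : Continuous (IccExtend UnitTime.le g) :=
  g.continuous.Icc_extend'

/-- The primitive vanishing at `0`, as a continuous linear map. -/
noncomputable def primitive (E : Type v) [NormedAddCommGroup E] [NormedSpace ℝ E]
    [CompleteSpace E] : C(UnitTime, E) →L[ℝ] C(UnitTime, E) :=
  LinearMap.mkContinuous
    { toFun := fun g => ⟨fun τ => ∫ σ in (0 : ℝ)..τ, IccExtend UnitTime.le g σ,
        (intervalIntegral.continuous_primitive
          (fun a b => (continuous_iccExtend g).intervalIntegrable a b) 0).comp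
          continuous_subtype_val⟩
      map_add' := fun g h => by
        ext τ
        exact intervalIntegral.integral_add ((continuous_iccExtend g).intervalIntegrable _ _)
          ((continuous_iccExtend h).intervalIntegrable _ _)
      map_smul' := fun c g => by
        ext τ
        exact intervalIntegral.integral_smul c _ } 1
    (fun g => by
      rw [one_mul, ContinuousMap.norm_le _ (norm_nonneg g)]
      exact fun τ => norm_primitive_le g τ)

theorem primitive_apply (g : C(UnitTime, E)) (τ : UnitTime) :
    primitive E g τ = ∫ σ in (0 : ℝ)..τ, IccExtend UnitTime.le g σ := rfl

/-- The constant function, as a continuous linear map. -/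
noncomputable def constCurve (E : Type v) [NormedAddCommGroup E] [NormedSpace ℝ E] :
    E →L[ℝ] C(UnitTime, E) :=
  LinearMap.mkContinuous
    { toFun := fun v => ContinuousMap.const _ v
      map_add' := fun _ _ => rfl
      map_smul' := fun _ _ => rfl } 1
    (fun v => by
      rw [one_mul, ContinuousMap.norm_le _ (norm_nonneg v)]
      exact fun τ => le_rfl)

theorem constCurve_apply (v : E) (τ : UnitTime) : constCurve E v τ = v := rfl

/-- The operator whose zeros are the solutions of the rescaled initial value problems. -/
noncomputable def odeOperator (f : C(E, E)) (p : (ℝ × E) × C(UnitTime, E)) : C(UnitTime, E) :=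
  p.2 - constCurve E p.1.2 - p.1.1 • primitive E (f.comp p.2)

theorem contDiff_odeOperator (f : C(E, E)) (hf : ContDiff ℝ ∞ f) :
    ContDiff ℝ ∞ (odeOperator f) := by
  unfold odeOperator
  have h1 : ContDiff ℝ ∞ (fun p : (ℝ × E) × C(UnitTime, E) => primitive E (f.comp p.2)) :=
    (primitive E).contDiff.comp ((contDiff_postcomp f hf).comp contDiff_snd)
  have h2 : ContDiff ℝ ∞ (fun p : (ℝ × E) × C(UnitTime, E) => constCurve E p.1.2) :=
    (constCurve E).contDiff.comp (contDiff_snd.comp contDiff_fst)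
  exact (contDiff_snd.sub h2).sub ((contDiff_fst.comp contDiff_fst).smul h1)

/-- The shear `(p, q) ↦ (p, q - T p)`. -/
noncomputable def shear {P Q : Type*} [NormedAddCommGroup P] [NormedSpace ℝ P]
    [NormedAddCommGroup Q] [NormedSpace ℝ Q] (T : P →L[ℝ] Q) : (P × Q) ≃L[ℝ] (P × Q) :=
  ContinuousLinearEquiv.equivOfInverse
    ((ContinuousLinearMap.fst ℝ P Q).prod
      (ContinuousLinearMap.snd ℝ P Q - T.comp (ContinuousLinearMap.fst ℝ P Q)))
    ((ContinuousLinearMap.fst ℝ P Q).prod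
      (ContinuousLinearMap.snd ℝ P Q + T.comp (ContinuousLinearMap.fst ℝ P Q)))
    (fun x => by ext <;> simp) (fun x => by ext <;> simp)

/-- At time parameter `0` the integral term carries the factor `0`, so the partial derivative in the
curve variable is the identity. The full derivative is therefore a shear, which is invertible. -/
theorem hasFDerivAt_odeOperator (f : C(E, E)) (hf : ContDiff ℝ ∞ f) (v₀ : E) :
    ∃ T : (ℝ × E) →L[ℝ] C(UnitTime, E),
      HasFDerivAt (fun p => (p.1, odeOperator f p))
        (shear T : (ℝ × E) × C(UnitTime, E) →L[ℝ] (ℝ × E) × C(UnitTime, E))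
        ((0, v₀), constCurve E v₀) := by
  set p₀ : (ℝ × E) × C(UnitTime, E) := ((0, v₀), constCurve E v₀) with hp₀
  set c := primitive E (f.comp (constCurve E v₀)) with hc
  have h1 : ContDiff ℝ ∞ (fun p : (ℝ × E) × C(UnitTime, E) => primitive E (f.comp p.2)) :=
    (primitive E).contDiff.comp ((contDiff_postcomp f hf).comp contDiff_snd)
  have h1' := ((h1.differentiable (by simp)) p₀).hasFDerivAt
  have h2 : HasFDerivAt (fun p : (ℝ × E) × C(UnitTime, E) => p.1.1)
      ((ContinuousLinearMap.fst ℝ ℝ E).comp (ContinuousLinearMap.fst ℝ _ _)) p₀ :=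
    ((ContinuousLinearMap.fst ℝ ℝ E).comp
      (ContinuousLinearMap.fst ℝ (ℝ × E) C(UnitTime, E))).hasFDerivAt
  have h3 := h2.smul h1'
  have h4 : HasFDerivAt (fun p : (ℝ × E) × C(UnitTime, E) => constCurve E p.1.2)
      ((constCurve E).comp ((ContinuousLinearMap.snd ℝ ℝ E).comp
        (ContinuousLinearMap.fst ℝ _ _))) p₀ :=
    ((constCurve E).comp ((ContinuousLinearMap.snd ℝ ℝ E).comp
      (ContinuousLinearMap.fst ℝ (ℝ × E) C(UnitTime, E)))).hasFDerivAt
  have h5 : HasFDerivAt (fun p : (ℝ × E) × C(UnitTime, E) => p.2)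
      (ContinuousLinearMap.snd ℝ _ _) p₀ := hasFDerivAt_snd
  refine ⟨(constCurve E).comp (ContinuousLinearMap.snd ℝ ℝ E) +
    (ContinuousLinearMap.fst ℝ ℝ E).smulRight c, ?_⟩
  refine (hasFDerivAt_fst.prodMk ((h5.sub h4).sub h3)).congr_fderiv ?_
  refine ContinuousLinearMap.ext fun x => ?_
  refine Prod.ext rfl ?_
  simp [shear, hp₀, hc, sub_sub]

/-- A smooth vector field on a Banach space has a smooth local flow. -/
theorem exists_local_flow (f : C(E, E)) (hf : ContDiff ℝ ∞ f) (v₀ : E) :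
    ∃ φ : ℝ × E → E, ∃ δ > 0,
      (∀ s ∈ Ioo (-δ) δ, ∀ v ∈ Metric.ball v₀ δ, ContDiffAt ℝ ∞ φ (s, v) ∧
        HasDerivAt (fun s => φ (s, v)) (f (φ (s, v))) s) ∧
      ∀ v ∈ Metric.ball v₀ δ, φ (0, v) = v := by
  obtain ⟨T, hT⟩ := hasFDerivAt_odeOperator f hf v₀
  set G : (ℝ × E) × C(UnitTime, E) → (ℝ × E) × C(UnitTime, E) :=
    fun p => (p.1, odeOperator f p) with hG
  have hGs : ContDiff ℝ ∞ G := contDiff_fst.prodMk (contDiff_odeOperator f hf)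
  -- The equation `γ τ = v + s • ∫ σ in 0..τ, f (γ σ)` has the time `s` as a parameter, and all
  -- curves live on `[-1, 1]`. Inverting `G` at `(q, 0)` solves it smoothly in `q = (s, v)`.
  obtain ⟨g, hg0, hgs, hgr, hgl⟩ := exists_smooth_local_inverse
    (Eventually.of_forall fun x => hGs.contDiffAt) (shear T) hT
  have hGp : G ((0, v₀), constCurve E v₀) = ((0, v₀), 0) := by
    simp [hG, odeOperator]
  rw [hGp] at hgs hgr hg0
  -- the solution operator
  set S : ℝ × E → C(UnitTime, E) := fun q => (g (q, 0)).2 with hS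
  have hS0 : S (0, v₀) = constCurve E v₀ := by simp [hS, hg0]
  have hpair : Continuous (fun q : ℝ × E => (q, (0 : C(UnitTime, E)))) := by fun_prop
  have hSs : ∀ᶠ q in 𝓝 ((0 : ℝ), v₀), ContDiffAt ℝ ∞ S q := by
    filter_upwards [hpair.continuousAt.eventually hgs] with q hq
    exact (hq.comp q (by fun_prop)).snd
  have hSeq : ∀ᶠ q in 𝓝 ((0 : ℝ), v₀), odeOperator f (q, S q) = 0 := by
    filter_upwards [hpair.continuousAt.eventually hgr] with q hq
    have h1 : (g (q, 0)).1 = q := congrArg Prod.fst hq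
    have h2 : odeOperator f (g (q, 0)) = 0 := congrArg Prod.snd hq
    rw [← h2]
    exact congrArg _ (Prod.ext h1.symm rfl)
  -- Local uniqueness: a solution close to the constant curve is the one given by `S`.
  have hun : ∀ᶠ p in 𝓝 (((0 : ℝ), v₀), constCurve E v₀), odeOperator f p = 0 → S p.1 = p.2 := by
    filter_upwards [hgl] with p hp h0
    have : G p = (p.1, 0) := by simp [hG, h0]
    rw [this] at hp
    simp [hS, hp]
  obtain ⟨ρ, hρ, hun⟩ := Metric.eventually_nhds_iff.1 hun
  have hSc : ∀ᶠ q in 𝓝 ((0 : ℝ), v₀), dist (S q) (constCurve E v₀) < ρ := by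
    have := hSs.self_of_nhds.continuousAt
    rw [ContinuousAt, hS0] at this
    exact this.eventually (Metric.ball_mem_nhds _ hρ)
  obtain ⟨δ', hδ', hall⟩ := Metric.eventually_nhds_iff.1 (hSs.and (hSeq.and hSc))
  set δ := min δ' ρ with hδ
  have hδpos : 0 < δ := lt_min hδ' hρ
  have hnear : ∀ s ∈ Ioo (-δ) δ, ∀ v ∈ Metric.ball v₀ δ, dist (s, v) ((0 : ℝ), v₀) < δ := by
    intro s hs v hv
    rw [Prod.dist_eq, max_lt_iff]
    refine ⟨?_, hv⟩
    rw [Real.dist_eq, sub_zero, abs_lt]; exact hs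
  -- integral form of the equation
  have hint : ∀ s ∈ Ioo (-δ) δ, ∀ v ∈ Metric.ball v₀ δ, ∀ τ : UnitTime,
      S (s, v) τ = v + s • ∫ σ in (0 : ℝ)..τ, f (IccExtend UnitTime.le (S (s, v)) σ) := by
    intro s hs v hv τ
    have h := (hall ((hnear s hs v hv).trans_le (min_le_left _ _))).2.1
    have h2 := congrArg (fun c : C(UnitTime, E) => c τ) h
    simp only [odeOperator, ContinuousMap.sub_apply, ContinuousMap.smul_apply, primitive_apply,
      constCurve_apply, ContinuousMap.zero_apply] at h2
    rw [sub_sub, sub_eq_zero] at h2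
    exact h2
  -- rescaling
  have hscale : ∀ s ∈ Ioo (-δ) δ, ∀ v ∈ Metric.ball v₀ δ, ∀ τ : UnitTime,
      S (s * τ, v) UnitTime.one = S (s, v) τ := by
    intro s hs v hv τ
    have hτ : |(τ : ℝ)| ≤ 1 := abs_le.2 τ.2
    have hmul : ∀ σ : UnitTime, (τ : ℝ) * σ ∈ Icc (-1 : ℝ) 1 := fun σ => by
      rw [mem_Icc, ← abs_le, abs_mul]
      exact mul_le_one₀ hτ (abs_nonneg _) (abs_le.2 σ.2)
    -- Slowing a solution down by the factor `τ` solves the problem with time parameter `s * τ` and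
    -- stays within `ρ` of the constant curve, so uniqueness identifies it with `S (s * τ, v)`.
    let γ : C(UnitTime, E) := ⟨fun σ => S (s, v) ⟨τ * σ, hmul σ⟩, by fun_prop⟩
    have hst : s * τ ∈ Ioo (-δ) δ := by
      rw [mem_Ioo, ← abs_lt, abs_mul] at *
      nlinarith [abs_nonneg s, abs_nonneg (τ : ℝ)]
    have hode : odeOperator f ((s * τ, v), γ) = 0 := by
      ext σ
      simp only [odeOperator, ContinuousMap.sub_apply, ContinuousMap.smul_apply, primitive_apply,
        constCurve_apply, ContinuousMap.zero_apply]
      rw [sub_sub, sub_eq_zero]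
      change S (s, v) ⟨τ * σ, hmul σ⟩ = _
      rw [hint s hs v hv, mul_smul]
      congr 2
      rw [← mul_zero (τ : ℝ), ← intervalIntegral.smul_integral_comp_mul_left, mul_zero]
      congr 1
      refine intervalIntegral.integral_congr fun x hx => ?_
      have hx1 : x ∈ Icc (-1 : ℝ) 1 := by
        refine (uIcc_subset_Icc ?_ σ.2) hx
        constructor <;> norm_num
      change f (IccExtend UnitTime.le (S (s, v)) (τ * x)) = IccExtend UnitTime.le (f.comp γ) x
      rw [IccExtend_of_mem _ _ hx1, IccExtend_of_mem _ _ (hmul ⟨x, hx1⟩)]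
      rfl
    have hd : dist ((s * τ, v), γ) (((0 : ℝ), v₀), constCurve E v₀) < ρ := by
      rw [Prod.dist_eq, max_lt_iff]
      refine ⟨(hnear _ hst v hv).trans_le (min_le_right _ _), ?_⟩
      have h3 := (hall ((hnear s hs v hv).trans_le (min_le_left _ _))).2.2
      refine lt_of_le_of_lt ?_ h3
      rw [ContinuousMap.dist_le dist_nonneg]
      exact fun σ => ContinuousMap.dist_apply_le_dist (f := S (s, v)) (g := constCurve E v₀) _
    rw [hun hd hode]
    change S (s, v) ⟨τ * 1, _⟩ = _
    congr 1
    ext; simp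
  -- The flow is the value of the rescaled solution at rescaled time `1`.
  refine ⟨fun q => S q UnitTime.one, δ, hδpos, fun s hs v hv => ⟨?_, ?_⟩, fun v hv => ?_⟩
  · have h1 := (hall ((hnear s hs v hv).trans_le (min_le_left _ _))).1
    exact (ContinuousMap.evalCLM ℝ UnitTime.one : C(UnitTime, E) →L[ℝ] E).contDiff.contDiffAt.comp
      (s, v) h1
  · have habs : |s| < δ := abs_lt.2 hs
    -- With a fixed larger time `s₁`, all values at times `s'` near `s` are read off from the single
    -- curve `S (s₁, v)`. Differentiating in time becomes differentiating an integral in its upper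
    -- limit.
    set s₁ := (|s| + δ) / 2 with hs₁
    have hs₁p : |s| < s₁ := by rw [hs₁]; linarith
    have hpos : 0 < s₁ := (abs_nonneg s).trans_lt hs₁p
    have hs₁m : s₁ ∈ Ioo (-δ) δ := by constructor <;> rw [hs₁] <;> linarith [abs_nonneg s]
    set h := fun σ => f (IccExtend UnitTime.le (S (s₁, v)) σ) with hh
    have hcont : Continuous h := f.continuous.comp (continuous_iccExtend _)
    have hmem : ∀ s', |s'| < s₁ → s' / s₁ ∈ Icc (-1 : ℝ) 1 := fun s' hs' => by
      rw [mem_Icc, ← abs_le, abs_div, abs_of_pos hpos]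
      exact (div_le_one hpos).2 hs'.le
    have hform : ∀ s', |s'| < s₁ → S (s', v) UnitTime.one =
        v + s₁ • ∫ σ in (0 : ℝ)..(s' / s₁), h σ := by
      intro s' hs'
      have := hscale s₁ hs₁m v hv ⟨s' / s₁, hmem s' hs'⟩
      rw [mul_div_cancel₀ _ hpos.ne'] at this
      rw [this, hint s₁ hs₁m v hv]
    have hval : f (S (s, v) UnitTime.one) = h (s / s₁) := by
      have := hscale s₁ hs₁m v hv ⟨s / s₁, hmem s hs₁p⟩
      rw [mul_div_cancel₀ _ hpos.ne'] at this
      rw [hh, this]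
      simp only
      rw [IccExtend_of_mem _ _ (hmem s hs₁p)]
    have hder : HasDerivAt (fun s' => v + s₁ • ∫ σ in (0 : ℝ)..(s' / s₁), h σ) (h (s / s₁)) s := by
      have h1 : HasDerivAt (fun u => ∫ σ in (0 : ℝ)..u, h σ) (h (s / s₁)) (s / s₁) :=
        (hcont.integral_hasStrictDerivAt 0 (s / s₁)).hasDerivAt
      have h2 : HasDerivAt (fun s' : ℝ => s' / s₁) (1 / s₁) s := (hasDerivAt_id s).div_const s₁
      have h3 := ((h1.scomp s h2).const_smul s₁).const_add v
      refine h3.congr_deriv ?_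
      rw [smul_smul, mul_one_div_cancel hpos.ne', one_smul]
    rw [hval]
    refine hder.congr_of_eventuallyEq ?_
    filter_upwards [(isOpen_lt continuous_abs continuous_const).mem_nhds hs₁p] with s' hs'
    exact hform s' hs'
  · have h0 : (0 : ℝ) ∈ Ioo (-δ) δ := ⟨by linarith, hδpos⟩
    have := hint 0 h0 v hv UnitTime.one
    simpa using this

end LocalFlow

/-- A vector field that is smooth near `v₀` has a smooth local flow near `v₀`. -/
theorem exists_local_flow_near {E : Type v} [NormedAddCommGroup E] [NormedSpace ℝ E]
    [FiniteDimensional ℝ E] {f : E → E} {v₀ : E} (hf : ∀ᶠ v in 𝓝 v₀, ContDiffAt ℝ ∞ f v)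
    {W : Set E} (hW : W ∈ 𝓝 v₀) :
    ∃ φ : ℝ × E → E, ∃ δ > 0,
      (∀ s ∈ Ioo (-δ) δ, ∀ v ∈ Metric.ball v₀ δ, ContDiffAt ℝ ∞ φ (s, v) ∧ φ (s, v) ∈ W ∧
        HasDerivAt (fun s => φ (s, v)) (f (φ (s, v))) s) ∧
      ∀ v ∈ Metric.ball v₀ δ, φ (0, v) = v := by
  have : CompleteSpace E := FiniteDimensional.complete ℝ E
  obtain ⟨r, hr, hball⟩ := Metric.eventually_nhds_iff_ball.1 hf
  -- The cut-off makes the field globally smooth and does not change it on the ball of radius `r /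
  -- 3`, in which the flow is kept by shrinking `δ`.
  let b : ContDiffBump v₀ := ⟨r / 3, r / 2, by positivity, by linarith⟩
  have hF : ContDiff ℝ ∞ (fun v => b v • f v) := by
    rw [contDiff_iff_contDiffAt]
    intro v
    by_cases hv : v ∈ Metric.ball v₀ r
    · exact b.contDiffAt.smul (hball v hv)
    · have hnot : v ∉ tsupport b := by
        rw [b.tsupport_eq]
        intro h
        exact hv (Metric.closedBall_subset_ball (by change r / 2 < r; linarith) h)
      refine (contDiffAt_const (c := (0 : E))).congr_of_eventuallyEq ?_
      filter_upwards [(isClosed_tsupport b).isOpen_compl.mem_nhds hnot] with w hw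
      rw [image_eq_zero_of_notMem_tsupport hw, zero_smul]
  obtain ⟨φ, δ, hδ, h1, h2⟩ := exists_local_flow ⟨_, hF.continuous⟩ hF v₀
  have h00 : φ (0, v₀) = v₀ := h2 v₀ (Metric.mem_ball_self hδ)
  have hc : ContinuousAt φ (0, v₀) :=
    (h1 0 ⟨by linarith, hδ⟩ v₀ (Metric.mem_ball_self hδ)).1.continuousAt
  have hev : ∀ᶠ q in 𝓝 ((0 : ℝ), v₀), φ q ∈ W ∩ Metric.ball v₀ (r / 3) := by
    rw [ContinuousAt, h00] at hc
    exact hc.eventually (inter_mem hW (Metric.ball_mem_nhds _ (by positivity)))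
  obtain ⟨δ₂, hδ₂, h3⟩ := Metric.eventually_nhds_iff.1 hev
  refine ⟨φ, min δ δ₂, lt_min hδ hδ₂, fun s hs v hv => ?_, fun v hv =>
    h2 v (Metric.ball_subset_ball (min_le_left _ _) hv)⟩
  have hs1 : s ∈ Ioo (-δ) δ :=
    Ioo_subset_Ioo (neg_le_neg (min_le_left _ _)) (min_le_left _ _) hs
  have hv1 := Metric.ball_subset_ball (min_le_left δ δ₂) hv
  have h4 : φ (s, v) ∈ W ∩ Metric.ball v₀ (r / 3) := by
    refine h3 ?_
    rw [Prod.dist_eq, max_lt_iff]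
    refine ⟨?_, Metric.ball_subset_ball (min_le_right δ δ₂) hv⟩
    rw [Real.dist_eq, sub_zero, abs_lt]
    exact Ioo_subset_Ioo (neg_le_neg (min_le_right _ _)) (min_le_right _ _) hs
  refine ⟨(h1 s hs1 v hv1).1, h4.1, ?_⟩
  have h5 := (h1 s hs1 v hv1).2
  have h6 : b (φ (s, v)) = 1 := b.one_of_mem_closedBall (Metric.ball_subset_closedBall h4.2)
  simpa [h6] using h5

/-! ### Tangent maps, velocities and vector fields read in charts -/

section Charts

variable {E : Type v} [NormedAddCommGroup E] [NormedSpace ℝ E]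
  {M : Type u} [TopologicalSpace M] [ChartedSpace E M]

/-- The derivative of a map between manifolds, as a map between the model spaces. -/
noncomputable def tmap {E' : Type*} [NormedAddCommGroup E'] [NormedSpace ℝ E']
    {M' : Type*} [TopologicalSpace M'] [ChartedSpace E' M'] (f : M → M') (x : M) : E →L[ℝ] E' :=
  mfderiv 𝓘(ℝ, E) 𝓘(ℝ, E') f x

/-- The tangent vector to a curve. -/
def HasVelocity (γ : ℝ → M) (t : ℝ) (ξ : E) : Prop :=
  HasMFDerivAt 𝓘(ℝ, ℝ) 𝓘(ℝ, E) γ t ((1 : ℝ →L[ℝ] ℝ).smulRight ξ : ℝ →L[ℝ] E)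

section tmap

variable {E' : Type*} [NormedAddCommGroup E'] [NormedSpace ℝ E']
  {M' : Type*} [TopologicalSpace M'] [ChartedSpace E' M']
  {E'' : Type*} [NormedAddCommGroup E''] [NormedSpace ℝ E'']
  {M'' : Type*} [TopologicalSpace M''] [ChartedSpace E'' M'']

theorem tmap_comp {g : M' → M''} {f : M → M'} {x : M}
    (hg : MDifferentiableAt 𝓘(ℝ, E') 𝓘(ℝ, E'') g (f x))
    (hf : MDifferentiableAt 𝓘(ℝ, E) 𝓘(ℝ, E') f x) :
    tmap (E := E) (E' := E'') (g ∘ f) x =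
      (tmap (E := E') (E' := E'') g (f x)).comp (tmap (E := E) (E' := E') f x) :=
  mfderiv_comp x hg hf

theorem tmap_comp_apply {g : M' → M''} {f : M → M'} {x : M}
    (hg : MDifferentiableAt 𝓘(ℝ, E') 𝓘(ℝ, E'') g (f x))
    (hf : MDifferentiableAt 𝓘(ℝ, E) 𝓘(ℝ, E') f x) (ξ : E) :
    tmap (E := E) (E' := E'') (g ∘ f) x ξ =
      tmap (E := E') (E' := E'') g (f x) (tmap (E := E) (E' := E') f x ξ) := by
  rw [tmap_comp hg hf]; rfl

theorem tmap_id (x : M) : tmap (E := E) (E' := E) (id : M → M) x = ContinuousLinearMap.id ℝ E :=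
  mfderiv_id

theorem tmap_congr {f g : M → M'} {x : M} (h : f =ᶠ[𝓝 x] g) :
    tmap (E := E) (E' := E') f x = tmap (E := E) (E' := E') g x :=
  h.mfderiv_eq

theorem tmap_eq_fderiv {f : E → E'} {x : E} : tmap (E := E) (E' := E') f x = fderiv ℝ f x :=
  mfderiv_eq_fderiv

theorem tmap_of_isLocalInverse {f : M → M'} {g : M' → M} {x : M}
    (hf : MDifferentiableAt 𝓘(ℝ, E) 𝓘(ℝ, E') f x)
    (hg : MDifferentiableAt 𝓘(ℝ, E') 𝓘(ℝ, E) g (f x)) (h : ∀ᶠ y in 𝓝 x, g (f y) = y) (ξ : E) :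
    tmap (E := E') (E' := E) g (f x) (tmap (E := E) (E' := E') f x ξ) = ξ := by
  rw [← tmap_comp_apply hg hf, tmap_congr (f := g ∘ f) (g := id) h, tmap_id]; rfl

theorem hasVelocity_iff_hasDerivAt {γ : ℝ → E} {t : ℝ} {ξ : E} :
    HasVelocity (E := E) γ t ξ ↔ HasDerivAt γ ξ t := by
  have h : HasVelocity (E := E) γ t ξ ↔
      HasFDerivAt γ ((1 : ℝ →L[ℝ] ℝ).smulRight ξ : ℝ →L[ℝ] E) t := hasMFDerivAt_iff_hasFDerivAt
  rw [h, hasDerivAt_iff_hasFDerivAt]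
  exact ⟨fun h => h.congr_fderiv (by ext; simp), fun h => h.congr_fderiv (by ext; simp)⟩

/-- The chain rule for velocities. -/
theorem HasVelocity.comp {γ : ℝ → M} {t : ℝ} {ξ : E} (hγ : HasVelocity γ t ξ)
    {f : M → M'} (hf : MDifferentiableAt 𝓘(ℝ, E) 𝓘(ℝ, E') f (γ t)) :
    HasVelocity (f ∘ γ) t (tmap (E := E) (E' := E') f (γ t) ξ) := by
  refine (hf.hasMFDerivAt.comp t hγ).congr_mfderiv ?_
  exact ContinuousLinearMap.ext fun r =>
    (tmap (E := E) (E' := E') f (γ t)).map_smul ((1 : ℝ →L[ℝ] ℝ) r) ξ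

end tmap

theorem HasVelocity.congr {γ γ' : ℝ → M} {t : ℝ} {ξ : E} (h : HasVelocity γ t ξ)
    (hγ : γ' =ᶠ[𝓝 t] γ) : HasVelocity γ' t ξ :=
  HasMFDerivAt.congr_of_eventuallyEq h hγ

theorem HasVelocity.continuousAt {γ : ℝ → M} {t : ℝ} {ξ : E} (h : HasVelocity γ t ξ) :
    ContinuousAt γ t :=
  HasMFDerivAt.continuousAt h

/-- The chain rule for reparametrizations. -/
theorem HasVelocity.scomp {γ : ℝ → M} {t c : ℝ} {h : ℝ → ℝ} {ξ : E}
    (hγ : HasVelocity γ (h t) ξ) (hh : HasDerivAt h c t) :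
    HasVelocity (γ ∘ h) t (c • ξ) := by
  have h1 : HasVelocity (E := ℝ) h t c := hasVelocity_iff_hasDerivAt.2 hh
  refine (HasMFDerivAt.comp t hγ h1).congr_mfderiv ?_
  exact ContinuousLinearMap.ext fun (r : ℝ) => mul_smul (α := ℝ) (β := E) r c ξ

variable [IsManifold 𝓘(ℝ, E) ∞ M] (X : LocalVectorField E M)

/-- The value of a local vector field, in the model space. -/
def LocalVectorField.val (x : M) : E := X.toFun x

/-- A local vector field read in the preferred chart at `x₀`. -/
noncomputable def LocalVectorField.inChart (x₀ : M) : E → E :=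
  fun w => (tmap (E := E) (E' := E) (chartAt E x₀).symm w).inverse
    (X.val ((chartAt E x₀).symm w))

theorem mdifferentiable_chartAt (x₀ : M) :
    (chartAt E x₀).MDifferentiable 𝓘(ℝ, E) 𝓘(ℝ, E) :=
  haveI : IsManifold 𝓘(ℝ, E) 1 M := IsManifold.of_le (n := ∞) (by simp)
  mdifferentiable_chart x₀

theorem tmap_chartAt_symm_tmap (x₀ : M) {m : M} (hm : m ∈ (chartAt E x₀).source) (ξ : E) :
    tmap (E := E) (E' := E) (chartAt E x₀).symm (chartAt E x₀ m)
      (tmap (E := E) (E' := E) (chartAt E x₀) m ξ) = ξ :=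
  tmap_of_isLocalInverse ((mdifferentiable_chartAt x₀).mdifferentiableAt hm)
    ((mdifferentiable_chartAt x₀).mdifferentiableAt_symm ((chartAt E x₀).map_source hm))
    ((chartAt E x₀).eventually_left_inverse hm) ξ

theorem tmap_chartAt_tmap_symm (x₀ : M) {w : E} (hw : w ∈ (chartAt E x₀).target) (ξ : E) :
    tmap (E := E) (E' := E) (chartAt E x₀) ((chartAt E x₀).symm w)
      (tmap (E := E) (E' := E) (chartAt E x₀).symm w ξ) = ξ :=
  tmap_of_isLocalInverse ((mdifferentiable_chartAt x₀).mdifferentiableAt_symm hw)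
    ((mdifferentiable_chartAt x₀).mdifferentiableAt ((chartAt E x₀).map_target hw))
    ((chartAt E x₀).eventually_right_inverse hw) ξ

theorem isInvertible_tmap_chartAt_symm (x₀ : M) {w : E} (hw : w ∈ (chartAt E x₀).target) :
    (tmap (E := E) (E' := E) (chartAt E x₀).symm w).IsInvertible := by
  refine ContinuousLinearMap.IsInvertible.of_inverse
    (g := tmap (E := E) (E' := E) (chartAt E x₀) ((chartAt E x₀).symm w)) ?_ ?_
  · refine ContinuousLinearMap.ext fun ξ => ?_
    have := tmap_chartAt_symm_tmap x₀ ((chartAt E x₀).map_target hw) ξ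
    rwa [(chartAt E x₀).right_inv hw] at this
  · exact ContinuousLinearMap.ext fun ξ => tmap_chartAt_tmap_symm x₀ hw ξ

theorem LocalVectorField.tmap_symm_inChart (x₀ : M) {w : E} (hw : w ∈ (chartAt E x₀).target) :
    tmap (E := E) (E' := E) (chartAt E x₀).symm w (X.inChart x₀ w) =
      X.val ((chartAt E x₀).symm w) :=
  (isInvertible_tmap_chartAt_symm x₀ hw).self_apply_inverse _

theorem LocalVectorField.tmap_chartAt (x₀ : M) {m : M} (hm : m ∈ (chartAt E x₀).source) :
    tmap (E := E) (E' := E) (chartAt E x₀) m (X.val m) = X.inChart x₀ (chartAt E x₀ m) := by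
  have hw := (chartAt E x₀).map_source hm
  have h1 := X.tmap_symm_inChart x₀ hw
  have h2 := tmap_chartAt_tmap_symm x₀ hw (X.inChart x₀ (chartAt E x₀ m))
  rwa [h1, (chartAt E x₀).left_inv hm] at h2

theorem LocalVectorField.contMDiffAt {m : M} (hm : m ∈ X.domain) :
    ContMDiffAt 𝓘(ℝ, E) 𝓘(ℝ, E).tangent ∞
      (fun x : M => (⟨x, X.toFun x⟩ : TangentBundle 𝓘(ℝ, E) M)) m :=
  X.smooth.contMDiffAt (X.isOpen_domain.mem_nhds hm)

/-- `inChart` is by definition the pullback of the field along the inverse chart, whose derivative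
is invertible. -/
theorem LocalVectorField.contDiffAt_inChart [CompleteSpace E] (x₀ : M) {w : E}
    (hw : w ∈ (chartAt E x₀).target)
    (hX : (chartAt E x₀).symm w ∈ X.domain) : ContDiffAt ℝ ∞ (X.inChart x₀) w := by
  have h1 : ContMDiffAt 𝓘(ℝ, E) 𝓘(ℝ, E) ∞ (chartAt E x₀).symm w :=
    contMDiffOn_chart_symm.contMDiffAt ((chartAt E x₀).open_target.mem_nhds hw)
  have h0 : (mfderiv 𝓘(ℝ, E) 𝓘(ℝ, E) (chartAt E x₀).symm w).IsInvertible :=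
    isInvertible_tmap_chartAt_symm (E := E) x₀ hw
  have h2 := ContMDiffAt.mpullback_vectorField_preimage (X.contMDiffAt hX) h1 h0 (by simp)
  exact (contMDiffAt_vectorSpace_iff_contDiffAt (V := X.inChart x₀)).1 h2

theorem LocalVectorField.eventually_contDiffAt_inChart [CompleteSpace E] (x₀ : M) {m : M}
    (hm : m ∈ (chartAt E x₀).source)
    (hX : m ∈ X.domain) : ∀ᶠ w in 𝓝 (chartAt E x₀ m), ContDiffAt ℝ ∞ (X.inChart x₀) w := by
  have hw := (chartAt E x₀).map_source hm
  have hc := (chartAt E x₀).continuousAt_symm hw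
  rw [ContinuousAt, (chartAt E x₀).left_inv hm] at hc
  filter_upwards [(chartAt E x₀).open_target.mem_nhds hw,
    hc.eventually (X.isOpen_domain.mem_nhds hX)] with w h1 h2
  exact X.contDiffAt_inChart x₀ h1 h2

end Charts

/-! ### Flow boxes on the manifold -/

section FlowBox

variable {E : Type v} [NormedAddCommGroup E] [NormedSpace ℝ E] [FiniteDimensional ℝ E]
  {M : Type u} [TopologicalSpace M] [ChartedSpace E M] [IsManifold 𝓘(ℝ, E) ∞ M]

/-- A local vector field has a smooth local flow near every point of its domain. -/
theorem LocalVectorField.exists_flowBox (X : LocalVectorField E M) {y₀ : M} (hy₀ : y₀ ∈ X.domain) :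
    ∃ Φ : ℝ × M → M, ∃ δ > 0, ∃ U : Set M, IsOpen U ∧ y₀ ∈ U ∧ (∀ y ∈ U, Φ (0, y) = y) ∧
      ∀ s ∈ Ioo (-δ) δ, ∀ y ∈ U,
        ContMDiffAt (𝓘(ℝ, ℝ).prod 𝓘(ℝ, E)) 𝓘(ℝ, E) ∞ Φ (s, y) ∧ Φ (s, y) ∈ X.domain ∧
        HasVelocity (fun s => Φ (s, y)) s (X.val (Φ (s, y))) := by
  have : CompleteSpace E := FiniteDimensional.complete ℝ E
  set e := chartAt E y₀ with he
  have hs : y₀ ∈ e.source := mem_chart_source E y₀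
  have ht : e y₀ ∈ e.target := e.map_source hs
  have hW : e.target ∩ e.symm ⁻¹' X.domain ∈ 𝓝 (e y₀) := by
    refine inter_mem (e.open_target.mem_nhds ht) ?_
    refine (e.continuousAt_symm ht).preimage_mem_nhds ?_
    rw [e.left_inv hs]; exact X.isOpen_domain.mem_nhds hy₀
  obtain ⟨φ, δ, hδ, h1, h2⟩ := exists_local_flow_near
    (X.eventually_contDiffAt_inChart y₀ hs hy₀) hW
  refine ⟨fun q => e.symm (φ (q.1, e q.2)), δ, hδ, e.source ∩ e ⁻¹' Metric.ball (e y₀) δ,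
    e.isOpen_inter_preimage Metric.isOpen_ball, ⟨hs, Metric.mem_ball_self hδ⟩, ?_, ?_⟩
  · intro y hy
    simp only
    rw [h2 _ hy.2, e.left_inv hy.1]
  · intro s hs' y hy
    obtain ⟨h3, h4, h5⟩ := h1 s hs' _ hy.2
    refine ⟨?_, h4.2, ?_⟩
    · have a1 : ContMDiffAt 𝓘(ℝ, E) 𝓘(ℝ, E) ∞ e.symm (φ (s, e y)) :=
        contMDiffOn_chart_symm.contMDiffAt (e.open_target.mem_nhds h4.1)
      have a2 : ContMDiffAt 𝓘(ℝ, E) 𝓘(ℝ, E) ∞ e y :=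
        contMDiffOn_chart.contMDiffAt (e.open_source.mem_nhds hy.1)
      have a3 : ContMDiffAt (𝓘(ℝ, ℝ).prod 𝓘(ℝ, E)) 𝓘(ℝ, ℝ × E) ∞
          (fun q : ℝ × M => (q.1, e q.2)) (s, y) := by
        refine ContMDiffAt.prodMk_space contMDiffAt_fst ?_
        exact ContMDiffAt.comp (g := e) (s, y) a2 contMDiffAt_snd
      have a4 : ContMDiffAt (𝓘(ℝ, ℝ).prod 𝓘(ℝ, E)) 𝓘(ℝ, E) ∞
          (fun q : ℝ × M => φ (q.1, e q.2)) (s, y) :=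
        ContMDiffAt.comp (g := φ) (s, y) h3.contMDiffAt a3
      exact ContMDiffAt.comp (g := e.symm) (s, y) a1 a4
    · have b1 := (hasVelocity_iff_hasDerivAt (E := E)).2 h5
      have b2 := b1.comp (f := e.symm) ((mdifferentiable_chartAt y₀).mdifferentiableAt_symm h4.1)
      rw [X.tmap_symm_inChart y₀ h4.1] at b2
      exact b2

end FlowBox

/-! ### The maximal flow: uniqueness, group law, smoothness, pullbacks -/

section Flows

set_option linter.unusedSectionVars false

variable {E : Type v} [NormedAddCommGroup E] [NormedSpace ℝ E]
  {M : Type u} [TopologicalSpace M] [ChartedSpace E M] [IsManifold 𝓘(ℝ, E) ∞ M]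
  {X Y Z : LocalVectorField E M}

/-- `γ` is an integral curve of `X` in the domain of `X` at all times in `J`. -/
def LocalVectorField.IsCurveOn (X : LocalVectorField E M) (γ : ℝ → M) (J : Set ℝ) : Prop :=
  ∀ s ∈ J, γ s ∈ X.domain ∧ HasVelocity γ s (X.val (γ s))

/-- On an open interval the derivative within the interval is the full derivative, so integral
curves can be handled through `HasVelocity`. -/
theorem LocalVectorField.flowsTo_iff {t : ℝ} {y z : M} :
    X.FlowsTo t y z ↔ ∃ (γ : ℝ → M) (a b : ℝ), 0 ∈ Ioo a b ∧ t ∈ Ioo a b ∧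
      X.IsCurveOn γ (Ioo a b) ∧ γ 0 = y ∧ γ t = z := by
  constructor
  · rintro ⟨γ, a, b, h0, ht, hd, hγ, hy, hz⟩
    refine ⟨γ, a, b, h0, ht, fun s hs => ⟨hd s hs, ?_⟩, hy, hz⟩
    exact (hγ s hs).hasMFDerivAt (isOpen_Ioo.mem_nhds hs)
  · rintro ⟨γ, a, b, h0, ht, hγ, hy, hz⟩
    refine ⟨γ, a, b, h0, ht, fun s hs => (hγ s hs).1, fun s hs => ?_, hy, hz⟩
    exact HasMFDerivAt.hasMFDerivWithinAt (hγ s hs).2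

theorem LocalVectorField.IsCurveOn.mono {γ : ℝ → M} {J J' : Set ℝ} (h : X.IsCurveOn γ J)
    (hJ : J' ⊆ J) : X.IsCurveOn γ J' := fun s hs => h s (hJ hs)

theorem LocalVectorField.IsCurveOn.comp_add {γ : ℝ → M} {a b : ℝ} (h : X.IsCurveOn γ (Ioo a b))
    (c : ℝ) : X.IsCurveOn (fun s => γ (s + c)) (Ioo (a - c) (b - c)) := by
  intro s hs
  obtain ⟨h1, h2⟩ := h (s + c) ⟨by linarith [hs.1], by linarith [hs.2]⟩
  refine ⟨h1, ?_⟩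
  have := HasVelocity.scomp (h := fun s => s + c) h2 ((hasDerivAt_id s).add_const c)
  rwa [one_smul] at this

theorem LocalVectorField.IsCurveOn.continuousAt {γ : ℝ → M} {J : Set ℝ} (h : X.IsCurveOn γ J)
    {s : ℝ} (hs : s ∈ J) : ContinuousAt γ s := (h s hs).2.continuousAt

variable [FiniteDimensional ℝ E] [T2Space M]

/-- The times near which the curves agree form an open set. So do the times of `J` at which they
differ, since `M` is Hausdorff. By local uniqueness the two sets cover `J`, which is connected. -/
theorem LocalVectorField.IsCurveOn.eqOn {γ γ' : ℝ → M} {J : Set ℝ} (h : X.IsCurveOn γ J)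
    (h' : X.IsCurveOn γ' J) (hJ : IsOpen J) (hc : IsPreconnected J) {t₀ : ℝ} (ht₀ : t₀ ∈ J)
    (heq : γ t₀ = γ' t₀) : EqOn γ γ' J := by
  have : CompleteSpace E := FiniteDimensional.complete ℝ E
  have : IsManifold 𝓘(ℝ, E) 1 M := IsManifold.of_le (n := ∞) (by simp)
  have hloc : ∀ t ∈ J, γ t = γ' t → γ =ᶠ[𝓝 t] γ' := by
    intro t ht he
    refine isMIntegralCurveAt_eventuallyEq_of_contMDiffAt_boundaryless (v := X.toFun)
      ((X.contMDiffAt (h t ht).1).of_le (by simp)) ?_ ?_ he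
    · filter_upwards [hJ.mem_nhds ht] with s hs using (h s hs).2
    · filter_upwards [hJ.mem_nhds ht] with s hs using (h' s hs).2
  have key : J ⊆ {t | ∀ᶠ s in 𝓝 t, γ s = γ' s} := by
    refine hc.subset_left_of_subset_union (v := {t | t ∈ J ∧ γ t ≠ γ' t}) ?_ ?_ ?_ ?_ ?_
    · exact isOpen_iff_mem_nhds.2 fun t ht => eventually_eventually_nhds.2 ht
    · refine isOpen_iff_mem_nhds.2 fun t ht => ?_
      filter_upwards [hJ.mem_nhds ht.1, ((h.continuousAt ht.1).prodMk
        (h'.continuousAt ht.1)).eventually (isOpen_ne_fun continuous_fst continuous_snd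
          |>.mem_nhds ht.2)] with s h1 h2 using ⟨h1, h2⟩
    · exact Set.disjoint_left.2 fun t h1 h2 => h2.2
        (Filter.Eventually.self_of_nhds (p := fun s => γ s = γ' s) h1)
    · intro t ht
      by_cases he : γ t = γ' t
      · exact Or.inl (hloc t ht he)
      · exact Or.inr ⟨ht, he⟩
    · exact ⟨t₀, ht₀, hloc t₀ ht₀ heq⟩
  exact fun t ht => Filter.Eventually.self_of_nhds (p := fun s => γ s = γ' s) (key ht)

theorem LocalVectorField.FlowsTo.unique {t : ℝ} {y z z' : M} (h : X.FlowsTo t y z)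
    (h' : X.FlowsTo t y z') : z = z' := by
  obtain ⟨γ, a, b, h0, ht, hγ, hy, hz⟩ := flowsTo_iff.1 h
  obtain ⟨γ', a', b', h0', ht', hγ', hy', hz'⟩ := flowsTo_iff.1 h'
  have hsub : ∀ s, s ∈ Ioo (max a a') (min b b') ↔ s ∈ Ioo a b ∧ s ∈ Ioo a' b' := fun s => by
    simp only [mem_Ioo, max_lt_iff, lt_min_iff]; tauto
  have := (hγ.mono fun s hs => ((hsub s).1 hs).1).eqOn (hγ'.mono fun s hs => ((hsub s).1 hs).2)
    isOpen_Ioo isPreconnected_Ioo ((hsub 0).2 ⟨h0, h0'⟩) (hy.trans hy'.symm)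
    ((hsub t).2 ⟨ht, ht'⟩)
  rw [← hz, ← hz', this]

theorem LocalVectorField.FlowsTo.symm {t : ℝ} {y z : M} (h : X.FlowsTo t y z) :
    X.FlowsTo (-t) z y := by
  obtain ⟨γ, a, b, h0, ht, hγ, hy, hz⟩ := flowsTo_iff.1 h
  refine flowsTo_iff.2 ⟨fun s => γ (s + t), a - t, b - t, ?_, ?_, hγ.comp_add t, ?_, ?_⟩
  · exact ⟨by linarith [ht.1], by linarith [ht.2]⟩
  · exact ⟨by linarith [h0.1], by linarith [h0.2]⟩
  · simpa using hz
  · simpa using hy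

theorem LocalVectorField.FlowsTo.mem_domain {t : ℝ} {y z : M} (h : X.FlowsTo t y z) :
    y ∈ X.domain ∧ z ∈ X.domain := by
  obtain ⟨γ, a, b, h0, ht, hγ, hy, hz⟩ := flowsTo_iff.1 h
  exact ⟨hy ▸ (hγ 0 h0).1, hz ▸ (hγ t ht).1⟩

theorem LocalVectorField.FlowsTo.trans {s t : ℝ} {x y z : M} (h : X.FlowsTo s x y)
    (h' : X.FlowsTo t y z) : X.FlowsTo (s + t) x z := by
  obtain ⟨γ, a, b, h0, hs, hγ, hx, hy⟩ := flowsTo_iff.1 h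
  obtain ⟨γ₁, a', b', h0', ht', hγ₁, hy', hz'⟩ := flowsTo_iff.1 h'
  have hγ' := hγ₁.comp_add (-s)
  set γ' : ℝ → M := fun r => γ₁ (r + -s) with hdef
  have hys : γ' s = y := by simpa [hdef] using hy'
  have hzs : γ' (s + t) = z := by simpa [hdef] using hz'
  have hsub : ∀ r, r ∈ Ioo (max a (a' - -s)) (min b (b' - -s)) ↔
      r ∈ Ioo a b ∧ r ∈ Ioo (a' - -s) (b' - -s) := fun r => by
    simp only [mem_Ioo, max_lt_iff, lt_min_iff]; tauto
  have hs' : s ∈ Ioo (a' - -s) (b' - -s) := ⟨by linarith [h0'.1], by linarith [h0'.2]⟩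
  have hagree := (hγ.mono fun r hr => ((hsub r).1 hr).1).eqOn
    (hγ'.mono fun r hr => ((hsub r).1 hr).2) isOpen_Ioo isPreconnected_Ioo
    ((hsub s).2 ⟨hs, hs'⟩) (hy.trans hys.symm)
  classical
  -- The two curves agree on the overlap of their intervals, so near every time the glued curve
  -- coincides with one of them.
  set η : ℝ → M := fun r => if r ∈ Ioo a b then γ r else γ' r with hη
  have hη1 : ∀ r ∈ Ioo a b, η r = γ r := fun r hr => if_pos hr
  have hη2 : ∀ r ∈ Ioo (a' - -s) (b' - -s), η r = γ' r := by
    intro r hr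
    by_cases hr' : r ∈ Ioo a b
    · rw [hη1 r hr']; exact hagree ((hsub r).2 ⟨hr', hr⟩)
    · exact if_neg hr'
  have hst : s + t ∈ Ioo (a' - -s) (b' - -s) := ⟨by linarith [ht'.1], by linarith [ht'.2]⟩
  refine flowsTo_iff.2 ⟨η, min a (a' - -s), max b (b' - -s), ?_, ?_, ?_, ?_, ?_⟩
  · exact ⟨(min_le_left _ _).trans_lt h0.1, h0.2.trans_le (le_max_left _ _)⟩
  · exact ⟨(min_le_right _ _).trans_lt hst.1, hst.2.trans_le (le_max_right _ _)⟩
  · intro r hr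
    have hcover : r ∈ Ioo a b ∨ r ∈ Ioo (a' - -s) (b' - -s) := by
      rcases lt_trichotomy r s with h1 | h1 | h1
      · rcases min_lt_iff.1 hr.1 with h2 | h2
        · exact Or.inl ⟨h2, h1.trans hs.2⟩
        · exact Or.inr ⟨h2, h1.trans hs'.2⟩
      · exact Or.inl (h1 ▸ hs)
      · rcases lt_max_iff.1 hr.2 with h2 | h2
        · exact Or.inl ⟨hs.1.trans h1, h2⟩
        · exact Or.inr ⟨hs'.1.trans h1, h2⟩
    rcases hcover with h1 | h1
    · rw [hη1 r h1]
      refine ⟨(hγ r h1).1, (hγ r h1).2.congr ?_⟩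
      filter_upwards [isOpen_Ioo.mem_nhds h1] with q hq using hη1 q hq
    · rw [hη2 r h1]
      refine ⟨(hγ' r h1).1, (hγ' r h1).2.congr ?_⟩
      filter_upwards [isOpen_Ioo.mem_nhds h1] with q hq using hη2 q hq
  · rw [hη1 0 h0, hx]
  · rw [hη2 _ hst, hzs]

theorem LocalVectorField.FlowsTo.flow_eq {t : ℝ} {y z : M} (h : X.FlowsTo t y z) :
    X.flow t y = z := by
  have hex : ∃ z, X.FlowsTo t y z := ⟨z, h⟩
  rw [LocalVectorField.flow, dif_pos hex]
  exact hex.choose_spec.unique h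

theorem LocalVectorField.flowsTo_zero {y : M} (hy : y ∈ X.domain) : X.FlowsTo 0 y y := by
  obtain ⟨Φ, δ, hδ, U, hU, hyU, h0, h⟩ := X.exists_flowBox hy
  have hz : (0 : ℝ) ∈ Ioo (-δ) δ := ⟨by linarith, hδ⟩
  exact flowsTo_iff.2 ⟨fun s => Φ (s, y), -δ, δ, hz, hz,
    fun s hs => ⟨(h s hs y hyU).2.1, (h s hs y hyU).2.2⟩, h0 y hyU, h0 y hyU⟩

theorem LocalVectorField.IsCurveOn.flowsTo {γ : ℝ → M} {a b s t : ℝ}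
    (hγ : X.IsCurveOn γ (Ioo a b)) (hs : s ∈ Ioo a b) (ht : t ∈ Ioo a b) :
    X.FlowsTo (t - s) (γ s) (γ t) := by
  refine flowsTo_iff.2 ⟨fun r => γ (r + s), a - s, b - s, ?_, ?_, hγ.comp_add s, ?_, ?_⟩
  · exact ⟨by linarith [hs.1], by linarith [hs.2]⟩
  · exact ⟨by linarith [ht.1], by linarith [ht.2]⟩
  · simp
  · simp

/-- The local flow near a point of the domain is jointly smooth. -/
theorem LocalVectorField.exists_flow_near (X : LocalVectorField E M) {y₀ : M}
    (hy₀ : y₀ ∈ X.domain) :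
    ∃ Φ : ℝ × M → M, ∃ δ > 0, ∃ U : Set M, IsOpen U ∧ y₀ ∈ U ∧
      ∀ s ∈ Ioo (-δ) δ, ∀ y ∈ U,
        ContMDiffAt (𝓘(ℝ, ℝ).prod 𝓘(ℝ, E)) 𝓘(ℝ, E) ∞ Φ (s, y) ∧ X.FlowsTo s y (Φ (s, y)) ∧
        HasVelocity (fun s => Φ (s, y)) s (X.val (Φ (s, y))) := by
  obtain ⟨Φ, δ, hδ, U, hU, hyU, h0, h⟩ := X.exists_flowBox hy₀
  have hz : (0 : ℝ) ∈ Ioo (-δ) δ := ⟨by linarith, hδ⟩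
  refine ⟨Φ, δ, hδ, U, hU, hyU, fun s hs y hy => ⟨(h s hs y hy).1, ?_, (h s hs y hy).2.2⟩⟩
  exact flowsTo_iff.2 ⟨fun s => Φ (s, y), -δ, δ, hz, hs,
    fun s hs => ⟨(h s hs y hy).2.1, (h s hs y hy).2.2⟩, h0 y hy, rfl⟩

/-- Flow boxes give smoothness for short times only. Let `P s` say that the time-`s` map is smooth
near `y₀`; a flow box around `γ s` carries `P` between `s` and nearby times in both directions, and
connectedness of the interval carries it from `0` to `t`. -/
theorem LocalVectorField.FlowsTo.exists_smooth {t : ℝ} {y₀ z₀ : M} (h : X.FlowsTo t y₀ z₀) :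
    ∃ F : M → M, ∃ U : Set M, IsOpen U ∧ y₀ ∈ U ∧
      ∀ y ∈ U, ContMDiffAt 𝓘(ℝ, E) 𝓘(ℝ, E) ∞ F y ∧ X.FlowsTo t y (F y) := by
  obtain ⟨γ, a, b, h0, ht, hγ, hy, hz⟩ := flowsTo_iff.1 h
  let P : ℝ → Prop := fun s => ∃ F : M → M, ∃ U : Set M, IsOpen U ∧ y₀ ∈ U ∧
      ∀ y ∈ U, ContMDiffAt 𝓘(ℝ, E) 𝓘(ℝ, E) ∞ F y ∧ X.FlowsTo s y (F y)
  have hP0 : P 0 := ⟨id, X.domain, X.isOpen_domain, h.mem_domain.1,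
    fun y hy => ⟨contMDiffAt_id, flowsTo_zero hy⟩⟩
  have key : P 0 → P t := by
    refine isPreconnected_Ioo.induction₂' (fun s s' => P s → P s' ) (fun s hs => ?_)
      (fun _ _ _ _ _ _ h1 h2 => h2 ∘ h1) h0 ht
    obtain ⟨Φ, δ, hδ, U, hU, hyU, hΦ⟩ := X.exists_flow_near (hγ s hs).1
    have step : ∀ r r', r ∈ Ioo a b → γ r ∈ U → r' - r ∈ Ioo (-δ) δ → P r → P r' := by
      rintro r r' hr hrU hrr ⟨F, V, hV, hyV, hF⟩
      have hFr : F y₀ = γ r := by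
        have h1 := hγ.flowsTo h0 hr
        rw [sub_zero, hy] at h1
        exact (hF y₀ hyV).2.unique h1
      have hFc : ContinuousOn F V := fun y hy => (hF y hy).1.continuousAt.continuousWithinAt
      refine ⟨fun y => Φ (r' - r, F y), V ∩ F ⁻¹' U, hFc.isOpen_inter_preimage hV hU,
        ⟨hyV, by rw [mem_preimage, hFr]; exact hrU⟩, fun y hy => ⟨?_, ?_⟩⟩
      · exact ContMDiffAt.comp (g := Φ) y (hΦ _ hrr _ hy.2).1
          (contMDiffAt_const.prodMk (hF y hy.1).1)
      · have := (hF y hy.1).2.trans (hΦ _ hrr _ hy.2).2.1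
        rwa [add_sub_cancel] at this
    have hev : ∀ᶠ r in 𝓝[Ioo a b] s, r ∈ Ioo a b ∧ γ r ∈ U ∧ r - s ∈ Ioo (-δ) δ := by
      refine (eventually_mem_nhdsWithin).and (nhdsWithin_le_nhds ?_)
      refine ((hγ.continuousAt hs).eventually (hU.mem_nhds hyU)).and ?_
      have hc : ContinuousAt (fun r : ℝ => r - s) s := by fun_prop
      refine hc.preimage_mem_nhds (isOpen_Ioo.mem_nhds ?_)
      simp [hδ]
    filter_upwards [hev] with r hr
    refine ⟨step s r hs hyU hr.2.2, step r s hr.1 hr.2.1 ?_⟩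
    exact ⟨by linarith [hr.2.2.2], by linarith [hr.2.2.1]⟩
  exact key hP0

/-- The time-`t` flow map is smooth on its (open) domain of definition. -/
theorem LocalVectorField.FlowsTo.eventually_contMDiffAt_flow {t : ℝ} {y z : M}
    (h : X.FlowsTo t y z) : ∀ᶠ y' in 𝓝 y, ContMDiffAt 𝓘(ℝ, E) 𝓘(ℝ, E) ∞ (X.flow t) y' ∧
      X.FlowsTo t y' (X.flow t y') := by
  obtain ⟨F, U, hU, hyU, hF⟩ := h.exists_smooth
  filter_upwards [hU.mem_nhds hyU] with y' hy'
  have heq : ∀ w ∈ U, X.flow t w = F w := fun w hw => (hF w hw).2.flow_eq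
  refine ⟨(hF y' hy').1.congr_of_eventuallyEq ?_, ?_⟩
  · filter_upwards [hU.mem_nhds hy'] with w hw using heq w hw
  · rw [heq y' hy']; exact (hF y' hy').2

theorem LocalVectorField.FlowsTo.contMDiffAt_flow {t : ℝ} {y z : M} (h : X.FlowsTo t y z) :
    ContMDiffAt 𝓘(ℝ, E) 𝓘(ℝ, E) ∞ (X.flow t) y :=
  h.eventually_contMDiffAt_flow.self_of_nhds.1

theorem LocalVectorField.FlowsTo.mdifferentiableAt_flow {t : ℝ} {y z : M} (h : X.FlowsTo t y z) :
    MDifferentiableAt 𝓘(ℝ, E) 𝓘(ℝ, E) (X.flow t) y :=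
  h.contMDiffAt_flow.mdifferentiableAt (by simp)

theorem LocalVectorField.FlowsTo.tmap_flow_neg {t : ℝ} {y z : M} (h : X.FlowsTo t y z) (ξ : E) :
    tmap (E := E) (E' := E) (X.flow (-t)) z (tmap (E := E) (E' := E) (X.flow t) y ξ) = ξ := by
  have hz := h.flow_eq
  subst hz
  refine tmap_of_isLocalInverse h.mdifferentiableAt_flow h.symm.mdifferentiableAt_flow ?_ ξ
  filter_upwards [h.eventually_contMDiffAt_flow] with y' hy' using hy'.2.symm.flow_eq

theorem LocalVectorField.FlowsTo.tmap_flow {t : ℝ} {y z : M} (h : X.FlowsTo t y z) (ξ : E) :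
    tmap (E := E) (E' := E) (X.flow t) y (tmap (E := E) (E' := E) (X.flow (-t)) z ξ) = ξ := by
  have := h.symm.tmap_flow_neg ξ
  rwa [neg_neg] at this

theorem LocalVectorField.FlowsTo.isInvertible_tmap_flow {t : ℝ} {y z : M} (h : X.FlowsTo t y z) :
    (tmap (E := E) (E' := E) (X.flow t) y).IsInvertible :=
  ContinuousLinearMap.IsInvertible.of_inverse
    (g := tmap (E := E) (E' := E) (X.flow (-t)) z)
    (ContinuousLinearMap.ext h.tmap_flow) (ContinuousLinearMap.ext h.tmap_flow_neg)

theorem IsFlowPullback.tmap_flow {t : ℝ} (h : IsFlowPullback X t Y Z) {y z : M}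
    (hf : X.FlowsTo t y z) (hz : z ∈ Y.domain) :
    y ∈ Z.domain ∧ tmap (E := E) (E' := E) (X.flow t) y (Z.val y) = Y.val z := by
  have hy : y ∈ Z.domain := (h.1 y).2 ⟨z, hz, hf⟩
  refine ⟨hy, ?_⟩
  have h1 : Z.val y = (tmap (E := E) (E' := E) (X.flow t) y).inverse (Y.val (X.flow t y)) :=
    h.2 y hy
  rw [h1, hf.flow_eq]
  exact hf.isInvertible_tmap_flow.self_apply_inverse _

/-- Pullbacks of local vector fields along flows exist. -/
theorem exists_isFlowPullback (X : LocalVectorField E M) (t : ℝ) (Y : LocalVectorField E M) :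
    ∃ Z, IsFlowPullback X t Y Z := by
  classical
  have : CompleteSpace E := FiniteDimensional.complete ℝ E
  let U : Set M := {y | ∃ z ∈ Y.domain, X.FlowsTo t y z}
  have hev : ∀ y ∈ U, ∀ᶠ y' in 𝓝 y, y' ∈ U := by
    rintro y ⟨z, hz, hf⟩
    have hc := hf.contMDiffAt_flow.continuousAt
    rw [ContinuousAt, hf.flow_eq] at hc
    filter_upwards [hf.eventually_contMDiffAt_flow, hc.eventually (Y.isOpen_domain.mem_nhds hz)]
      with y' h1 h2 using ⟨_, h2, h1.2⟩
  let f : (x : M) → TangentSpace 𝓘(ℝ, E) x := fun y => if y ∈ U then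
    VectorField.mpullback 𝓘(ℝ, E) 𝓘(ℝ, E) (X.flow t) Y.toFun y else 0
  refine ⟨⟨U, isOpen_iff_mem_nhds.2 hev, f, ?_, fun y hy => if_neg hy⟩, fun y => Iff.rfl,
    fun y hy => if_pos hy⟩
  intro y hy
  obtain ⟨z, hz, hf⟩ := hy
  have h0 : (mfderiv 𝓘(ℝ, E) 𝓘(ℝ, E) (X.flow t) y).IsInvertible := hf.isInvertible_tmap_flow
  have hY : X.flow t y ∈ Y.domain := by rw [hf.flow_eq]; exact hz
  have h2 := ContMDiffAt.mpullback_vectorField_preimage (m := ∞) (Y.contMDiffAt hY)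
    hf.contMDiffAt_flow h0 (by simp)
  refine (h2.congr_of_eventuallyEq ?_).contMDiffWithinAt
  filter_upwards [hev y ⟨z, hz, hf⟩] with y' hy'
  have : f y' = VectorField.mpullback 𝓘(ℝ, E) 𝓘(ℝ, E) (X.flow t) Y.toFun y' := if_pos hy'
  rw [this]

end Flows

/-! ### Stability of injectivity -/

section Linear

set_option linter.unusedSectionVars false

variable {F E : Type*} [NormedAddCommGroup F] [NormedSpace ℝ F] [FiniteDimensional ℝ F]
  [NormedAddCommGroup E] [NormedSpace ℝ E]

/-- Injectivity of linear maps out of a finite-dimensional space is an open condition. -/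
theorem eventually_norm_le_of_injective {L₀ : F →L[ℝ] E} (h : Function.Injective L₀) :
    ∃ C > 0, ∀ᶠ L in 𝓝 L₀, ∀ η, ‖η‖ ≤ C * ‖L η‖ := by
  obtain ⟨K, hK, hanti⟩ := LinearMap.exists_antilipschitzWith (L₀ : F →ₗ[ℝ] E)
    (LinearMap.ker_eq_bot.2 h)
  have hK' : (0 : ℝ) < K := hK
  have h0 : ∀ η, ‖η‖ ≤ K * ‖L₀ η‖ := fun η => by
    have := hanti.le_mul_dist η 0
    simpa using this
  refine ⟨2 * K, by positivity, ?_⟩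
  -- The radius is chosen so that the perturbation costs at most half of `‖η‖`, which is absorbed on
  -- the left.
  filter_upwards [Metric.ball_mem_nhds L₀ (ε := 1 / (2 * K)) (by positivity)] with L hL η
  rw [Metric.mem_ball, dist_comm, dist_eq_norm] at hL
  have h1 : ‖L₀ η‖ ≤ ‖L η‖ + 1 / (2 * K) * ‖η‖ := by
    calc ‖L₀ η‖ = ‖L η + (L₀ - L) η‖ := by simp
      _ ≤ ‖L η‖ + ‖(L₀ - L) η‖ := norm_add_le _ _
      _ ≤ ‖L η‖ + 1 / (2 * K) * ‖η‖ := by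
        gcongr
        exact (ContinuousLinearMap.le_opNorm _ _).trans (by gcongr)
  have h2 := (h0 η).trans (mul_le_mul_of_nonneg_left h1 hK'.le)
  have h3 : (K : ℝ) * (‖L η‖ + 1 / (2 * K) * ‖η‖) = K * ‖L η‖ + ‖η‖ / 2 := by field_simp
  linarith

theorem injective_of_norm_le {L : F →L[ℝ] E} {C : ℝ} (h : ∀ η, ‖η‖ ≤ C * ‖L η‖) :
    Function.Injective L := by
  refine (injective_iff_map_eq_zero L).2 fun η hη => ?_
  have := h η
  rw [hη, norm_zero, mul_zero] at this
  exact norm_le_zero_iff.1 this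

end Linear

/-! ### Invariance of the spanned distribution under flows -/

section Invariance

set_option linter.unusedSectionVars false

variable {E : Type v} [NormedAddCommGroup E] [NormedSpace ℝ E]
  {M : Type u} [TopologicalSpace M] [ChartedSpace E M]

/-- The value of a distribution at a point, in the model space. -/
def TangentDistribution.fiber (D : TangentDistribution E M) (x : M) : Submodule ℝ E := D x

variable [IsManifold 𝓘(ℝ, E) ∞ M]

theorem fiber_spannedBy (V : Set (LocalVectorField E M)) (x : M) :
    TangentDistribution.fiber (spannedBy V) x =
      Submodule.span ℝ {w : E | ∃ X ∈ V, x ∈ X.domain ∧ X.val x = w} := rfl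

theorem val_mem_fiber {V : Set (LocalVectorField E M)} {X : LocalVectorField E M} (hX : X ∈ V)
    {x : M} (hx : x ∈ X.domain) : X.val x ∈ TangentDistribution.fiber (spannedBy V) x := by
  rw [fiber_spannedBy]
  exact Submodule.subset_span ⟨X, hX, hx, rfl⟩

theorem subset_stableHull (V : Set (LocalVectorField E M)) : V ⊆ stableHull V :=
  subset_sInter fun _ hW => hW.1

theorem isStable_stableHull (V : Set (LocalVectorField E M)) : IsStable (stableHull V) := by
  intro X hX Y hY t Z hZ W hW
  exact hW.2 X (hX W hW) Y (hY W hW) t Z hZ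

theorem stableHull_subset {V W : Set (LocalVectorField E M)} (h : V ⊆ W) (hW : IsStable W) :
    stableHull V ⊆ W := sInter_subset_of_mem ⟨h, hW⟩

variable [FiniteDimensional ℝ E] [T2Space M] {V : Set (LocalVectorField E M)}
  {X : LocalVectorField E M}

/-- The distribution spanned by a stable set is invariant under the flows of its members. -/
theorem IsStable.tmap_flow_mem (hV : IsStable V) (hX : X ∈ V) {t : ℝ} {y z : M}
    (h : X.FlowsTo t y z) {ξ : E} (hξ : ξ ∈ TangentDistribution.fiber (spannedBy V) y) :
    tmap (E := E) (E' := E) (X.flow t) y ξ ∈ TangentDistribution.fiber (spannedBy V) z := by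
  rw [fiber_spannedBy] at hξ
  induction hξ using Submodule.span_induction with
  | mem w hw =>
    obtain ⟨Y, hY, hyY, rfl⟩ := hw
    -- Pushing forward by time `t` is pulling back by time `-t`: the image of `Y y` is the value at
    -- `z` of a field that stability puts in `V`.
    obtain ⟨Z, hZ⟩ := exists_isFlowPullback X (-t) Y
    obtain ⟨h1, h2⟩ := hZ.tmap_flow h.symm hyY
    rw [← h2, h.tmap_flow]
    exact val_mem_fiber (hV X hX Y hY (-t) Z hZ) h1
  | zero => rw [map_zero]; exact Submodule.zero_mem _
  | add a b _ _ ha hb => rw [map_add]; exact Submodule.add_mem _ ha hb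
  | smul c a _ ha => rw [map_smul]; exact Submodule.smul_mem _ c ha

theorem IsStable.finrank_le (hV : IsStable V) (hX : X ∈ V) {t : ℝ} {y z : M}
    (h : X.FlowsTo t y z) : Module.finrank ℝ (TangentDistribution.fiber (spannedBy V) y) ≤
      Module.finrank ℝ (TangentDistribution.fiber (spannedBy V) z) := by
  refine LinearMap.finrank_le_finrank_of_injective
    (f := ((tmap (E := E) (E' := E) (X.flow t) y : E →ₗ[ℝ] E).restrict
      (fun ξ hξ => hV.tmap_flow_mem hX h hξ))) ?_
  intro a b hab
  have h1 := congrArg Subtype.val hab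
  simp only [LinearMap.restrict_apply] at h1
  have h2 := congrArg (tmap (E := E) (E' := E) (X.flow (-t)) z) h1
  have h3 := h.tmap_flow_neg (a : E)
  have h4 := h.tmap_flow_neg (b : E)
  exact Subtype.ext (h3.symm.trans (h2.trans h4))

theorem IsStable.finrank_eq (hV : IsStable V) (hX : X ∈ V) {t : ℝ} {y z : M}
    (h : X.FlowsTo t y z) : Module.finrank ℝ (TangentDistribution.fiber (spannedBy V) y) =
      Module.finrank ℝ (TangentDistribution.fiber (spannedBy V) z) :=
  (hV.finrank_le hX h).antisymm (hV.finrank_le hX h.symm)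

/-- The values of a set of local vector fields contain bases of the spanned distribution. -/
theorem exists_fields_linearIndependent (V : Set (LocalVectorField E M)) {y : M} {k : ℕ}
    (hk : Module.finrank ℝ (TangentDistribution.fiber (spannedBy V) y) = k) :
    ∃ Y : Fin k → LocalVectorField E M, (∀ i, Y i ∈ V ∧ y ∈ (Y i).domain) ∧
        LinearIndependent ℝ (fun i => (Y i).val y) := by
  obtain ⟨b, hb, hspan, hli⟩ :=
    exists_linearIndependent ℝ {w : E | ∃ X ∈ V, y ∈ X.domain ∧ X.val y = w}
  have : Finite b := hli.finite
  have : Fintype b := Fintype.ofFinite b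
  have hcard : Fintype.card b = k := by
    rw [← hk, fiber_spannedBy, ← hspan, ← finrank_span_eq_card hli, Subtype.range_coe]
  let e := (Fintype.equivFinOfCardEq hcard).symm
  choose Y hY1 hY2 hY3 using fun w : b => hb w.2
  refine ⟨fun i => Y (e i), fun i => ⟨hY1 _, hY2 _⟩, ?_⟩
  have : (fun i => (Y (e i)).val y) = (fun w : b => (w : E)) ∘ e := funext fun i => hY3 _
  rw [this]
  exact hli.comp e e.injective

end Invariance

/-! ### Construction of plaques by composing flows -/

section Plaques

set_option linter.unusedSectionVars false

variable {E : Type v} [NormedAddCommGroup E] [NormedSpace ℝ E]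
  {M : Type u} [TopologicalSpace M] [ChartedSpace E M]
  {F : Type*} [NormedAddCommGroup F] [NormedSpace ℝ F]

/-- `ψ` is near `u` a smooth parametrization of an integral manifold of `D`. -/
structure IsPlaqueAt (D : TangentDistribution E M) (ψ : F → M) (u : F) : Prop where
  contMDiffAt : ContMDiffAt 𝓘(ℝ, F) 𝓘(ℝ, E) ∞ ψ u
  injective : Function.Injective (tmap (E := F) (E' := E) ψ u)
  range_eq : LinearMap.range (tmap (E := F) (E' := E) ψ u).toLinearMap = D.fiber (ψ u)

variable [IsManifold 𝓘(ℝ, E) ∞ M] [FiniteDimensional ℝ E] [T2Space M]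

/-- The derivative of a parametrization that is read in a chart. -/
theorem contDiffAt_chart_comp (y : M) {ψ : F → M} {u : F} (hu : ψ u ∈ (chartAt E y).source)
    (hψ : ContMDiffAt 𝓘(ℝ, F) 𝓘(ℝ, E) ∞ ψ u) :
    ContDiffAt ℝ ∞ (chartAt E y ∘ ψ) u ∧ ∀ η, fderiv ℝ (chartAt E y ∘ ψ) u η =
      tmap (E := E) (E' := E) (chartAt E y) (ψ u) (tmap (E := F) (E' := E) ψ u η) := by
  have a1 : ContMDiffAt 𝓘(ℝ, E) 𝓘(ℝ, E) ∞ (chartAt E y) (ψ u) :=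
    contMDiffOn_chart.contMDiffAt ((chartAt E y).open_source.mem_nhds hu)
  refine ⟨(a1.comp u hψ).contDiffAt, fun η => ?_⟩
  rw [← tmap_eq_fderiv, tmap_comp_apply (a1.mdifferentiableAt (by simp))
    (hψ.mdifferentiableAt (by simp))]

theorem injective_fderiv_chart_comp (y : M) {ψ : F → M} {u : F}
    (hu : ψ u ∈ (chartAt E y).source) (hψ : ContMDiffAt 𝓘(ℝ, F) 𝓘(ℝ, E) ∞ ψ u)
    (hinj : Function.Injective (tmap (E := F) (E' := E) ψ u)) :
    Function.Injective (fderiv ℝ (chartAt E y ∘ ψ) u) := by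
  intro a b hab
  have hm := contDiffAt_chart_comp y hu hψ
  rw [hm.2, hm.2] at hab
  refine hinj ?_
  have h3 := congrArg (tmap (E := E) (E' := E) (chartAt E y).symm (chartAt E y (ψ u))) hab
  rwa [tmap_chartAt_symm_tmap y hu, tmap_chartAt_symm_tmap y hu] at h3

/-- The derivative of the composition of a flow with a map into its domain. -/
theorem LocalVectorField.tmap_flow_comp {X : LocalVectorField E M} {Φ : ℝ × M → M} {U : Set M}
    (hU : IsOpen U) {ψ : F → M} {u : F} {ℓ : F →L[ℝ] ℝ} (hψ : ContMDiffAt 𝓘(ℝ, F) 𝓘(ℝ, E) ∞ ψ u)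
    (hu : ψ u ∈ U)
    (hΦs : ContMDiffAt (𝓘(ℝ, ℝ).prod 𝓘(ℝ, E)) 𝓘(ℝ, E) ∞ Φ (ℓ u, ψ u))
    (hΦf : ∀ y ∈ U, X.FlowsTo (ℓ u) y (Φ (ℓ u, y)))
    (hΦv : HasVelocity (fun s => Φ (s, ψ u)) (ℓ u) (X.val (Φ (ℓ u, ψ u)))) (η : F) :
    tmap (E := F) (E' := E) (fun u => Φ (ℓ u, ψ u)) u η =
      ℓ η • X.val (Φ (ℓ u, ψ u)) +
        tmap (E := E) (E' := E) (X.flow (ℓ u)) (ψ u) (tmap (E := F) (E' := E) ψ u η) := by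
  have h1 : HasMFDerivAt 𝓘(ℝ, F) 𝓘(ℝ, ℝ) ℓ u ℓ := ℓ.hasMFDerivAt
  have h2 := (hψ.mdifferentiableAt (by simp)).hasMFDerivAt
  have hΦd : MDifferentiableAt (𝓘(ℝ, ℝ).prod 𝓘(ℝ, E)) 𝓘(ℝ, E) Φ (ℓ u, ψ u) :=
    hΦs.mdifferentiableAt (by simp)
  have h3 := (HasMFDerivAt.comp u hΦd.hasMFDerivAt (h1.prodMk h2)).mfderiv
  have h4 := congrArg (fun L => L η) h3
  have h5 := mfderiv_prod_eq_add_apply (p := (ℓ u, ψ u))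
    (v := ((ℓ η, tmap (E := F) (E' := E) ψ u η) : ℝ × E)) hΦd
  refine (h4.trans h5).trans ?_
  have h6 : mfderiv 𝓘(ℝ, ℝ) 𝓘(ℝ, E) (fun s => Φ (s, ψ u)) (ℓ u) =
    ((1 : ℝ →L[ℝ] ℝ).smulRight (X.val (Φ (ℓ u, ψ u))) : ℝ →L[ℝ] E) := HasMFDerivAt.mfderiv hΦv
  have h7 : tmap (E := E) (E' := E) (fun z => Φ (ℓ u, z)) (ψ u) =
      tmap (E := E) (E' := E) (X.flow (ℓ u)) (ψ u) := by
    refine tmap_congr ?_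
    filter_upwards [hU.mem_nhds hu] with z hz using ((hΦf z hz).flow_eq).symm
  rw [← h7]
  exact congrArg (fun L : ℝ →L[ℝ] E => L (ℓ η) +
    tmap (E := E) (E' := E) (fun z => Φ (ℓ u, z)) (ψ u) (tmap (E := F) (E' := E) ψ u η)) h6

theorem LocalVectorField.flow_zero_tmap {X : LocalVectorField E M} {y : M} (hy : y ∈ X.domain) :
    tmap (E := E) (E' := E) (X.flow 0) y = ContinuousLinearMap.id ℝ E := by
  rw [← tmap_id (M := M) y]
  refine tmap_congr ?_
  filter_upwards [X.isOpen_domain.mem_nhds hy] with z hz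
  exact (LocalVectorField.flowsTo_zero hz).flow_eq

/-- One more flow direction can be added to a parametrization tangent to the distribution. -/
theorem IsStable.exists_parametrization_step {V : Set (LocalVectorField E M)} (hV : IsStable V)
    {X : LocalVectorField E M} (hX : X ∈ V) {A : Set M}
    (hA : ∀ t z w, X.FlowsTo t z w → z ∈ A → w ∈ A) {ψ : F → M}
    (hy : ψ 0 ∈ X.domain) (ℓ : F →L[ℝ] ℝ)
    (hψ : ∀ᶠ u in 𝓝 0, ContMDiffAt 𝓘(ℝ, F) 𝓘(ℝ, E) ∞ ψ u ∧
      (∀ η, tmap (E := F) (E' := E) ψ u η ∈ TangentDistribution.fiber (spannedBy V) (ψ u)) ∧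
      Module.finrank ℝ (TangentDistribution.fiber (spannedBy V) (ψ u)) =
        Module.finrank ℝ (TangentDistribution.fiber (spannedBy V) (ψ 0)) ∧ ψ u ∈ A) :
    ∃ ψ' : F → M, ψ' 0 = ψ 0 ∧
      tmap (E := F) (E' := E) ψ' 0 = tmap (E := F) (E' := E) ψ 0 + ℓ.smulRight (X.val (ψ 0)) ∧
      ∀ᶠ u in 𝓝 0, ContMDiffAt 𝓘(ℝ, F) 𝓘(ℝ, E) ∞ ψ' u ∧
        (∀ η, tmap (E := F) (E' := E) ψ' u η ∈ TangentDistribution.fiber (spannedBy V) (ψ' u)) ∧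
        Module.finrank ℝ (TangentDistribution.fiber (spannedBy V) (ψ' u)) =
          Module.finrank ℝ (TangentDistribution.fiber (spannedBy V) (ψ 0)) ∧ ψ' u ∈ A := by
  obtain ⟨Φ, δ, hδ, U, hU, hyU, hΦ⟩ := X.exists_flow_near hy
  have hz : (0 : ℝ) ∈ Ioo (-δ) δ := ⟨by linarith, hδ⟩
  have h0 : ∀ y ∈ U, Φ (0, y) = y := fun y hy =>
    (hΦ 0 hz y hy).2.1.unique (LocalVectorField.flowsTo_zero (hΦ 0 hz y hy).2.1.mem_domain.1)
  have hψ0 : Φ (ℓ 0, ψ 0) = ψ 0 := by rw [map_zero]; exact h0 _ hyU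
  have hev : ∀ᶠ u in 𝓝 (0 : F), ψ u ∈ U ∧ ℓ u ∈ Ioo (-δ) δ := by
    refine (hψ.self_of_nhds.1.continuousAt.eventually (hU.mem_nhds hyU)).and ?_
    refine ℓ.continuous.continuousAt.preimage_mem_nhds (isOpen_Ioo.mem_nhds ?_)
    rw [map_zero]; exact hz
  have hder : ∀ u, ψ u ∈ U → ℓ u ∈ Ioo (-δ) δ → ContMDiffAt 𝓘(ℝ, F) 𝓘(ℝ, E) ∞ ψ u → ∀ η,
      tmap (E := F) (E' := E) (fun u => Φ (ℓ u, ψ u)) u η =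
      ℓ η • X.val (Φ (ℓ u, ψ u)) +
        tmap (E := E) (E' := E) (X.flow (ℓ u)) (ψ u) (tmap (E := F) (E' := E) ψ u η) :=
    fun u h1 h2 h3 η => LocalVectorField.tmap_flow_comp hU h3 h1 (hΦ _ h2 _ h1).1
      (fun y hy => (hΦ _ h2 y hy).2.1) (hΦ _ h2 _ h1).2.2 η
  -- The point `ψ u` is moved along `X` for the time `ℓ u`. The derivative acquires a multiple of
  -- `X` and is otherwise transported by the flow, so invariance keeps it tangent; at `u = 0` the
  -- transport is the identity.
  refine ⟨fun u => Φ (ℓ u, ψ u), hψ0, ?_, ?_⟩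
  · refine ContinuousLinearMap.ext fun η => ?_
    rw [hder 0 hyU (by rw [map_zero]; exact hz) hψ.self_of_nhds.1 η, hψ0, map_zero,
      LocalVectorField.flow_zero_tmap hy]
    simp [add_comm]
  · filter_upwards [hψ, hev] with u ⟨h1, h2, h3, h4⟩ ⟨h5, h6⟩
    obtain ⟨k1, k2, k3⟩ := hΦ _ h6 _ h5
    refine ⟨?_, fun η => ?_, ?_, hA _ _ _ k2 h4⟩
    · exact ContMDiffAt.comp (g := Φ) u k1 (ℓ.contMDiff.contMDiffAt.prodMk h1)
    · rw [hder u h5 h6 h1 η]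
      exact Submodule.add_mem _ (Submodule.smul_mem _ _ (val_mem_fiber hX k2.mem_domain.2))
        (hV.tmap_flow_mem hX k2 (h2 η))
    · rw [← h3]; exact (hV.finrank_eq hX k2).symm

/-- Through every point there is an integral manifold of the distribution spanned by a stable set,
which moreover stays in any given set that is invariant under the flows. -/
theorem IsStable.exists_plaque {V : Set (LocalVectorField E M)} (hV : IsStable V) {A : Set M}
    (hA : ∀ X ∈ V, ∀ t z w, X.FlowsTo t z w → z ∈ A → w ∈ A) {y : M} (hy : y ∈ A)
    {k : ℕ} (hk : Module.finrank ℝ (TangentDistribution.fiber (spannedBy V) y) = k) :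
    ∃ ψ : EuclideanSpace ℝ (Fin k) → M,
      ψ 0 = y ∧ ∀ᶠ u in 𝓝 0, IsPlaqueAt (spannedBy V) ψ u ∧ ψ u ∈ A := by
  obtain ⟨Y, hY, hli⟩ := exists_fields_linearIndependent V hk
  let F := EuclideanSpace ℝ (Fin k)
  let ℓ : Fin k → F →L[ℝ] ℝ := fun i => EuclideanSpace.proj i
  -- The flows of the `Y i` with `i ∈ s` are composed, the `i`-th coordinate serving as flow time.
  -- The rank is carried along for the dimension count at the end.
  have key : ∀ s : Finset (Fin k), ∃ ψ : F → M, ψ 0 = y ∧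
      tmap (E := F) (E' := E) ψ 0 = ∑ i ∈ s, (ℓ i).smulRight ((Y i).val y) ∧
      ∀ᶠ u in 𝓝 0, ContMDiffAt 𝓘(ℝ, F) 𝓘(ℝ, E) ∞ ψ u ∧
        (∀ η, tmap (E := F) (E' := E) ψ u η ∈ TangentDistribution.fiber (spannedBy V) (ψ u)) ∧
        Module.finrank ℝ (TangentDistribution.fiber (spannedBy V) (ψ u)) =
          Module.finrank ℝ (TangentDistribution.fiber (spannedBy V) y) ∧ ψ u ∈ A := by
    intro s
    induction s using Finset.induction_on with
    | empty =>
      have h0 : ∀ u : F, tmap (E := F) (E' := E) (fun _ : F => y) u = 0 := fun u => mfderiv_const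
      refine ⟨fun _ => y, rfl, h0 0, Eventually.of_forall fun u =>
        ⟨contMDiffAt_const, fun η => ?_, rfl, hy⟩⟩
      rw [h0]; exact Submodule.zero_mem _
    | insert i s hi ih =>
      obtain ⟨ψ, h0, h1, h2⟩ := ih
      have h2' := h2
      rw [← h0] at h2'
      obtain ⟨ψ', h3, h4, h5⟩ := hV.exists_parametrization_step (hY i).1 (hA _ (hY i).1)
        (by rw [h0]; exact (hY i).2) (ℓ i) h2'
      refine ⟨ψ', h3.trans h0, ?_, ?_⟩
      · rw [h4, h1, h0, Finset.sum_insert hi, add_comm]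
      · rw [h0] at h5; exact h5
  obtain ⟨ψ, h0, h1, h2⟩ := key Finset.univ
  refine ⟨ψ, h0, ?_⟩
  have hinj : Function.Injective (tmap (E := F) (E' := E) ψ 0) := by
    refine (injective_iff_map_eq_zero _).2 fun η hη => ?_
    rw [h1] at hη
    have h3 : ∑ i, η i • (Y i).val y = 0 := by
      rw [← hη, _root_.sum_apply]
      rfl
    have h4 := Fintype.linearIndependent_iff.1 hli (fun i => η i) h3
    ext i
    simpa using h4 i
  -- injectivity persists near the base point
  set e := chartAt E y with he
  have hys : y ∈ e.source := mem_chart_source E y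
  have hcs : ∀ᶠ u in 𝓝 (0 : F), ψ u ∈ e.source :=
    h2.self_of_nhds.1.continuousAt.eventually (by rw [h0]; exact e.open_source.mem_nhds hys)
  have hmd := fun u (hu : ψ u ∈ e.source) hs => contDiffAt_chart_comp (E := E) (F := F) y hu hs
  have hinj0 : Function.Injective (fderiv ℝ (e ∘ ψ) 0) :=
    injective_fderiv_chart_comp y hcs.self_of_nhds h2.self_of_nhds.1 hinj
  obtain ⟨C, _, hC⟩ := eventually_norm_le_of_injective hinj0
  have hcont : ContinuousAt (fderiv ℝ (e ∘ ψ)) 0 :=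
    ((hmd 0 hcs.self_of_nhds h2.self_of_nhds.1).1.fderiv_right (m := 0) (by simp)).continuousAt
  filter_upwards [h2, hcs, hcont.eventually hC] with u ⟨k1, k2, k3, k4⟩ k5 k6
  have hinju : Function.Injective (tmap (E := F) (E' := E) ψ u) := by
    intro a b hab
    refine injective_of_norm_le k6 ?_
    rw [(hmd u k5 k1).2, (hmd u k5 k1).2, hab]
  refine ⟨⟨k1, hinju, ?_⟩, k4⟩
  -- The image lies in the distribution and both have dimension `k`, the rank being constant along
  -- the flows.
  refine Submodule.eq_of_le_of_finrank_eq ?_ ?_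
  · rintro _ ⟨η, rfl⟩
    exact k2 η
  · rw [k3, hk, LinearMap.finrank_range_of_inj hinju, finrank_euclideanSpace_fin]

end Plaques

/-! ### Gronwall's lemma for absolutely continuous curves -/

section Gronwall

set_option linter.unusedSectionVars false

variable {G : Type*} [NormedAddCommGroup G] [NormedSpace ℝ G]

/-- Membership in a neighbourhood within `[a, b]` holds on a compact subinterval. -/
theorem exists_Icc_of_eventually_nhdsWithin_Icc {a b t₀ : ℝ} (ht₀ : t₀ ∈ Icc a b) {P : ℝ → Prop}
    (h : ∀ᶠ t in 𝓝[Icc a b] t₀, P t) :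
    ∃ c d, t₀ ∈ Icc c d ∧ Icc c d ⊆ Icc a b ∧ Icc c d ∈ 𝓝[Icc a b] t₀ ∧ ∀ t ∈ Icc c d, P t := by
  obtain ⟨ε, hε, hP⟩ := Metric.eventually_nhds_iff.1 (eventually_nhdsWithin_iff.1 h)
  have hsub : Icc (max a (t₀ - ε / 2)) (min b (t₀ + ε / 2)) =
      Icc a b ∩ Icc (t₀ - ε / 2) (t₀ + ε / 2) := Icc_inter_Icc.symm
  refine ⟨max a (t₀ - ε / 2), min b (t₀ + ε / 2), ?_, ?_, ?_, ?_⟩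
  · rw [hsub]; exact ⟨ht₀, by linarith, by linarith⟩
  · rw [hsub]; exact inter_subset_left
  · rw [hsub]
    exact inter_mem self_mem_nhdsWithin
      (mem_nhdsWithin_of_mem_nhds (Icc_mem_nhds (by linarith) (by linarith)))
  · intro t ht
    rw [hsub] at ht
    refine hP ?_ ht.1
    rw [Real.dist_eq, abs_lt]
    constructor <;> linarith [ht.2.1, ht.2.2]

/-- A norming functional of `z t - z s` reduces the claim to the fundamental theorem of calculus for
a real-valued absolutely continuous function. -/
theorem norm_sub_le_of_ae_deriv_le {z : ℝ → G} {s t m : ℝ}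
    (hz : AbsolutelyContinuousOnInterval z s t) {β : ℝ → ℝ} (hβ : IntervalIntegrable β volume s t)
    (hd : ∀ᵐ τ ∂volume.restrict (uIoc s t), ∃ d, HasDerivAt z d τ ∧ ‖d‖ ≤ β τ * m) :
    ‖z t - z s‖ ≤ |∫ τ in s..t, β τ| * |m| := by
  obtain ⟨g, hg, hgz⟩ := exists_dual_vector'' ℝ (z t - z s)
  have hac : AbsolutelyContinuousOnInterval (fun τ => g (z τ)) s t := by
    rw [absolutelyContinuousOnInterval_iff] at hz ⊢
    intro ε hε
    obtain ⟨δ, hδ, h⟩ := hz ε hε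
    refine ⟨δ, hδ, fun I hI hsum => lt_of_le_of_lt (Finset.sum_le_sum fun i _ => ?_) (h I hI hsum)⟩
    rw [dist_eq_norm, dist_eq_norm, ← map_sub]
    exact (g.le_opNorm _).trans (mul_le_of_le_one_left (norm_nonneg _) hg)
  have hint := hac.integral_deriv_eq_sub
  have h1 : ‖z t - z s‖ = ∫ τ in s..t, deriv (fun τ => g (z τ)) τ := by
    rw [hint, ← map_sub, hgz]; rfl
  have h2 := intervalIntegral.norm_integral_le_abs_of_norm_le (f := deriv (fun τ => g (z τ)))
    (g := fun τ => β τ * m) (a := s) (b := t) (μ := volume) ?_ (hβ.mul_const m)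
  · rw [h1]
    refine (le_abs_self _).trans (h2.trans ?_)
    rw [intervalIntegral.integral_mul_const, abs_mul]
  · filter_upwards [hd] with τ hτ
    obtain ⟨d, hd1, hd2⟩ := hτ
    have : HasDerivAt (fun τ => g (z τ)) (g d) τ := g.hasFDerivAt.comp_hasDerivAt τ hd1
    rw [this.deriv]
    exact ((g.le_opNorm _).trans (mul_le_of_le_one_left (norm_nonneg _) hg)).trans hd2

/-- Gronwall's lemma for absolutely continuous curves: a curve with `‖z'‖ ≤ β ‖z‖` almost
everywhere that vanishes at some time vanishes identically. -/
theorem eq_zero_of_ae_norm_deriv_le {z : ℝ → G} {a b : ℝ} (hab : a ≤ b)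
    (hz : AbsolutelyContinuousOnInterval z a b) {β : ℝ → ℝ} (hβ0 : ∀ t, 0 ≤ β t)
    (hβ : IntervalIntegrable β volume a b)
    (hd : ∀ᵐ τ ∂volume.restrict (Icc a b), ∃ d, HasDerivAt z d τ ∧ ‖d‖ ≤ β τ * ‖z τ‖)
    {t₀ : ℝ} (ht₀ : t₀ ∈ Icc a b) (h0 : z t₀ = 0) : ∀ t ∈ Icc a b, z t = 0 := by
  have hcont : ContinuousOn z (Icc a b) := by rw [← uIcc_of_le hab]; exact hz.continuousOn
  intro t ht
  -- It suffices to show that vanishing spreads, in both directions, between each time and nearby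
  -- times.
  refine isPreconnected_Icc.induction₂' (fun s s' => z s = 0 → z s' = 0) (fun s hs => ?_)
    (fun _ _ _ _ _ _ h1 h2 => h2 ∘ h1) ht₀ ht h0
  by_cases hzs : z s = 0
  swap
  · filter_upwards [(hcont s hs).eventually_ne hzs] with s' hs'
    exact ⟨fun h => absurd h hzs, fun h => absurd h hs'⟩
  have hprim : ContinuousOn (fun t => ∫ τ in s..t, β τ) (Icc a b) := by
    rw [← uIcc_of_le hab] at hs ⊢
    exact intervalIntegral.continuousOn_primitive_interval' hβ hs
  -- Where the integral of `β` from `s` is below `1 / 2`, the maximum of `‖z‖` is at most half of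
  -- itself, hence zero.
  have hsmall : ∀ᶠ t in 𝓝[Icc a b] s, |∫ τ in s..t, β τ| < 1 / 2 := by
    have h1 : Tendsto (fun t => |∫ τ in s..t, β τ|) (𝓝[Icc a b] s) (𝓝 0) := by
      have := (hprim s hs).tendsto.abs
      simpa using this
    exact h1.eventually (gt_mem_nhds (by norm_num))
  obtain ⟨c, d, hscd, hsub, hnhds, hcd⟩ := exists_Icc_of_eventually_nhdsWithin_Icc hs hsmall
  obtain ⟨t₁, ht₁, hmax⟩ := isCompact_Icc.exists_isMaxOn ⟨s, hscd⟩ (hcont.mono hsub).norm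
  have hle : ∀ t ∈ Icc c d, ‖z t‖ ≤ 1 / 2 * ‖z t₁‖ := by
    intro t ht
    have huIcc : uIcc s t ⊆ Icc c d := uIcc_subset_Icc hscd ht
    have hsub' : uIcc s t ⊆ uIcc a b := by rw [uIcc_of_le hab]; exact huIcc.trans hsub
    have h1 := norm_sub_le_of_ae_deriv_le (m := ‖z t₁‖) (hz.mono hsub') (hβ.mono_set hsub') ?_
    · rw [hzs, sub_zero, abs_of_nonneg (norm_nonneg (z t₁))] at h1
      exact h1.trans (mul_le_mul_of_nonneg_right (hcd t ht).le (norm_nonneg _))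
    · have hsub2 : uIoc s t ⊆ Icc a b := uIoc_subset_uIcc.trans (huIcc.trans hsub)
      filter_upwards [ae_restrict_of_ae_restrict_of_subset hsub2 hd,
        ae_restrict_mem measurableSet_uIoc] with τ ⟨e, h2, h3⟩ hτ
      exact ⟨e, h2, h3.trans (mul_le_mul_of_nonneg_left
        (hmax (huIcc (uIoc_subset_uIcc hτ))) (hβ0 τ))⟩
  have hz1 : ‖z t₁‖ = 0 := by
    have := hle t₁ ht₁
    linarith [norm_nonneg (z t₁)]
  filter_upwards [hnhds] with s' hs'
  refine ⟨fun _ => ?_, fun _ => hzs⟩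
  have := hle s' hs'
  rw [hz1, mul_zero] at this
  exact norm_le_zero_iff.1 this

/-- Lipschitz maps preserve absolute continuity. -/
theorem absolutelyContinuousOnInterval_comp_of_lipschitzOnWith {G' : Type*} [NormedAddCommGroup G']
    {f : ℝ → G} {g : G → G'} {K : NNReal} {s : Set G} {a b : ℝ}
    (hf : AbsolutelyContinuousOnInterval f a b) (hg : LipschitzOnWith K g s)
    (hfs : MapsTo f (uIcc a b) s) : AbsolutelyContinuousOnInterval (g ∘ f) a b := by
  rw [absolutelyContinuousOnInterval_iff] at hf ⊢
  intro ε hε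
  obtain ⟨δ, hδ, h⟩ := hf (ε / (K + 1)) (by positivity)
  refine ⟨δ, hδ, fun I hI hsum => ?_⟩
  have h1 := h I hI hsum
  calc ∑ i ∈ Finset.range I.1, dist ((g ∘ f) (I.2 i).1) ((g ∘ f) (I.2 i).2)
      ≤ ∑ i ∈ Finset.range I.1, K * dist (f (I.2 i).1) (f (I.2 i).2) :=
        Finset.sum_le_sum fun i hi =>
          hg.dist_le_mul _ (hfs (hI.1 i hi).1) _ (hfs (hI.1 i hi).2)
    _ = K * ∑ i ∈ Finset.range I.1, dist (f (I.2 i).1) (f (I.2 i).2) := by rw [Finset.mul_sum]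
    _ ≤ (K + 1) * ∑ i ∈ Finset.range I.1, dist (f (I.2 i).1) (f (I.2 i).2) := by
        refine mul_le_mul_of_nonneg_right (by linarith) (Finset.sum_nonneg fun _ _ => dist_nonneg)
    _ < (K + 1) * (ε / (K + 1)) := by gcongr
    _ = ε := by field_simp

end Gronwall

/-! ### The defect of an immersion and its differential inequality -/

section Transverse

variable {E F : Type*} [NormedAddCommGroup E] [NormedSpace ℝ E] [NormedAddCommGroup F]
  [NormedSpace ℝ F]

/-- A smooth immersion has a smooth left inverse, locally. -/
theorem exists_smooth_leftInverse [FiniteDimensional ℝ F] [FiniteDimensional ℝ E] {f : F → E}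
    {u₀ : F} (hf : ∀ᶠ u in 𝓝 u₀, ContDiffAt ℝ ∞ f u) (hinj : Function.Injective (fderiv ℝ f u₀)) :
    ∃ r : E → F, r (f u₀) = u₀ ∧ (∀ᶠ w in 𝓝 (f u₀), ContDiffAt ℝ ∞ r w) ∧
      ∀ᶠ u in 𝓝 u₀, r (f u) = u := by
  have : CompleteSpace F := FiniteDimensional.complete ℝ F
  -- If `A` is a linear left inverse of the derivative, then `A ∘ f` is a local diffeomorphism, and
  -- its inverse composed with `A` is a left inverse of `f`.
  obtain ⟨A', hA'⟩ := LinearMap.exists_leftInverse_of_injective (fderiv ℝ f u₀).toLinearMap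
    (LinearMap.ker_eq_bot.2 hinj)
  let A : E →L[ℝ] F := LinearMap.toContinuousLinearMap A'
  have hA : A.comp (fderiv ℝ f u₀) = (ContinuousLinearEquiv.refl ℝ F : F →L[ℝ] F) :=
    ContinuousLinearMap.ext fun η => LinearMap.congr_fun hA' η
  have hd : HasFDerivAt (A ∘ f) ((ContinuousLinearEquiv.refl ℝ F : F ≃L[ℝ] F) : F →L[ℝ] F) u₀ := by
    rw [← hA]
    exact A.hasFDerivAt.comp u₀ (hf.self_of_nhds.differentiableAt (by simp)).hasFDerivAt
  obtain ⟨g, hg0, hg1, -, hg2⟩ := exists_smooth_local_inverse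
    (hf.mono fun u hu => A.contDiff.contDiffAt.comp u hu) _ hd
  refine ⟨g ∘ A, hg0, ?_, hg2⟩
  have hc : Tendsto A (𝓝 (f u₀)) (𝓝 ((A ∘ f) u₀)) := A.continuous.continuousAt
  filter_upwards [hc.eventually hg1] with w hw
  exact ContDiffAt.comp w hw A.contDiff.contDiffAt

/-- If `r` is a left inverse of the immersion `f`, then the function `w ↦ w - f (r w)`, which
defines the image of `f`, satisfies a linear differential inequality along every vector field that
is tangent to this image. -/
theorem exists_norm_fderiv_defect_le {f : F → E} {r : E → F} {u₀ : F}
    (hf : ∀ᶠ u in 𝓝 u₀, ContDiffAt ℝ ∞ f u) (hr0 : r (f u₀) = u₀)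
    (hr : ∀ᶠ w in 𝓝 (f u₀), ContDiffAt ℝ ∞ r w) (hrf : ∀ᶠ u in 𝓝 u₀, r (f u) = u)
    {Y : E → E} (hY : ∀ᶠ w in 𝓝 (f u₀), ContDiffAt ℝ ∞ Y w)
    (hYf : ∀ᶠ u in 𝓝 u₀, ∃ η, fderiv ℝ f u η = Y (f u)) :
    ∃ C : ℝ, 0 ≤ C ∧ ∀ᶠ w in 𝓝 (f u₀),
      ‖fderiv ℝ (fun w => w - f (r w)) w (Y w)‖ ≤ C * ‖w - f (r w)‖ := by
  have hrc : Tendsto r (𝓝 (f u₀)) (𝓝 u₀) := by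
    have := hr.self_of_nhds.continuousAt
    rwa [ContinuousAt, hr0] at this
  have hfc : Tendsto f (𝓝 u₀) (𝓝 (f u₀)) := hf.self_of_nhds.continuousAt
  have hv : ∀ᶠ w in 𝓝 (f u₀), ContDiffAt ℝ ∞ (fun w => w - f (r w)) w := by
    filter_upwards [hr, hrc.eventually hf] with w h1 h2
    exact contDiffAt_id.sub (ContDiffAt.comp (g := f) w h2 h1)
  -- The defect vanishes along `f` and `Y` is tangent to the image of `f`, so `g` vanishes on this
  -- image. As `g` is locally Lipschitz, comparing its values at `w` and `f (r w)` gives the bound.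
  set g : E → E := fun w => fderiv ℝ (fun w => w - f (r w)) w (Y w) with hg
  have hg1 : ContDiffAt ℝ 1 g (f u₀) :=
    (hv.self_of_nhds.fderiv_right (m := 1) (WithTop.coe_le_coe.2 le_top)).clm_apply
      (hY.self_of_nhds.of_le (by simp))
  obtain ⟨K, s, hs, hK⟩ := hg1.exists_lipschitzOnWith
  have hgf : ∀ᶠ u in 𝓝 u₀, g (f u) = 0 := by
    filter_upwards [hYf, hf, hfc.eventually hv, eventually_eventually_nhds.2 hrf]
      with u ⟨η, hη⟩ h1 h2 h3
    have h4 : HasFDerivAt ((fun w => w - f (r w)) ∘ f)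
        ((fderiv ℝ (fun w => w - f (r w)) (f u)).comp (fderiv ℝ f u)) u :=
      (h2.differentiableAt (by simp)).hasFDerivAt.comp u (h1.differentiableAt (by simp)).hasFDerivAt
    have h5 : HasFDerivAt ((fun w => w - f (r w)) ∘ f) (0 : F →L[ℝ] E) u := by
      refine (hasFDerivAt_const (0 : E) u).congr_of_eventuallyEq ?_
      filter_upwards [h3] with u' hu'
      simp [hu']
    have h6 := congrArg (fun L => L η) (h4.unique h5)
    simpa [hg, ← hη] using h6
  refine ⟨K, K.2, ?_⟩
  filter_upwards [hs, hrc.eventually hgf, (hfc.comp hrc).eventually hs] with w h1 h2 h3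
  have h4 := hK.dist_le_mul w h1 (f (r w)) h3
  rw [h2, dist_zero_right, dist_eq_norm] at h4
  exact h4

end Transverse

/-! ### Horizontal curves stay in plaques; uniqueness of plaques -/

section Stay

set_option linter.unusedSectionVars false

variable {E : Type v} [NormedAddCommGroup E] [NormedSpace ℝ E]
  {M : Type u} [TopologicalSpace M] [ChartedSpace E M] [IsManifold 𝓘(ℝ, E) ∞ M]
  {F : Type*} [NormedAddCommGroup F] [NormedSpace ℝ F]
  {F' : Type*} [NormedAddCommGroup F'] [NormedSpace ℝ F']
  [FiniteDimensional ℝ E] [T2Space M] [FiniteDimensional ℝ F] [FiniteDimensional ℝ F']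
  {D : TangentDistribution E M}

theorem IsPlaqueAt.exists_fderiv_eq_inChart {ψ : F → M} {u : F} (h : IsPlaqueAt D ψ u) (y : M)
    (hu : ψ u ∈ (chartAt E y).source) {X : LocalVectorField E M} (hX : X ∈ horizontalFields D)
    (hXu : ψ u ∈ X.domain) :
    ∃ η, fderiv ℝ (chartAt E y ∘ ψ) u η = X.inChart y ((chartAt E y ∘ ψ) u) := by
  have h1 : X.val (ψ u) ∈ D.fiber (ψ u) := hX _ hXu
  rw [← h.range_eq] at h1
  obtain ⟨η, hη⟩ := h1
  refine ⟨η, ?_⟩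
  rw [(contDiffAt_chart_comp y hu h.contMDiffAt).2, Function.comp_apply, ← X.tmap_chartAt y hu,
    ← hη]
  rfl

/-- An integral manifold is locally the zero set of a function that satisfies a linear differential
inequality along all vector fields tangent to the distribution. -/
theorem exists_defect {ψ : F → M} {u₀ : F} (hψ : ∀ᶠ u in 𝓝 u₀, IsPlaqueAt D ψ u) {e : M → E}
    (he : e = chartAt E (ψ u₀)) :
    ∃ r : E → F, r (e (ψ u₀)) = u₀ ∧ (∀ᶠ w in 𝓝 (e (ψ u₀)), ContDiffAt ℝ ∞ r w) ∧
      (∀ᶠ w in 𝓝 (e (ψ u₀)), ContDiffAt ℝ ∞ (fun w => w - e (ψ (r w))) w) ∧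
      (∀ᶠ m in 𝓝 (ψ u₀), e m - e (ψ (r (e m))) = 0 → ψ (r (e m)) = m) ∧
      ∀ X ∈ horizontalFields D, ψ u₀ ∈ X.domain → ∃ C : ℝ, 0 ≤ C ∧ ∀ᶠ w in 𝓝 (e (ψ u₀)),
        ‖fderiv ℝ (fun w => w - e (ψ (r w))) w (X.inChart (ψ u₀) w)‖ ≤ C * ‖w - e (ψ (r w))‖ := by
  subst he
  set e := chartAt E (ψ u₀) with he
  have hs : ψ u₀ ∈ e.source := mem_chart_source E _
  have hψc : Tendsto ψ (𝓝 u₀) (𝓝 (ψ u₀)) := hψ.self_of_nhds.contMDiffAt.continuousAt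
  have hsrc : ∀ᶠ u in 𝓝 u₀, ψ u ∈ e.source := hψc.eventually (e.open_source.mem_nhds hs)
  have hf : ∀ᶠ u in 𝓝 u₀, ContDiffAt ℝ ∞ (e ∘ ψ) u := by
    filter_upwards [hψ, hsrc] with u h1 h2
    exact (contDiffAt_chart_comp _ h2 h1.contMDiffAt).1
  obtain ⟨r, hr0, hr1, hr2⟩ := exists_smooth_leftInverse hf
    (injective_fderiv_chart_comp _ hs hψ.self_of_nhds.contMDiffAt hψ.self_of_nhds.injective)
  have hrc : Tendsto r (𝓝 (e (ψ u₀))) (𝓝 u₀) := by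
    have := hr1.self_of_nhds.continuousAt
    rwa [ContinuousAt, hr0] at this
  refine ⟨r, hr0, hr1, ?_, ?_, ?_⟩
  · filter_upwards [hr1, hrc.eventually hf] with w h1 h2
    exact contDiffAt_id.sub (ContDiffAt.comp (g := e ∘ ψ) w h2 h1)
  · have hec : Tendsto e (𝓝 (ψ u₀)) (𝓝 (e (ψ u₀))) := e.continuousAt hs
    filter_upwards [e.open_source.mem_nhds hs, (hrc.comp hec).eventually hsrc] with m h1 h2 h3
    exact (e.injOn h1 h2 (sub_eq_zero.1 h3)).symm
  · intro X hX hXu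
    refine exists_norm_fderiv_defect_le hf hr0 hr1 hr2
      (X.eventually_contDiffAt_inChart _ hs hXu) ?_
    filter_upwards [hψ, hsrc, hψc.eventually (X.isOpen_domain.mem_nhds hXu)] with u h1 h2 h3
    exact h1.exists_fderiv_eq_inChart _ h2 hX h3

/-- A curve controlled by vector fields tangent to the distribution that passes through a point of
an integral manifold remains for a short time in this integral manifold, and is continuous in it. -/
theorem IsControlledBy.exists_lift {γ : ℝ → M} {a b : ℝ} {k : ℕ}
    {X : Fin k → LocalVectorField E M} (hγ : IsControlledBy γ a b X)
    (hX : ∀ j, X j ∈ horizontalFields D) {t₀ : ℝ} (ht₀ : t₀ ∈ Icc a b) {ψ : F → M} {u₀ : F}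
    (hψ : ∀ᶠ u in 𝓝 u₀, IsPlaqueAt D ψ u) (h0 : ψ u₀ = γ t₀) :
    ∃ h : M → F, h (γ t₀) = u₀ ∧ ContinuousAt h (γ t₀) ∧
      ∀ᶠ t in 𝓝[Icc a b] t₀, ψ (h (γ t)) = γ t := by
  obtain ⟨⟨hcont, hac⟩, hdom, w, hw, hvel⟩ := hγ
  set e := chartAt E (ψ u₀) with he
  have hs : ψ u₀ ∈ e.source := mem_chart_source E _
  have hec : Tendsto e (𝓝 (ψ u₀)) (𝓝 (e (ψ u₀))) := e.continuousAt hs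
  obtain ⟨r, hr0, hr1, hv, hzero, hC⟩ := exists_defect hψ (e := e) rfl
  have hc₀ : Tendsto γ (𝓝[Icc a b] t₀) (𝓝 (ψ u₀)) := by rw [h0]; exact hcont t₀ ht₀
  choose C hC0 hC1 using fun j => hC (X j) (hX j) (by rw [h0]; exact hdom j ht₀)
  set v : E → E := fun w => w - e (ψ (r w)) with hvdef
  obtain ⟨K, s, hsn, hK⟩ := (hv.self_of_nhds.of_le (by simp) : ContDiffAt ℝ 1 v _
    ).exists_lipschitzOnWith
  have hall : ∀ᶠ t in 𝓝[Icc a b] t₀, γ t ∈ e.source ∧ e (γ t) ∈ s ∧ ContDiffAt ℝ ∞ v (e (γ t)) ∧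
      (v (e (γ t)) = 0 → ψ (r (e (γ t))) = γ t) ∧
      ∀ j, ‖fderiv ℝ v (e (γ t)) ((X j).inChart (ψ u₀) (e (γ t)))‖ ≤ C j * ‖v (e (γ t))‖ :=
    (hc₀.eventually (e.open_source.mem_nhds hs)).and <|
    ((hec.comp hc₀).eventually hsn).and <| ((hec.comp hc₀).eventually hv).and <|
    (hc₀.eventually hzero).and <| eventually_all.2 fun j => (hec.comp hc₀).eventually (hC1 j)
  obtain ⟨c, d, htcd, hsub, hnhds, hP⟩ := exists_Icc_of_eventually_nhdsWithin_Icc ht₀ hall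
  have hcd : c ≤ d := htcd.1.trans htcd.2
  have hc' := (hsub (left_mem_Icc.2 hcd)).1
  have hd' := (hsub (right_mem_Icc.2 hcd)).2
  have hac' : AbsolutelyContinuousOnInterval (v ∘ (e ∘ γ)) c d := by
    refine absolutelyContinuousOnInterval_comp_of_lipschitzOnWith (s := s)
      (hac e (IsManifold.chart_mem_maximalAtlas _) c d hc' hcd hd' fun t ht => (hP t ht).1) hK ?_
    rw [uIcc_of_le hcd]
    exact fun t ht => (hP t ht).2.1
  have hz0 : (v ∘ (e ∘ γ)) t₀ = 0 := by
    have : v (e (γ t₀)) = 0 := by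
      rw [← h0]; simp only [hvdef]; rw [hr0, sub_self]
    exact this
  have hw' : ∀ j, IntervalIntegrable (w j) volume c d := fun j =>
    (intervalIntegrable_iff_integrableOn_Icc_of_le hcd).2 ((hw j).mono_set hsub)
  have hβ : IntervalIntegrable (fun t => ∑ j, C j * |w j t|) volume c d := by
    have := IntervalIntegrable.sum Finset.univ
      (f := fun j t => C j * |w j t|) (μ := volume) (a := c) (b := d)
      (fun j _ => (hw' j).abs.const_mul (C j))
    simpa only [Finset.sum_fn] using this
  -- Almost everywhere the derivative of the defect along `γ` is the sum of the controls times the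
  -- derivatives of the defect along the `X j`, so Gronwall's lemma applies with `β = ∑ j, C j * |w
  -- j|`, which is integrable.
  have key := eq_zero_of_ae_norm_deriv_le hcd hac'
    (β := fun t => ∑ j, C j * |w j t|)
    (fun t => Finset.sum_nonneg fun j _ => mul_nonneg (hC0 j) (abs_nonneg _)) hβ ?_ htcd hz0
  · refine ⟨r ∘ e, ?_, ?_, ?_⟩
    · rw [← h0]; exact hr0
    · rw [← h0]
      exact ContinuousAt.comp (g := r) hr1.self_of_nhds.continuousAt (e.continuousAt hs)
    · filter_upwards [hnhds] with t ht
      exact (hP t ht).2.2.2.1 (key t ht)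
  · filter_upwards [ae_restrict_of_ae_restrict_of_subset hsub hvel,
      ae_restrict_mem measurableSet_Icc] with t h1 ht
    obtain ⟨h2, h3, h4, -, h5⟩ := hP t ht
    have hvel' : HasVelocity γ t (∑ j, w j t • (X j).val (γ t)) := h1
    have h6 := hvel'.comp (f := e) ((mdifferentiable_chartAt _).mdifferentiableAt h2)
    rw [hasVelocity_iff_hasDerivAt, map_sum] at h6
    have h7 : ∀ j, tmap (E := E) (E' := E) e (γ t) (w j t • (X j).val (γ t)) =
        w j t • (X j).inChart (ψ u₀) (e (γ t)) := fun j => by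
      rw [map_smul, (X j).tmap_chartAt _ h2]
    simp only [h7] at h6
    have h8 := (h4.differentiableAt (by simp)).hasFDerivAt.comp_hasDerivAt t h6
    refine ⟨_, h8, ?_⟩
    rw [map_sum, Finset.sum_mul]
    refine (norm_sum_le _ _).trans (Finset.sum_le_sum fun j _ => ?_)
    rw [map_smul, norm_smul, Real.norm_eq_abs, mul_comm (C j), mul_assoc]
    exact mul_le_mul_of_nonneg_left (h5 j) (abs_nonneg _)

theorem subset_horizontalFields_spannedBy (V : Set (LocalVectorField E M)) :
    V ⊆ horizontalFields (spannedBy V) := fun _ hX _ hx => val_mem_fiber hX hx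

/-- A function with `‖θ'‖ ≤ C ‖θ‖` that vanishes at `u₀` vanishes near `u₀`. -/
theorem eventually_eq_zero_of_norm_fderiv_le {θ : F → E} {u₀ : F} {C : ℝ}
    (hθ : ∀ᶠ u in 𝓝 u₀, DifferentiableAt ℝ θ u)
    (hle : ∀ᶠ u in 𝓝 u₀, ∀ η, ‖fderiv ℝ θ u η‖ ≤ C * ‖η‖ * ‖θ u‖) (h0 : θ u₀ = 0) :
    ∀ᶠ u in 𝓝 u₀, θ u = 0 := by
  obtain ⟨ε, hε, hball⟩ := Metric.eventually_nhds_iff_ball.1 (hθ.and hle)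
  refine Metric.eventually_nhds_iff_ball.2 ⟨ε, hε, fun u hu => ?_⟩
  have hmem : ∀ s ∈ Icc (0 : ℝ) 1, u₀ + s • (u - u₀) ∈ Metric.ball u₀ ε := fun s hs =>
    (convex_ball u₀ ε).add_smul_sub_mem (Metric.mem_ball_self hε) hu hs
  have hd : ∀ s ∈ Icc (0 : ℝ) 1, HasDerivAt (fun s : ℝ => θ (u₀ + s • (u - u₀)))
      (fderiv ℝ θ (u₀ + s • (u - u₀)) (u - u₀)) s := fun s hs => by
    have h1 : HasDerivAt (fun s : ℝ => u₀ + s • (u - u₀)) (u - u₀) s := by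
      simpa using ((hasDerivAt_id s).smul_const (u - u₀)).const_add u₀
    exact (hball _ (hmem s hs)).1.hasFDerivAt.comp_hasDerivAt s h1
  have := eq_zero_of_abs_deriv_le_mul_abs_self_of_eq_zero_right
    (f := fun s : ℝ => θ (u₀ + s • (u - u₀)))
    (f' := fun s => fderiv ℝ θ (u₀ + s • (u - u₀)) (u - u₀)) (K := C * ‖u - u₀‖) (a := 0) (b := 1)
    (fun s hs => (hd s hs).continuousAt.continuousWithinAt)
    (fun s hs => (hd s ⟨hs.1, hs.2.le⟩).hasDerivWithinAt) (by simpa using h0)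
    (fun s hs => (hball _ (hmem s ⟨hs.1, hs.2.le⟩)).2 _) 1 (by simp)
  simpa using this

/-- Local uniqueness of integral manifolds: one of two integral manifolds through the same point
factors locally through the other one. -/
theorem exists_plaque_transition {V : Set (LocalVectorField E M)} {ψ : F → M} {u₀ : F}
    (hψ : ∀ᶠ u in 𝓝 u₀, IsPlaqueAt (spannedBy V) ψ u) {ψ' : F' → M} {u₀' : F'}
    (hψ' : ∀ᶠ u in 𝓝 u₀', IsPlaqueAt (spannedBy V) ψ' u) (h0 : ψ' u₀' = ψ u₀) :
    ∃ h : F → F', h u₀ = u₀' ∧ (∀ᶠ u in 𝓝 u₀, ContDiffAt ℝ ∞ h u) ∧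
      ∀ᶠ u in 𝓝 u₀, ψ' (h u) = ψ u := by
  set D := spannedBy V with hD
  set e := chartAt E (ψ' u₀') with he
  obtain ⟨r, hr0, hr1, hv, hzero, hC⟩ := exists_defect hψ' (e := e) rfl
  set v : E → E := fun w => w - e (ψ' (r w)) with hvdef
  have hs : ψ u₀ ∈ e.source := by rw [← h0]; exact mem_chart_source E _
  have hψc : Tendsto ψ (𝓝 u₀) (𝓝 (ψ u₀)) := hψ.self_of_nhds.contMDiffAt.continuousAt
  have hsrc : ∀ᶠ u in 𝓝 u₀, ψ u ∈ e.source := hψc.eventually (e.open_source.mem_nhds hs)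
  have hf : ∀ᶠ u in 𝓝 u₀, ContDiffAt ℝ ∞ (e ∘ ψ) u := by
    filter_upwards [hψ, hsrc] with u h1 h2
    exact (contDiffAt_chart_comp _ h2 h1.contMDiffAt).1
  have hfc : Tendsto (e ∘ ψ) (𝓝 u₀) (𝓝 (e (ψ u₀))) := hf.self_of_nhds.continuousAt
  rw [h0] at hr0 hr1 hv hzero
  -- a local frame
  have hrank : ∀ u, IsPlaqueAt D ψ u → Module.finrank ℝ (D.fiber (ψ u)) = Module.finrank ℝ F :=
    fun u hu => by rw [← hu.range_eq, LinearMap.finrank_range_of_inj hu.injective]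
  obtain ⟨k, hk⟩ : ∃ k, Module.finrank ℝ F = k := ⟨_, rfl⟩
  obtain ⟨Y, hY, hli⟩ := exists_fields_linearIndependent V ((hrank u₀ hψ.self_of_nhds).trans hk)
  have hYH : ∀ i, Y i ∈ horizontalFields D := fun i =>
    subset_horizontalFields_spannedBy V (hY i).1
  choose C hC0 hC1 using fun i => hC (Y i) (hYH i) (by rw [h0]; exact (hY i).2)
  rw [h0] at hC1
  let B : F → (Fin k → ℝ) →L[ℝ] E := fun u =>
    ∑ i, (ContinuousLinearMap.proj i : (Fin k → ℝ) →L[ℝ] ℝ).smulRight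
      ((Y i).inChart (ψ' u₀') (e (ψ u)))
  have hBapp : ∀ u a, B u a = ∑ i, a i • (Y i).inChart (ψ' u₀') (e (ψ u)) := fun u a => by
    simp only [B]; rw [_root_.sum_apply]; rfl
  have hYc : ∀ i, ContinuousAt (fun u => (Y i).inChart (ψ' u₀') (e (ψ u))) u₀ := fun i =>
    ContinuousAt.comp (g := (Y i).inChart (ψ' u₀')) (f := e ∘ ψ)
      ((Y i).eventually_contDiffAt_inChart _ hs (hY i).2).self_of_nhds.continuousAt
      hf.self_of_nhds.continuousAt
  have hBc : ContinuousAt B u₀ := by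
    refine tendsto_finsetSum _ fun i _ => ?_
    exact ((ContinuousLinearMap.smulRightL ℝ (Fin k → ℝ) E
      (ContinuousLinearMap.proj i)).continuous.continuousAt).tendsto.comp (hYc i)
  have hBinj : Function.Injective (B u₀) := by
    refine (injective_iff_map_eq_zero _).2 fun a ha => ?_
    have h1 : B u₀ a = tmap (E := E) (E' := E) e (ψ u₀) (∑ i, a i • (Y i).val (ψ u₀)) := by
      rw [hBapp, map_sum]
      refine Finset.sum_congr rfl fun i _ => ?_
      rw [map_smul, (Y i).tmap_chartAt _ hs]
    rw [h1] at ha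
    have h2 := congrArg (tmap (E := E) (E' := E) e.symm (e (ψ u₀))) ha
    rw [tmap_chartAt_symm_tmap _ hs, map_zero] at h2
    exact funext fun i => Fintype.linearIndependent_iff.1 hli a h2 i
  obtain ⟨C₁, hC₁, hanti⟩ := eventually_norm_le_of_injective hBinj
  have hYdom : ∀ᶠ u in 𝓝 u₀, ∀ i, ψ u ∈ (Y i).domain := eventually_all.2 fun i =>
    hψc.eventually ((Y i).isOpen_domain.mem_nhds (hY i).2)
  -- Near `u₀` the frame is still independent and tangent to `ψ`. By dimension it spans all tangent
  -- directions, with coefficients bounded through `C₁`.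
  have hrange : ∀ᶠ u in 𝓝 u₀, ∀ η, ∃ a, B u a = fderiv ℝ (e ∘ ψ) u η := by
    filter_upwards [hψ, hsrc, hYdom, hBc.eventually hanti] with u h1 h2 h3 h4
    have hle : LinearMap.range (B u).toLinearMap ≤
        LinearMap.range (fderiv ℝ (e ∘ ψ) u).toLinearMap := by
      rintro _ ⟨a, rfl⟩
      change B u a ∈ _
      rw [hBapp]
      refine Submodule.sum_mem _ fun i _ => Submodule.smul_mem _ _ ?_
      exact h1.exists_fderiv_eq_inChart _ h2 (hYH i) (h3 i)
    have heq := Submodule.eq_of_le_of_finrank_eq hle (by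
      rw [LinearMap.finrank_range_of_inj (injective_of_norm_le h4),
        LinearMap.finrank_range_of_inj (injective_fderiv_chart_comp _ h2 h1.contMDiffAt
          h1.injective)]
      simp [hk])
    intro η
    have h5 : fderiv ℝ (e ∘ ψ) u η ∈ LinearMap.range (fderiv ℝ (e ∘ ψ) u).toLinearMap := ⟨η, rfl⟩
    rw [← heq] at h5
    exact h5
  have hfb : ∀ᶠ u in 𝓝 u₀, ‖fderiv ℝ (e ∘ ψ) u‖ ≤ ‖fderiv ℝ (e ∘ ψ) u₀‖ + 1 := by
    have hc : ContinuousAt (fderiv ℝ (e ∘ ψ)) u₀ :=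
      (hf.self_of_nhds.fderiv_right (m := 0) (by simp)).continuousAt
    exact (hc.norm.eventually (gt_mem_nhds (lt_add_one _))).mono fun u hu => hu.le
  set L := ‖fderiv ℝ (e ∘ ψ) u₀‖ + 1 with hL
  -- `θ` is the defect of `ψ'` evaluated along `ψ`. Expanding a direction in the frame bounds
  -- `fderiv ℝ θ u` by a multiple of `‖θ u‖`, so `θ` vanishes near `u₀`, which puts `ψ` into the
  -- image of `ψ'`.
  have hθ := eventually_eq_zero_of_norm_fderiv_le (θ := v ∘ (e ∘ ψ)) (u₀ := u₀)
    (C := C₁ * L * ∑ i, C i) ?_ ?_ ?_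
  · refine ⟨fun u => r (e (ψ u)), hr0, ?_, ?_⟩
    · filter_upwards [hf, hfc.eventually hr1] with u h1 h2
      exact ContDiffAt.comp (g := r) u h2 h1
    · filter_upwards [hθ, hψc.eventually hzero] with u h1 h2 using h2 h1
  · filter_upwards [hf, hfc.eventually hv] with u h1 h2
    exact (h2.differentiableAt (by simp)).comp u (h1.differentiableAt (by simp))
  · filter_upwards [hf, hfc.eventually hv, hrange, hfb, hBc.eventually hanti,
      eventually_all.2 fun i => hfc.eventually (hC1 i)] with u h1 h2 h3 h4 h5 h6 η
    rw [fderiv_comp u (h2.differentiableAt (by simp)) (h1.differentiableAt (by simp)),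
      ContinuousLinearMap.comp_apply]
    obtain ⟨a, ha⟩ := h3 η
    have h7 : ‖a‖ ≤ C₁ * (L * ‖η‖) := by
      refine (h5 a).trans (mul_le_mul_of_nonneg_left ?_ hC₁.le)
      rw [ha]
      exact (ContinuousLinearMap.le_opNorm _ _).trans
        (mul_le_mul_of_nonneg_right h4 (norm_nonneg _))
    rw [← ha, hBapp, map_sum]
    calc ‖∑ i, fderiv ℝ v ((e ∘ ψ) u) (a i • (Y i).inChart (ψ' u₀') (e (ψ u)))‖
        ≤ ∑ i, ‖a‖ * (C i * ‖v ((e ∘ ψ) u)‖) := by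
          refine (norm_sum_le _ _).trans (Finset.sum_le_sum fun i _ => ?_)
          rw [map_smul, norm_smul]
          have h8 := h6 i
          rw [← h0] at h8
          exact mul_le_mul (norm_le_pi_norm a i) h8 (norm_nonneg _) (norm_nonneg _)
      _ = ‖a‖ * (∑ i, C i) * ‖v ((e ∘ ψ) u)‖ := by
          rw [← Finset.mul_sum, ← Finset.sum_mul, mul_assoc]
      _ ≤ (C₁ * (L * ‖η‖)) * (∑ i, C i) * ‖v ((e ∘ ψ) u)‖ := by
          refine mul_le_mul_of_nonneg_right (mul_le_mul_of_nonneg_right h7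
            (Finset.sum_nonneg fun i _ => hC0 i)) (norm_nonneg _)
      _ = C₁ * L * (∑ i, C i) * ‖η‖ * ‖(v ∘ (e ∘ ψ)) u‖ := by
          simp only [Function.comp_apply]; ring
  · simp only [Function.comp_apply, hvdef]
    rw [hr0, h0, sub_self]

end Stay

/-! ### Absolute continuity under time reversal -/

section Reversal

theorem absolutelyContinuousOnInterval_congr {Y : Type*} [PseudoMetricSpace Y] {f g : ℝ → Y}
    {a b : ℝ} (h : AbsolutelyContinuousOnInterval f a b) (hfg : EqOn g f (uIcc a b)) :
    AbsolutelyContinuousOnInterval g a b := by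
  rw [absolutelyContinuousOnInterval_iff] at h ⊢
  intro ε hε
  obtain ⟨δ, hδ, h⟩ := h ε hε
  refine ⟨δ, hδ, fun I hI hs => ?_⟩
  have h1 : ∑ i ∈ Finset.range I.1, dist (g (I.2 i).1) (g (I.2 i).2) =
      ∑ i ∈ Finset.range I.1, dist (f (I.2 i).1) (f (I.2 i).2) :=
    Finset.sum_congr rfl fun i hi => by rw [hfg (hI.1 i hi).1, hfg (hI.1 i hi).2]
  rw [h1]
  exact h I hI hs

theorem disjoint_uIoc_sub_left {p q r s c : ℝ} (h : Disjoint (uIoc p q) (uIoc r s)) :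
    Disjoint (uIoc (c - p) (c - q)) (uIoc (c - r) (c - s)) := by
  simp only [uIoc, Ioc_disjoint_Ioc, min_sub_sub_left, max_sub_sub_left] at h ⊢
  linarith

theorem absolutelyContinuousOnInterval_comp_sub_left {Y : Type*} [PseudoMetricSpace Y] {f : ℝ → Y}
    {a b : ℝ} (c : ℝ) (h : AbsolutelyContinuousOnInterval f (c - b) (c - a)) :
    AbsolutelyContinuousOnInterval (fun t => f (c - t)) a b := by
  rw [absolutelyContinuousOnInterval_iff] at h ⊢
  intro ε hε
  obtain ⟨δ, hδ, h⟩ := h ε hε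
  have hm : ∀ t ∈ uIcc a b, c - t ∈ uIcc (c - b) (c - a) := fun t ht => by
    rcases mem_uIcc.1 ht with h | h
    · exact mem_uIcc.2 (.inl ⟨by linarith [h.2], by linarith [h.1]⟩)
    · exact mem_uIcc.2 (.inr ⟨by linarith [h.2], by linarith [h.1]⟩)
  refine ⟨δ, hδ, fun I hI hs => ?_⟩
  refine h (I.1, fun i => (c - (I.2 i).1, c - (I.2 i).2)) ⟨fun i hi =>
    ⟨hm _ (hI.1 i hi).1, hm _ (hI.1 i hi).2⟩, fun i hi j hj hij =>
    disjoint_uIoc_sub_left (hI.2 hi hj hij)⟩ ?_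
  simpa only [dist_sub_left] using hs

end Reversal

/-! ### Accessibility as an equivalence relation containing the flow lines -/

section Acc

set_option linter.unusedSectionVars false

variable {E : Type v} [NormedAddCommGroup E] [NormedSpace ℝ E]
  {M : Type u} [TopologicalSpace M] [ChartedSpace E M] [IsManifold 𝓘(ℝ, E) ∞ M]
  {H : TangentDistribution E M} {X Y Z : LocalVectorField E M}

theorem IsControlledBy.congr {γ γ' : ℝ → M} {a b : ℝ} {k : ℕ} {X : Fin k → LocalVectorField E M}
    (h : IsControlledBy γ a b X) (heq : EqOn γ' γ (Icc a b)) : IsControlledBy γ' a b X := by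
  obtain ⟨⟨hc, hac⟩, hd, w, hw, hv⟩ := h
  refine ⟨⟨hc.congr heq, fun e he t₀ t₁ h0 h01 h1 hm => ?_⟩, fun j t ht => ?_, w, hw, ?_⟩
  · have hsub : Icc t₀ t₁ ⊆ Icc a b := Icc_subset_Icc h0 h1
    refine absolutelyContinuousOnInterval_congr (hac e he t₀ t₁ h0 h01 h1 fun t ht => ?_) ?_
    · rw [← heq (hsub ht)]; exact hm ht
    · intro t ht
      rw [uIcc_of_le h01] at ht
      simp only [Function.comp_apply, heq (hsub ht)]
  · rw [heq ht]; exact hd j ht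
  -- The derivatives are two-sided, so they transfer only at interior times; the endpoints form a
  -- null set.
  · rw [← Measure.restrict_congr_set Ioo_ae_eq_Icc] at hv ⊢
    filter_upwards [hv, ae_restrict_mem measurableSet_Ioo] with t ht hm
    have h1 : γ' =ᶠ[𝓝 t] γ := by
      filter_upwards [Icc_mem_nhds hm.1 hm.2] with s hs using heq hs
    rw [heq ⟨hm.1.le, hm.2.le⟩]
    exact HasMFDerivAt.congr_of_eventuallyEq ht h1

/-- The controls become `-w j (c - t)`; reflections preserve Lebesgue measure, so integrability and
almost-everywhere statements carry over. -/
theorem IsControlledBy.comp_sub_left {γ : ℝ → M} {a b : ℝ} {k : ℕ}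
    {X : Fin k → LocalVectorField E M} (h : IsControlledBy γ a b X) (c : ℝ) :
    IsControlledBy (fun t => γ (c - t)) (c - b) (c - a) X := by
  obtain ⟨⟨hc, hac⟩, hd, w, hw, hv⟩ := h
  have hmaps : MapsTo (fun t => c - t) (Icc (c - b) (c - a)) (Icc a b) := fun t ht =>
    ⟨by linarith [ht.2], by linarith [ht.1]⟩
  have hpre : (fun t => c - t) ⁻¹' Icc a b = Icc (c - b) (c - a) := by
    simp
  have hmp := (Measure.measurePreserving_sub_left (volume : Measure ℝ) c)
  refine ⟨⟨hc.comp (by fun_prop) hmaps, fun e he t₀ t₁ h0 h01 h1 hm => ?_⟩,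
    fun j t ht => hd j (hmaps ht), fun j t => - w j (c - t), fun j => ?_, ?_⟩
  · refine absolutelyContinuousOnInterval_comp_sub_left (f := e ∘ γ) c
      (hac e he (c - t₁) (c - t₀) (by linarith) (by linarith) (by linarith) fun t ht => ?_)
    have := hm (x := c - t) ⟨by linarith [ht.2], by linarith [ht.1]⟩
    simpa using this
  · have h1 := (hmp.integrableOn_comp_preimage (Homeomorph.subLeft c).measurableEmbedding).2 (hw j)
    rw [hpre] at h1
    exact h1.neg
  · have h1 := (hmp.restrict_preimage (measurableSet_Icc (a := a) (b := b)))
    rw [hpre] at h1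
    filter_upwards [h1.quasiMeasurePreserving.ae hv] with t ht
    have h2 : HasVelocity γ (c - t) (∑ j, w j (c - t) • (X j).val (γ (c - t))) := ht
    have h3 := HasVelocity.scomp (h := fun t => c - t) h2 ((hasDerivAt_id t).const_sub c)
    rw [neg_one_smul, ← Finset.sum_neg_distrib] at h3
    simp_rw [← neg_smul] at h3
    exact h3

/-- A translation of time is a composition of two reflections. -/
theorem IsControlledBy.comp_add {γ : ℝ → M} {a b : ℝ} {k : ℕ}
    {X : Fin k → LocalVectorField E M} (h : IsControlledBy γ a b X) (c : ℝ) :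
    IsControlledBy (fun t => γ (t + c)) (a - c) (b - c) X := by
  have := (h.comp_sub_left 0).comp_sub_left (-c)
  have h1 : ∀ t, 0 - (-c - t) = t + c := fun t => by ring
  have h2 : ∀ t, -c - (0 - t) = t - c := fun t => by ring
  simpa only [h1, h2] using this

variable (H) in
/-- `z` can be reached from `y` by a single controlled horizontal curve. -/
def IsJoined (y z : M) : Prop :=
  ∃ (γ : ℝ → M) (a b : ℝ) (k : ℕ) (X : Fin k → LocalVectorField E M), a ≤ b ∧
    (∀ j, X j ∈ horizontalFields H) ∧ IsControlledBy γ a b X ∧ γ a = y ∧ γ b = z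

theorem IsJoined.symm {y z : M} (h : IsJoined H y z) : IsJoined H z y := by
  obtain ⟨γ, a, b, k, X, hab, hX, hγ, hy, hz⟩ := h
  refine ⟨_, 0 - b, 0 - a, k, X, by linarith, hX, hγ.comp_sub_left 0, ?_, ?_⟩ <;> simpa

/-- Chains of single controlled curves make reflexivity, symmetry and transitivity of accessibility
formal. -/
theorem mem_accessibleSet_iff {x y : M} :
    y ∈ accessibleSet H x ↔ Relation.ReflTransGen (IsJoined H) x y := by
  constructor
  · rintro ⟨γ, a, b, -, ⟨n, τ, hτ, rfl, rfl, h⟩, rfl, rfl⟩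
    refine Fin.induction (motive := fun i => Relation.ReflTransGen (IsJoined H) (γ (τ 0)) (γ (τ i)))
      .refl (fun i hi => hi.tail ?_) (Fin.last n)
    obtain ⟨k, X, hX, hγ⟩ := h i
    exact ⟨γ, _, _, k, X, hτ i.castSucc_le_succ, hX, hγ, rfl, rfl⟩
  · intro h
    induction h with
    | refl =>
      exact ⟨fun _ => x, 0, 0, le_rfl, ⟨0, fun _ => 0, monotone_const, rfl, rfl, fun i => i.elim0⟩,
        rfl, rfl⟩
    | tail _ hj ih =>
      obtain ⟨γ, a, b, hab, ⟨n, τ, hτ, h0, hl, h⟩, hx, hy⟩ := ih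
      obtain ⟨γ', a', b', k, X, hab', hX, hγ', hy', hz⟩ := hj
      have hle : ∀ i, τ i ≤ b := fun i => hl ▸ hτ (Fin.le_last i)
      -- The new curve is shifted in time to start at `b`; at `t = b` both formulas give the common
      -- endpoint.
      let ζ : ℝ → M := fun t => if t ≤ b then γ t else γ' (t + (a' - b))
      have hζ : ∀ t, b ≤ t → ζ t = γ' (t + (a' - b)) := by
        intro t ht
        rcases ht.eq_or_lt with rfl | ht
        · simp [ζ, hy, hy']
        · simp [ζ, not_le.2 ht]
      refine ⟨ζ, a, b' - (a' - b), by linarith, ⟨n + 1, Fin.snoc τ (b' - (a' - b)), ?_, ?_, ?_, ?_⟩,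
        ?_, ?_⟩
      · refine Fin.monotone_iff_le_succ.2 fun i => ?_
        refine Fin.lastCases ?_ (fun i => ?_) i
        · rw [Fin.succ_last, Fin.snoc_last, Fin.snoc_castSucc, hl]; linarith
        · rw [← Fin.castSucc_succ, Fin.snoc_castSucc, Fin.snoc_castSucc]
          exact hτ i.castSucc_le_succ
      · rw [← Fin.castSucc_zero, Fin.snoc_castSucc, h0]
      · rw [Fin.snoc_last]
      · refine Fin.lastCases ?_ (fun i => ?_)
        · refine ⟨k, X, hX, ?_⟩
          rw [Fin.succ_last, Fin.snoc_last, Fin.snoc_castSucc, hl]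
          have := hγ'.comp_add (a' - b)
          rw [sub_sub_cancel] at this
          exact this.congr fun t ht => hζ t ht.1
        · obtain ⟨k, X, hX, hγ⟩ := h i
          refine ⟨k, X, hX, ?_⟩
          rw [← Fin.castSucc_succ, Fin.snoc_castSucc, Fin.snoc_castSucc]
          exact hγ.congr fun t ht => if_pos (ht.2.trans (hle _))
      · simp [ζ, hab, hx]
      · rw [hζ _ (by linarith), sub_add_cancel, hz]

theorem mem_accessibleSet_self (x : M) : x ∈ accessibleSet H x :=
  mem_accessibleSet_iff.2 .refl

theorem mem_accessibleSet_trans {x y z : M} (h : y ∈ accessibleSet H x)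
    (h' : z ∈ accessibleSet H y) : z ∈ accessibleSet H x :=
  mem_accessibleSet_iff.2 ((mem_accessibleSet_iff.1 h).trans (mem_accessibleSet_iff.1 h'))

theorem mem_accessibleSet_symm {x y : M} (h : y ∈ accessibleSet H x) : x ∈ accessibleSet H y := by
  rw [mem_accessibleSet_iff] at h ⊢
  have : Std.Symm (IsJoined H) := ⟨fun _ _ => IsJoined.symm⟩
  exact Relation.ReflTransGen.stdSymm.symm _ _ h

theorem accessibleSet_eq {x y : M} (h : y ∈ accessibleSet H x) :
    accessibleSet H y = accessibleSet H x :=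
  Subset.antisymm (fun _ hz => mem_accessibleSet_trans h hz)
    fun _ hz => mem_accessibleSet_trans (mem_accessibleSet_symm h) hz

variable [FiniteDimensional ℝ E] [T2Space M]

/-- Near `s` the curve is `r ↦ Φ (r - s, γ s)` for a smooth flow box `Φ`. -/
theorem LocalVectorField.IsCurveOn.contMDiffAt {γ : ℝ → M} {a b : ℝ}
    (h : X.IsCurveOn γ (Ioo a b)) {s : ℝ} (hs : s ∈ Ioo a b) :
    ContMDiffAt 𝓘(ℝ, ℝ) 𝓘(ℝ, E) ∞ γ s := by
  obtain ⟨Φ, δ, hδ, U, -, hyU, hΦ⟩ := X.exists_flow_near (h s hs).1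
  have h1 := (hΦ 0 ⟨by linarith, hδ⟩ _ hyU).1
  have h2 : ContMDiffAt 𝓘(ℝ, ℝ) 𝓘(ℝ, E) ∞ (fun r => Φ (r - s, γ s)) s := by
    refine ContMDiffAt.comp (g := Φ) s (I' := 𝓘(ℝ, ℝ).prod 𝓘(ℝ, E)) ?_
      (ContMDiffAt.prodMk (contDiff_id.sub contDiff_const).contMDiff.contMDiffAt
        contMDiffAt_const)
    simpa using h1
  refine h2.congr_of_eventuallyEq ?_
  have hc : ContinuousAt (fun r : ℝ => r - s) s := by fun_prop
  filter_upwards [isOpen_Ioo.mem_nhds hs, hc.preimage_mem_nhds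
    (isOpen_Ioo.mem_nhds (show s - s ∈ Ioo (-δ) δ by simp [hδ]))] with r hr hr'
  exact (h.flowsTo hs hr).unique (hΦ _ hr' _ hyU).2.1

theorem LocalVectorField.IsCurveOn.isControlledBy {γ : ℝ → M} {a b : ℝ}
    (h : X.IsCurveOn γ (Ioo a b)) {s t : ℝ} (hs : s ∈ Ioo a b) (ht : t ∈ Ioo a b) :
    IsControlledBy γ s t fun _ : Fin 1 => X := by
  have hsub : Icc s t ⊆ Ioo a b := fun r hr => ⟨hs.1.trans_le hr.1, hr.2.trans_lt ht.2⟩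
  refine ⟨⟨fun r hr => (h.continuousAt (hsub hr)).continuousWithinAt,
    fun e he t₀ t₁ h0 h01 h1 hm => ?_⟩, fun _ r hr => (h r (hsub hr)).1, fun _ _ => 1,
    fun _ => integrableOn_const (by simp), ?_⟩
  · refine ContDiffOn.absolutelyContinuousOnInterval (fun r hr => ?_)
    rw [uIcc_of_le h01] at hr
    have hr' := hsub (Icc_subset_Icc h0 h1 hr)
    have h2 : ContMDiffAt 𝓘(ℝ, ℝ) 𝓘(ℝ, E) ∞ (e ∘ γ) r :=
      ContMDiffAt.comp (g := e) r (contMDiffAt_of_mem_maximalAtlas he (hm hr)) (h.contMDiffAt hr')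
    exact (h2.contDiffAt.of_le (by simp)).contDiffWithinAt
  · filter_upwards [ae_restrict_mem measurableSet_Icc] with r hr
    have h2 : HasVelocity γ r (X.val (γ r)) := (h r (hsub hr)).2
    have h3 : ∑ _ : Fin 1, (1 : ℝ) • X.val (γ r) = X.val (γ r) := by simp
    rw [← h3] at h2
    exact h2

theorem LocalVectorField.FlowsTo.mem_accessibleSet_of_horizontal {t : ℝ} {y z : M}
    (h : X.FlowsTo t y z) (hX : X ∈ horizontalFields H) : z ∈ accessibleSet H y := by
  obtain ⟨γ, a, b, h0, ht, hγ, hy, hz⟩ := flowsTo_iff.1 h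
  rcases le_total 0 t with hle | hle
  · exact mem_accessibleSet_iff.2 (.single
      ⟨γ, 0, t, 1, _, hle, fun _ => hX, hγ.isControlledBy h0 ht, hy, hz⟩)
  · exact mem_accessibleSet_symm (mem_accessibleSet_iff.2 (.single
      ⟨γ, t, 0, 1, _, hle, fun _ => hX, hγ.isControlledBy ht h0, hz, hy⟩))

/-- The flow of a pulled back field is conjugate to the flow of the original field. -/
theorem IsFlowPullback.flowsTo {t : ℝ} (h : IsFlowPullback X t Y Z) {r : ℝ} {y z : M}
    (hZ : Z.FlowsTo r y z) : ∃ y' z', X.FlowsTo t y y' ∧ X.FlowsTo t z z' ∧ Y.FlowsTo r y' z' := by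
  obtain ⟨γ, a, b, h0, hr, hγ, rfl, rfl⟩ := LocalVectorField.flowsTo_iff.1 hZ
  have hf : ∀ s ∈ Ioo a b, X.FlowsTo t (γ s) (X.flow t (γ s)) ∧ X.flow t (γ s) ∈ Y.domain :=
    fun s hs => by
      obtain ⟨w, hw, hf⟩ := (h.1 _).1 (hγ s hs).1
      rw [hf.flow_eq]; exact ⟨hf, hw⟩
  refine ⟨_, _, (hf 0 h0).1, (hf r hr).1, LocalVectorField.flowsTo_iff.2
    ⟨X.flow t ∘ γ, a, b, h0, hr, fun s hs => ⟨(hf s hs).2, ?_⟩, rfl, rfl⟩⟩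
  have h1 := (hγ s hs).2.comp (hf s hs).1.mdifferentiableAt_flow
  rwa [(h.tmap_flow (hf s hs).1 (hf s hs).2).2] at h1

/-- The fields whose flow lines stay in accessible sets form a stable set: a flow line of the
pullback of `Y` along `X` is replaced by a flow line of `X`, one of `Y`, and one of `X` backwards.
-/
theorem LocalVectorField.FlowsTo.mem_accessibleSet {t : ℝ} {y z : M} (h : X.FlowsTo t y z)
    (hX : X ∈ stableHull (horizontalFields H)) : z ∈ accessibleSet H y := by
  refine stableHull_subset (W := {X | ∀ t y z, X.FlowsTo t y z → z ∈ accessibleSet H y})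
    (fun X hX t y z h => h.mem_accessibleSet_of_horizontal hX) ?_ hX t y z h
  intro X hX Y hY t Z hZ r y z h
  obtain ⟨y', z', h1, h2, h3⟩ := hZ.flowsTo h
  exact mem_accessibleSet_trans (mem_accessibleSet_trans (hX _ _ _ h1) (hY _ _ _ h3))
    (mem_accessibleSet_symm (hX _ _ _ h2))

end Acc

/-! ### The theorem of Poincaré and Volterra -/

section PoincareVolterra

/-- A connected space has a countable subcover of every open cover in which each member meets only
countably many others. -/
theorem exists_countable_subcover {L : Type*} [TopologicalSpace L] [ConnectedSpace L]
    {𝔘 : Set (Set L)} (ho : ∀ U ∈ 𝔘, IsOpen U) (hc : ⋃₀ 𝔘 = univ)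
    (hcount : ∀ U ∈ 𝔘, {U' ∈ 𝔘 | (U ∩ U').Nonempty}.Countable) :
    ∃ 𝔙 ⊆ 𝔘, 𝔙.Countable ∧ ⋃₀ 𝔙 = univ := by
  obtain ⟨p⟩ : Nonempty L := inferInstance
  obtain ⟨U₀, hU₀, hp⟩ : p ∈ ⋃₀ 𝔘 := hc ▸ mem_univ p
  -- `S n` collects the members reached from `U₀` by `n` successive overlaps. The union of all of
  -- them is open, and closed because a member that meets it is itself reached one step later.
  let S : ℕ → Set (Set L) := fun n =>
    n.rec {U₀} fun _ T => ⋃ U ∈ T, {U' ∈ 𝔘 | (U ∩ U').Nonempty}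
  have hS : ∀ n, S n ⊆ 𝔘 ∧ (S n).Countable := by
    intro n
    induction n with
    | zero => exact ⟨singleton_subset_iff.2 hU₀, countable_singleton _⟩
    | succ n ih =>
      exact ⟨iUnion₂_subset fun _ _ => sep_subset _ _,
        ih.2.biUnion fun U hU => hcount U (ih.1 hU)⟩
  have hsub : (⋃ n, S n) ⊆ 𝔘 := iUnion_subset fun n => (hS n).1
  refine ⟨⋃ n, S n, hsub, countable_iUnion fun n => (hS n).2, ?_⟩
  refine IsClopen.eq_univ ⟨⟨?_⟩, isOpen_sUnion fun U hU => ho U (hsub hU)⟩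
    ⟨p, U₀, mem_iUnion.2 ⟨0, rfl⟩, hp⟩
  refine isOpen_iff_mem_nhds.2 fun q hq => ?_
  obtain ⟨U', hU', hqU⟩ : q ∈ ⋃₀ 𝔘 := hc ▸ mem_univ q
  filter_upwards [(ho U' hU').mem_nhds hqU] with q' hq' hmem
  obtain ⟨U, hU, hq''⟩ := hmem
  obtain ⟨n, hn⟩ := mem_iUnion.1 hU
  exact hq ⟨U', mem_iUnion.2 ⟨n + 1, mem_iUnion₂.2 ⟨U, hn, hU', q', hq'', hq'⟩⟩, hqU⟩

theorem isPreconnected_subset_interior {L : Type*} [TopologicalSpace L] {C K : Set L}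
    (hC : IsPreconnected C) (hd : ∀ q ∈ C, q ∉ frontier K) {p : L} (hp : p ∈ C)
    (hpK : p ∈ interior K) : C ⊆ interior K := by
  refine hC.subset_left_of_subset_union (v := (closure K)ᶜ) isOpen_interior
    isClosed_closure.isOpen_compl ?_ ?_ ⟨p, hp, hpK⟩
  · exact disjoint_compl_right.mono_left (interior_subset.trans subset_closure)
  · intro q hq
    by_contra h
    rw [mem_union, not_or, mem_compl_iff, not_not] at h
    exact hd q hq ⟨h.2, h.1⟩

/-- A family of countably many open sets near every point, such that every member meets only
countably many others, and that contains a basis of the topology. -/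
theorem exists_locallyCountable_basis {E : Type*} [NormedAddCommGroup E] [NormedSpace ℝ E]
    [FiniteDimensional ℝ E] {M : Type*} [TopologicalSpace M] [ChartedSpace E M]
    [ParacompactSpace M] :
    ∃ B : M × Set E → Set M, ∃ J : Set (M × Set E), (∀ j, IsOpen (B j)) ∧
      (∀ j ∈ J, {j' ∈ J | (B j ∩ B j').Nonempty}.Countable) ∧
      ∀ (y : M) (O : Set M), IsOpen O → y ∈ O → ∃ j ∈ J, y ∈ B j ∧ B j ⊆ O := by
  have : ProperSpace E := FiniteDimensional.proper ℝ E
  have : LocallyCompactSpace M := ChartedSpace.locallyCompactSpace E M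
  choose K hK hyK hKs using fun y : M => exists_compact_subset (chartAt E y).open_source
    (mem_chart_source E y)
  -- Each `W y` lies in the compact set `K y`, so by local finiteness it meets only finitely many
  -- others; countable bases in the charts refine them.
  obtain ⟨W, hWo, hWc, hWf, hWK⟩ := precise_refinement (fun y => interior (K y))
    (fun y => isOpen_interior) (eq_univ_of_forall fun y => mem_iUnion.2 ⟨y, hyK y⟩)
  refine ⟨fun j => W j.1 ∩ ((chartAt E j.1).source ∩ chartAt E j.1 ⁻¹' (interior j.2)),
    univ ×ˢ TopologicalSpace.countableBasis E, fun j => (hWo _).inter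
      ((chartAt E j.1).isOpen_inter_preimage isOpen_interior), ?_, ?_⟩
  · rintro ⟨y, b⟩ -
    have hfin := hWf.finite_nonempty_inter_compact (hK y)
    refine (hfin.countable.prod (TopologicalSpace.countable_countableBasis E)).mono ?_
    rintro ⟨y', b'⟩ ⟨⟨-, hb'⟩, q, hq, hq'⟩
    exact ⟨⟨q, hq'.1, interior_subset (hWK y hq.1)⟩, hb'⟩
  · intro y O hO hy
    obtain ⟨i, hi⟩ := mem_iUnion.1 ((eq_univ_iff_forall.1 hWc) y)
    have hs : y ∈ (chartAt E i).source := hKs i (interior_subset (hWK i hi))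
    have hopen := (chartAt E i).isOpen_inter_preimage_symm hO
    obtain ⟨b, hb, hyb, hbO⟩ :=
      (TopologicalSpace.isBasis_countableBasis E).exists_subset_of_mem_open
      (show chartAt E i y ∈ (chartAt E i).target ∩ (chartAt E i).symm ⁻¹' O from
        ⟨(chartAt E i).map_source hs, by rwa [mem_preimage, (chartAt E i).left_inv hs]⟩) hopen
    have hbo := TopologicalSpace.isOpen_of_mem_countableBasis hb
    refine ⟨(i, b), ⟨mem_univ _, hb⟩, ⟨hi, hs, ?_⟩, ?_⟩
    · rw [mem_preimage, hbo.interior_eq]; exact hyb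
    · rintro q ⟨-, hqs, hqb⟩
      have := (hbO (interior_subset hqb)).2
      rwa [mem_preimage, (chartAt E i).left_inv hqs] at this

/-- The theorem of Poincaré and Volterra: a connected manifold with a continuous injection into a
paracompact manifold is σ-compact. -/
theorem sigmaCompactSpace_of_injective (E : Type*) [NormedAddCommGroup E] [NormedSpace ℝ E]
    [FiniteDimensional ℝ E] {M : Type*} [TopologicalSpace M] [ChartedSpace E M] [T2Space M]
    [ParacompactSpace M] (F : Type*) [NormedAddCommGroup F] [NormedSpace ℝ F]
    [FiniteDimensional ℝ F] {L : Type*} [TopologicalSpace L] [ChartedSpace F L] [T2Space L]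
    [ConnectedSpace L] {f : L → M}
    (hf : Continuous f) (hinj : Function.Injective f) : SigmaCompactSpace L := by
  have : ProperSpace F := FiniteDimensional.proper ℝ F
  have : LocallyConnectedSpace L := ChartedSpace.locallyConnectedSpace F L
  have : LocallyCompactSpace L := ChartedSpace.locallyCompactSpace F L
  obtain ⟨B, J, hBo, hBJ, hB⟩ := exists_locallyCountable_basis (E := E) (M := M)
  -- Components of preimages of basic sets, restricted to those inside a compact part of one chart
  -- of `L`.
  let 𝔘 : Set (Set L) := {U | (∃ j ∈ J, ∃ p, U = connectedComponentIn (f ⁻¹' B j) p) ∧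
    ∃ q K, IsCompact K ∧ K ⊆ (chartAt F q).source ∧ U ⊆ K}
  have ho : ∀ U ∈ 𝔘, IsOpen U := by
    rintro _ ⟨⟨j, -, p, rfl⟩, -⟩
    exact ((hBo j).preimage hf).connectedComponentIn
  suffices h : ∃ 𝔙 : Set (Set L), 𝔙 ⊆ 𝔘 ∧ 𝔙.Countable ∧ ⋃₀ 𝔙 = univ by
    obtain ⟨𝔙, h𝔙, hcount, hcov⟩ := h
    choose q K hK hKs hUK using fun U : 𝔙 => (h𝔙 U.2).2
    have := hcount.to_subtype
    refine SigmaCompactSpace.of_countable (range K) (countable_range K)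
      (forall_mem_range.2 hK) (eq_univ_of_forall fun p => ?_)
    obtain ⟨U, hU, hp⟩ : p ∈ ⋃₀ 𝔙 := by rw [hcov]; exact mem_univ p
    exact ⟨K ⟨U, hU⟩, mem_range_self _, hUK ⟨U, hU⟩ hp⟩
  refine exists_countable_subcover ho ?_ ?_
  · refine eq_univ_of_forall fun p => ?_
    obtain ⟨K, hK, hpK, hKs⟩ := exists_compact_subset (chartAt F p).open_source
      (mem_chart_source F p)
    have hfr : IsCompact (frontier K) := hK.of_isClosed_subset isClosed_frontier
      hK.isClosed.frontier_subset
    -- A basic set that avoids the image of the frontier of `K` traps the component through `p`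
    -- inside `K`.
    obtain ⟨j, hj, hpj, hjO⟩ := hB (f p) (f '' frontier K)ᶜ
      (hfr.image hf).isClosed.isOpen_compl (by
        rintro ⟨q, hq, hqp⟩
        rw [hinj hqp] at hq
        exact hq.2 hpK)
    have hpc : p ∈ connectedComponentIn (f ⁻¹' B j) p := mem_connectedComponentIn hpj
    refine ⟨_, ⟨⟨j, hj, p, rfl⟩, p, K, hK, hKs, ?_⟩, hpc⟩
    refine (isPreconnected_subset_interior isPreconnected_connectedComponentIn
      (fun q hq hqK => ?_) hpc hpK).trans interior_subset
    exact hjO (connectedComponentIn_subset (f ⁻¹' B j) p hq) ⟨q, hqK, rfl⟩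
  · rintro U hU
    obtain ⟨⟨j, hj, p, hUp⟩, q, K, -, hKs, hUK⟩ := id hU
    have hsub : {U' ∈ 𝔘 | (U ∩ U').Nonempty} ⊆ ⋃ j' ∈ {j' ∈ J | (B j ∩ B j').Nonempty},
        {U' | (∃ p', U' = connectedComponentIn (f ⁻¹' B j') p') ∧ (U ∩ U').Nonempty} := by
      rintro U' ⟨⟨⟨j', hj', p', hU'⟩, -⟩, hne⟩
      refine mem_iUnion₂.2 ⟨j', ⟨hj', ?_⟩, ⟨p', hU'⟩, hne⟩
      obtain ⟨r, hr, hr'⟩ := hne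
      rw [hUp] at hr
      rw [hU'] at hr'
      exact ⟨f r, connectedComponentIn_subset (f ⁻¹' B j) p hr,
        connectedComponentIn_subset (f ⁻¹' B j') p' hr'⟩
    refine ((hBJ j hj).biUnion fun j' _ => ?_).mono hsub
    -- Distinct components are disjoint, and those meeting `U` leave disjoint nonempty open traces
    -- in a chart whose domain contains `U`. The model space is separable, so there are countably
    -- many.
    refine PairwiseDisjoint.countable_of_isOpen (s := fun U' =>
      (chartAt F q).target ∩ (chartAt F q).symm ⁻¹' (U ∩ U')) ?_ ?_ ?_
    · rintro _ ⟨⟨p₁, rfl⟩, -⟩ _ ⟨⟨p₂, rfl⟩, -⟩ hne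
      refine Set.disjoint_left.2 fun w h1 h2 => hne ?_
      rw [connectedComponentIn_eq h1.2.2, connectedComponentIn_eq h2.2.2]
    · rintro _ ⟨⟨p₁, rfl⟩, -⟩
      exact (chartAt F q).isOpen_inter_preimage_symm
        ((ho U hU).inter ((hBo j').preimage hf).connectedComponentIn)
    · rintro U' ⟨-, r, hr⟩
      have hrs := hKs (hUK hr.1)
      refine ⟨chartAt F q r, (chartAt F q).map_source hrs, ?_⟩
      rwa [mem_preimage, (chartAt F q).left_inv hrs]

end PoincareVolterra

/-! ### The rank is constant on accessible sets -/

section Rank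

set_option linter.unusedSectionVars false

variable {E : Type v} [NormedAddCommGroup E] [NormedSpace ℝ E] [FiniteDimensional ℝ E]
  {M : Type u} [TopologicalSpace M] [ChartedSpace E M] [IsManifold 𝓘(ℝ, E) ∞ M] [T2Space M]
  {H D : TangentDistribution E M}

theorem IsControlledBy.mono {γ : ℝ → M} {a b c d : ℝ} {k : ℕ} {X : Fin k → LocalVectorField E M}
    (h : IsControlledBy γ a b X) (hac : a ≤ c) (hdb : d ≤ b) : IsControlledBy γ c d X := by
  obtain ⟨⟨hc, habs⟩, hd, w, hw, hv⟩ := h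
  have hsub : Icc c d ⊆ Icc a b := Icc_subset_Icc hac hdb
  exact ⟨⟨hc.mono hsub, fun e he t₀ t₁ h0 h01 h1 hm =>
    habs e he t₀ t₁ (hac.trans h0) h01 (h1.trans hdb) hm⟩, fun j => (hd j).mono_left hsub, w,
    fun j => (hw j).mono_set hsub, ae_restrict_of_ae_restrict_of_subset hsub hv⟩

theorem IsPlaqueAt.finrank_eq {F : Type*} [NormedAddCommGroup F] [NormedSpace ℝ F] {ψ : F → M}
    {u : F} (h : IsPlaqueAt D ψ u) : Module.finrank ℝ (D.fiber (ψ u)) = Module.finrank ℝ F := by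
  rw [← h.range_eq, LinearMap.finrank_range_of_inj h.injective]

variable (H) in
/-- The distribution spanned by the stable set generated by the horizontal fields. -/
noncomputable abbrev stableSpan : TangentDistribution E M :=
  spannedBy (stableHull (horizontalFields H))

theorem horizontalFields_subset_stableSpan :
    horizontalFields H ⊆ horizontalFields (stableSpan H) :=
  (subset_stableHull _).trans (subset_horizontalFields_spannedBy _)

theorem exists_plaque_in_accessibleSet {y : M} {k : ℕ}
    (hk : Module.finrank ℝ ((stableSpan H).fiber y) = k) :
    ∃ ψ : EuclideanSpace ℝ (Fin k) → M, ψ 0 = y ∧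
      ∀ᶠ u in 𝓝 0, IsPlaqueAt (stableSpan H) ψ u ∧ ψ u ∈ accessibleSet H y :=
  (isStable_stableHull _).exists_plaque
    (fun _ hX _ _ _ h hz => mem_accessibleSet_trans hz (h.mem_accessibleSet hX))
    (mem_accessibleSet_self y) hk

/-- Near each time the curve runs in a plaque, where the rank is the dimension of the parameter
space; so the rank is locally constant in time. -/
theorem IsJoined.finrank_eq {y z : M} (h : IsJoined H y z) :
    Module.finrank ℝ ((stableSpan H).fiber y) = Module.finrank ℝ ((stableSpan H).fiber z) := by
  obtain ⟨γ, a, b, k, X, hab, hX, hγ, rfl, rfl⟩ := h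
  refine isPreconnected_Icc.induction₂' (fun s s' => Module.finrank ℝ ((stableSpan H).fiber (γ s)) =
    Module.finrank ℝ ((stableSpan H).fiber (γ s'))) (fun t ht => ?_)
    (fun _ _ _ _ _ _ h1 h2 => h1.trans h2) (left_mem_Icc.2 hab) (right_mem_Icc.2 hab)
  obtain ⟨ψ, h0, hψ⟩ := exists_plaque_in_accessibleSet (H := H) (y := γ t) rfl
  have hψ' := hψ.mono fun _ h => h.1
  obtain ⟨h, hh, hc, hev⟩ := hγ.exists_lift (fun j => horizontalFields_subset_stableSpan (hX j)) ht
    hψ' h0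
  have hct : Tendsto (h ∘ γ) (𝓝[Icc a b] t) (𝓝 0) := by
    have := hc.tendsto.comp (hγ.1.1 t ht)
    rwa [hh] at this
  filter_upwards [hev, hct.eventually hψ'] with s h1 h2
  have h3 := h2.finrank_eq
  rw [Function.comp_apply, h1] at h3
  have h4 := hψ'.self_of_nhds.finrank_eq
  rw [h0] at h4
  exact ⟨h4.trans h3.symm, h3.trans h4.symm⟩

theorem finrank_eq_of_mem_accessibleSet {x y : M} (h : y ∈ accessibleSet H x) :
    Module.finrank ℝ ((stableSpan H).fiber y) = Module.finrank ℝ ((stableSpan H).fiber x) := by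
  have h1 := mem_accessibleSet_iff.1 h
  clear h
  induction h1 with
  | refl => rfl
  | tail _ h ih => exact h.finrank_eq.symm.trans ih

end Rank

/-! ### The manifold structure defined by plaques -/

section Plaques

set_option linter.unusedSectionVars false

variable {E : Type v} [NormedAddCommGroup E] [NormedSpace ℝ E] [FiniteDimensional ℝ E]
  {M : Type u} [TopologicalSpace M] [ChartedSpace E M] [IsManifold 𝓘(ℝ, E) ∞ M] [T2Space M]
  {F : Type*} [NormedAddCommGroup F] [NormedSpace ℝ F] [FiniteDimensional ℝ F]
  {F' : Type*} [NormedAddCommGroup F'] [NormedSpace ℝ F'] [FiniteDimensional ℝ F']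
  {D : TangentDistribution E M} {V : Set (LocalVectorField E M)}

theorem IsPlaqueAt.congr {ψ ψ' : F → M} {u : F} (h : IsPlaqueAt D ψ u) (heq : ψ' =ᶠ[𝓝 u] ψ) :
    IsPlaqueAt D ψ' u := by
  have h1 : tmap (E := F) (E' := E) ψ' u = tmap (E := F) (E' := E) ψ u := tmap_congr heq
  exact ⟨h.contMDiffAt.congr_of_eventuallyEq heq, h1 ▸ h.injective,
    by rw [h1, heq.self_of_nhds]; exact h.range_eq⟩

/-- A plaque is injective near each of its points. -/
theorem IsPlaqueAt.eventually_injOn {ψ : F → M} {u₀ : F} (h : ∀ᶠ u in 𝓝 u₀, IsPlaqueAt D ψ u) :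
    ∃ W ∈ 𝓝 u₀, InjOn ψ W := by
  have hs : ψ u₀ ∈ (chartAt E (ψ u₀)).source := mem_chart_source E _
  have hψc : Tendsto ψ (𝓝 u₀) (𝓝 (ψ u₀)) := h.self_of_nhds.contMDiffAt.continuousAt
  have hf : ∀ᶠ u in 𝓝 u₀, ContDiffAt ℝ ∞ (chartAt E (ψ u₀) ∘ ψ) u := by
    filter_upwards [h, hψc.eventually ((chartAt E (ψ u₀)).open_source.mem_nhds hs)] with u h1 h2
    exact (contDiffAt_chart_comp _ h2 h1.contMDiffAt).1
  obtain ⟨r, -, -, hr⟩ := exists_smooth_leftInverse hf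
    (injective_fderiv_chart_comp _ hs h.self_of_nhds.contMDiffAt h.self_of_nhds.injective)
  refine ⟨_, hr, fun u hu u' hu' heq => ?_⟩
  rw [← hu, ← hu', Function.comp_apply, Function.comp_apply, heq]

/-- Changes of charts between parametrizations by plaques are smooth, with open domain. -/
theorem contDiffAt_plaque_transition {L : Type*} {i : L → M} (hi : Function.Injective i)
    {e : PartialEquiv L F} {e' : PartialEquiv L F'} (he : IsOpen e.target)
    (hep : ∀ u ∈ e.target, IsPlaqueAt (spannedBy V) (i ∘ e.symm) u) (he' : IsOpen e'.target)
    (hep' : ∀ u ∈ e'.target, IsPlaqueAt (spannedBy V) (i ∘ e'.symm) u) {u₀ : F}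
    (hu₀ : u₀ ∈ (e.symm.trans e').source) :
    (e.symm.trans e').source ∈ 𝓝 u₀ ∧ ContDiffAt ℝ ∞ (e' ∘ e.symm) u₀ := by
  obtain ⟨h1, h2⟩ : u₀ ∈ e.target ∧ e.symm u₀ ∈ e'.source := hu₀
  have h3 := e'.map_source h2
  obtain ⟨h, h0, hsm, hh⟩ := exists_plaque_transition (V := V) (ψ := i ∘ e.symm) (ψ' := i ∘ e'.symm)
    (u₀ := u₀) (u₀' := e' (e.symm u₀))
    (by filter_upwards [he.mem_nhds h1] with u hu using hep u hu)
    (by filter_upwards [he'.mem_nhds h3] with u hu using hep' u hu)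
    (by simp [e'.left_inv h2])
  have hc : Tendsto h (𝓝 u₀) (𝓝 (e' (e.symm u₀))) := by
    rw [← h0]; exact hsm.self_of_nhds.continuousAt
  -- Injectivity of `i` identifies the change of charts with the smooth factorization `h`, and shows
  -- at the same time that its domain is open.
  have hev : ∀ᶠ u in 𝓝 u₀, u ∈ (e.symm.trans e').source ∧ e' (e.symm u) = h u := by
    filter_upwards [he.mem_nhds h1, hc.eventually (he'.mem_nhds h3), hh] with u h4 h5 h6
    have h7 : e'.symm (h u) = e.symm u := hi h6
    rw [← h7]
    exact ⟨⟨h4, show e.symm u ∈ e'.source from h7 ▸ e'.map_target h5⟩, e'.right_inv h5⟩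
  exact ⟨hev.mono fun _ h => h.1,
    hsm.self_of_nhds.congr_of_eventuallyEq (hev.mono fun _ h => h.2)⟩

/-- Through every point of a set that is locally parametrized by plaques there is a chart made of a
plaque. -/
theorem exists_plaque_partialEquiv {L : Type*} {i : L → M} (hi : Function.Injective i) {p : L}
    {ψ : F → M} {u₀ : F} (h0 : ψ u₀ = i p)
    (hψ : ∀ᶠ u in 𝓝 u₀, IsPlaqueAt D ψ u ∧ ψ u ∈ range i) :
    ∃ e : PartialEquiv L F, p ∈ e.source ∧ IsOpen e.target ∧
      ∀ u ∈ e.target, IsPlaqueAt D (i ∘ e.symm) u := by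
  classical
  have : Nonempty L := ⟨p⟩
  have : Nonempty F := ⟨u₀⟩
  obtain ⟨W', hW', hinj'⟩ := IsPlaqueAt.eventually_injOn (hψ.mono fun _ h => h.1)
  obtain ⟨W, hW, hWo, huW⟩ := eventually_nhds_iff.1 (hψ.and hW')
  have hinj : InjOn ψ W := hinj'.mono fun u hu => (hW u hu).2
  have hg : ∀ u ∈ W, i (Function.invFun i (ψ u)) = ψ u := fun u hu =>
    Function.invFun_eq (hW u hu).1.2
  refine ⟨⟨fun q => Function.invFunOn ψ W (i q), fun u => Function.invFun i (ψ u),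
    {q | i q ∈ ψ '' W}, W, ?_, ?_, ?_, ?_⟩, ⟨u₀, huW, h0⟩, hWo, ?_⟩
  · intro q hq
    exact Function.invFunOn_mem hq
  · intro u hu
    exact ⟨u, hu, (hg u hu).symm⟩
  · intro q hq
    have h1 : ψ (Function.invFunOn ψ W (i q)) = i q := Function.invFunOn_eq hq
    simp only [h1]
    exact Function.leftInverse_invFun hi q
  · intro u hu
    simp only [hg u hu]
    exact hinj (Function.invFunOn_mem ⟨u, hu, rfl⟩) hu (Function.invFunOn_eq ⟨u, hu, rfl⟩)
  · intro u hu
    refine (hW u hu).1.1.congr ?_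
    filter_upwards [hWo.mem_nhds hu] with u' hu' using hg u' hu'

/-- A set that is locally parametrized by plaques carries a charted space structure in which all
charts are made of plaques. -/
theorem exists_chartedSpace_of_plaques {L : Type*} {i : L → M} (hi : Function.Injective i)
    (hL : ∀ p, ∃ (ψ : F → M) (u₀ : F), ψ u₀ = i p ∧
      ∀ᶠ u in 𝓝 u₀, IsPlaqueAt (spannedBy V) ψ u ∧ ψ u ∈ range i) :
    ∃ (_ : TopologicalSpace L) (_ : ChartedSpace F L), ∀ e ∈ atlas F L, ∀ u ∈ e.target,
      IsPlaqueAt (spannedBy V) (i ∘ e.symm) u := by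
  have hex : ∀ p, ∃ e : PartialEquiv L F, p ∈ e.source ∧ IsOpen e.target ∧
      ∀ u ∈ e.target, IsPlaqueAt (spannedBy V) (i ∘ e.symm) u := fun p => by
    obtain ⟨ψ, u₀, h0, hψ⟩ := hL p
    exact exists_plaque_partialEquiv hi h0 hψ
  choose ch hch hcho hchp using hex
  -- `L` has no topology so far. It receives the one defined by the plaque charts, which may be
  -- strictly finer than the one induced from `M`.
  let c : ChartedSpaceCore F L :=
    { atlas := {e | IsOpen e.target ∧ ∀ u ∈ e.target, IsPlaqueAt (spannedBy V) (i ∘ e.symm) u}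
      chartAt := ch
      mem_chart_source := hch
      chart_mem_atlas := fun p => ⟨hcho p, hchp p⟩
      open_source := fun e e' he he' => isOpen_iff_mem_nhds.2 fun u hu =>
        (contDiffAt_plaque_transition hi he.1 he.2 he'.1 he'.2 hu).1
      continuousOn_toFun := fun e e' he he' u hu =>
        (contDiffAt_plaque_transition hi he.1 he.2 he'.1 he'.2
          hu).2.continuousAt.continuousWithinAt }
  refine ⟨c.toTopologicalSpace, c.toChartedSpace, ?_⟩
  intro e he
  obtain ⟨e₀, he₀, he⟩ := mem_iUnion₂.1 he
  rw [mem_singleton_iff] at he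
  subst he
  exact he₀.2

section Structure

variable {L : Type*} [TopologicalSpace L] [ChartedSpace F L] {i : L → M}

theorem isManifold_of_plaques (hi : Function.Injective i)
    (hat : ∀ e ∈ atlas F L, ∀ u ∈ e.target, IsPlaqueAt (spannedBy V) (i ∘ e.symm) u) :
    IsManifold 𝓘(ℝ, F) ∞ L := by
  refine isManifold_of_contDiffOn _ _ _ fun e e' he he' u hu => ?_
  exact (contDiffAt_plaque_transition hi (e := e.toPartialEquiv) (e' := e'.toPartialEquiv)
    e.open_target (hat e he) e'.open_target (hat e' he') hu.1).2.contDiffWithinAt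

variable [IsManifold 𝓘(ℝ, F) ∞ L]

theorem bijective_tmap_chartAt {p q : L} (hq : q ∈ (chartAt F p).source) :
    Function.Bijective (tmap (E := F) (E' := F) (chartAt F p) q) := by
  refine Function.bijective_iff_has_inverse.2
    ⟨tmap (E := F) (E' := F) (chartAt F p).symm (chartAt F p q), tmap_chartAt_symm_tmap p hq,
      fun ξ => ?_⟩
  have := tmap_chartAt_tmap_symm p ((chartAt F p).map_source hq) ξ
  rwa [(chartAt F p).left_inv hq] at this

theorem bijective_tmap_chartAt_symm {p : L} {u : F} (hu : u ∈ (chartAt F p).target) :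
    Function.Bijective (tmap (E := F) (E' := F) (chartAt F p).symm u) := by
  refine Function.bijective_iff_has_inverse.2
    ⟨tmap (E := F) (E' := F) (chartAt F p) ((chartAt F p).symm u), tmap_chartAt_tmap_symm p hu,
      fun ξ => ?_⟩
  have := tmap_chartAt_symm_tmap p ((chartAt F p).map_target hu) ξ
  rwa [(chartAt F p).right_inv hu] at this

theorem injective_and_range_comp {G : Type*} [NormedAddCommGroup G] [NormedSpace ℝ G]
    {A : F →L[ℝ] G} {B : F →L[ℝ] F} (hB : Function.Bijective B) (hA : Function.Injective A) :
    Function.Injective (A.comp B) ∧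
      LinearMap.range (A.comp B).toLinearMap = LinearMap.range A.toLinearMap := by
  refine ⟨hA.comp hB.1, ?_⟩
  ext ξ
  constructor
  · rintro ⟨η, rfl⟩
    exact ⟨B η, rfl⟩
  · rintro ⟨η, rfl⟩
    obtain ⟨ζ, rfl⟩ := hB.2 η
    exact ⟨ζ, rfl⟩

/-- A map that is parametrized by plaques in all charts is an immersion tangent to the
distribution. -/
theorem immersion_of_plaques
    (hat : ∀ e ∈ atlas F L, ∀ u ∈ e.target, IsPlaqueAt D (i ∘ e.symm) u) (p : L) :
    ContMDiffAt 𝓘(ℝ, F) 𝓘(ℝ, E) ∞ i p ∧ Function.Injective (tmap (E := F) (E' := E) i p) ∧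
      LinearMap.range (tmap (E := F) (E' := E) i p).toLinearMap = D.fiber (i p) := by
  have hp := mem_chart_source F p
  have hψ := hat _ (chart_mem_atlas F p) _ ((chartAt F p).map_source hp)
  have heq : i =ᶠ[𝓝 p] (i ∘ (chartAt F p).symm) ∘ chartAt F p := by
    filter_upwards [(chartAt F p).open_source.mem_nhds hp] with q hq
    simp [(chartAt F p).left_inv hq]
  have hc : ContMDiffAt 𝓘(ℝ, F) 𝓘(ℝ, F) ∞ (chartAt F p) p :=
    contMDiffOn_chart.contMDiffAt ((chartAt F p).open_source.mem_nhds hp)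
  have hcomp : tmap (E := F) (E' := E) i p = (tmap (E := F) (E' := E) (i ∘ (chartAt F p).symm)
      (chartAt F p p)).comp (tmap (E := F) (E' := F) (chartAt F p) p) := by
    rw [tmap_congr heq, tmap_comp (hψ.contMDiffAt.mdifferentiableAt (by simp))
      (hc.mdifferentiableAt (by simp))]
  have h1 := injective_and_range_comp (bijective_tmap_chartAt hp) hψ.injective
  rw [← hcomp] at h1
  refine ⟨(hψ.contMDiffAt.comp p hc).congr_of_eventuallyEq heq, h1.1, ?_⟩
  rw [h1.2, hψ.range_eq, Function.comp_apply, (chartAt F p).left_inv hp]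

/-- An immersion tangent to the distribution is parametrized by plaques. -/
theorem isPlaqueAt_of_immersion (hsm : ∀ q, ContMDiffAt 𝓘(ℝ, F) 𝓘(ℝ, E) ∞ i q)
    (himm : ∀ q, Function.Injective (tmap (E := F) (E' := E) i q))
    (htan : ∀ q, LinearMap.range (tmap (E := F) (E' := E) i q).toLinearMap = D.fiber (i q)) {p : L}
    {u : F} (hu : u ∈ (chartAt F p).target) : IsPlaqueAt D (i ∘ (chartAt F p).symm) u := by
  have hc : ContMDiffAt 𝓘(ℝ, F) 𝓘(ℝ, F) ∞ (chartAt F p).symm u :=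
    contMDiffOn_chart_symm.contMDiffAt ((chartAt F p).open_target.mem_nhds hu)
  have h1 := injective_and_range_comp (bijective_tmap_chartAt_symm hu)
    (himm ((chartAt F p).symm u))
  rw [← tmap_comp ((hsm _).mdifferentiableAt (by simp)) (hc.mdifferentiableAt (by simp))] at h1
  exact ⟨(hsm _).comp u hc, h1.1, h1.2.trans (htan _)⟩

end Structure

section Lift

variable {L : Type*} [TopologicalSpace L] [ChartedSpace F L] {i : L → M}

/-- Controlled curves that stay in a set parametrized by plaques are continuous for the topology
defined by the plaques. -/
theorem IsControlledBy.continuousOn_lift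
    (hat : ∀ e ∈ atlas F L, ∀ u ∈ e.target, IsPlaqueAt D (i ∘ e.symm) u)
    (hi : Function.Injective i) {γ : ℝ → M} {a b : ℝ} {k : ℕ} {X : Fin k → LocalVectorField E M}
    (hγ : IsControlledBy γ a b X) (hX : ∀ j, X j ∈ horizontalFields D) {ζ : ℝ → L}
    (hζ : ∀ t ∈ Icc a b, i (ζ t) = γ t) : ContinuousOn ζ (Icc a b) := by
  intro t ht
  set e := chartAt F (ζ t) with he
  have hs : ζ t ∈ e.source := mem_chart_source F _
  have hu := e.map_source hs
  obtain ⟨h, h0, hc, hev⟩ := hγ.exists_lift (F := F) (ψ := i ∘ e.symm) (u₀ := e (ζ t)) hX ht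
    (by filter_upwards [e.open_target.mem_nhds hu] with u h1 using hat e (chart_mem_atlas F _) u h1)
    (by rw [Function.comp_apply, e.left_inv hs, hζ t ht])
  have hct : Tendsto (h ∘ γ) (𝓝[Icc a b] t) (𝓝 (e (ζ t))) := by
    have := hc.tendsto.comp (hγ.1.1 t ht)
    rwa [h0] at this
  have h1 : Tendsto (e.symm ∘ (h ∘ γ)) (𝓝[Icc a b] t) (𝓝 (ζ t)) := by
    have := (e.continuousAt_symm hu).tendsto.comp hct
    rwa [e.left_inv hs] at this
  refine h1.congr' ?_
  filter_upwards [hev, self_mem_nhdsWithin] with s h2 h3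
  refine hi ?_
  rw [hζ s h3]
  exact h2

end Lift

section Factor

variable {N N' : Type*} [TopologicalSpace N] [ChartedSpace F N] [TopologicalSpace N']
  [ChartedSpace F' N'] [IsManifold 𝓘(ℝ, F) ∞ N] [IsManifold 𝓘(ℝ, F') ∞ N'] {i : N → M} {i' : N' → M}

/-- An integral manifold factors locally through any other integral manifold through the same
point, by a smooth map. -/
theorem exists_local_factorization (hN : ∀ p : N, ∀ u ∈ (chartAt F p).target,
      IsPlaqueAt (spannedBy V) (i ∘ (chartAt F p).symm) u)
    (hN' : ∀ p : N', ∀ u ∈ (chartAt F' p).target,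
      IsPlaqueAt (spannedBy V) (i' ∘ (chartAt F' p).symm) u) {p : N} {p' : N'} (h : i' p' = i p) :
    ∃ φ : N → N', φ p = p' ∧ ContMDiffAt 𝓘(ℝ, F) 𝓘(ℝ, F') ∞ φ p ∧ ∀ᶠ q in 𝓝 p, i' (φ q) = i q := by
  set e := chartAt F p with he
  set e' := chartAt F' p' with he'
  have hs : p ∈ e.source := mem_chart_source F p
  have hs' : p' ∈ e'.source := mem_chart_source F' p'
  obtain ⟨g, g0, hg, hgg⟩ := exists_plaque_transition (V := V) (ψ := i ∘ e.symm)
    (ψ' := i' ∘ e'.symm) (u₀ := e p) (u₀' := e' p')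
    (by filter_upwards [e.open_target.mem_nhds (e.map_source hs)] with u hu using hN p u hu)
    (by filter_upwards [e'.open_target.mem_nhds (e'.map_source hs')] with u hu using hN' p' u hu)
    (by simp [e.left_inv hs, e'.left_inv hs', h])
  have hc : ContMDiffAt 𝓘(ℝ, F) 𝓘(ℝ, F) ∞ e p :=
    contMDiffOn_chart.contMDiffAt (e.open_source.mem_nhds hs)
  have hc' : ContMDiffAt 𝓘(ℝ, F') 𝓘(ℝ, F') ∞ e'.symm (g (e p)) := by
    rw [g0]
    exact contMDiffOn_chart_symm.contMDiffAt (e'.open_target.mem_nhds (e'.map_source hs'))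
  refine ⟨fun q => e'.symm (g (e q)), by simp only [g0, e'.left_inv hs'], ?_, ?_⟩
  · exact ContMDiffAt.comp (g := e'.symm) p hc'
      (ContMDiffAt.comp (g := g) p hg.self_of_nhds.contMDiffAt hc)
  · filter_upwards [(e.continuousAt hs).tendsto.eventually hgg, e.open_source.mem_nhds hs]
      with q h1 h2
    simpa [e.left_inv h2] using h1

end Factor

end Plaques

/-! ### Accessible sets as leaves -/

section Leaves

set_option linter.unusedSectionVars false

variable {E : Type v} [NormedAddCommGroup E] [NormedSpace ℝ E] [FiniteDimensional ℝ E]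
  {M : Type u} [TopologicalSpace M] [ChartedSpace E M] [IsManifold 𝓘(ℝ, E) ∞ M] [T2Space M]
  {H D : TangentDistribution E M} {V : Set (LocalVectorField E M)}

theorem IntegralManifold.isPlaqueAt (N : IntegralManifold D) (p : N.carrier)
    (u : EuclideanSpace ℝ (Fin N.dim))
    (hu : u ∈ (chartAt (EuclideanSpace ℝ (Fin N.dim)) p).target) :
    IsPlaqueAt D (N.incl ∘ (chartAt (EuclideanSpace ℝ (Fin N.dim)) p).symm) u :=
  isPlaqueAt_of_immersion (fun q => N.smooth q) N.immersion N.tangent hu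

/-- The points of a subset of a manifold, without the subspace topology. -/
@[ext]
structure LeafCarrier (A : Set M) : Type u where
  incl : M
  mem : incl ∈ A

theorem LeafCarrier.incl_injective {A : Set M} : Function.Injective (incl (A := A)) :=
  fun _ _ h => LeafCarrier.ext h

theorem LeafCarrier.range_incl {A : Set M} : range (incl (A := A)) = A :=
  Subset.antisymm (range_subset_iff.2 LeafCarrier.mem) fun y hy => ⟨⟨y, hy⟩, rfl⟩

/-- Constancy of the rank on the accessible set allows one model space for all points. -/
theorem exists_plaque_in_leaf {x : M} (p : LeafCarrier (accessibleSet H x)) :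
    ∃ (ψ : EuclideanSpace ℝ (Fin (Module.finrank ℝ ((stableSpan H).fiber x))) → M)
      (u₀ : EuclideanSpace ℝ (Fin (Module.finrank ℝ ((stableSpan H).fiber x)))), ψ u₀ = p.incl ∧
      ∀ᶠ u in 𝓝 u₀, IsPlaqueAt (stableSpan H) ψ u ∧
        ψ u ∈ range (LeafCarrier.incl (A := accessibleSet H x)) := by
  obtain ⟨ψ, h0, hψ⟩ := exists_plaque_in_accessibleSet (finrank_eq_of_mem_accessibleSet p.mem)
  refine ⟨ψ, 0, h0, ?_⟩
  rw [LeafCarrier.range_incl, ← accessibleSet_eq p.mem]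
  exact hψ

/-- Accessible sets are connected in the topology defined by plaques. -/
theorem connectedSpace_accessibleSet {F : Type*} [NormedAddCommGroup F] [NormedSpace ℝ F]
    [FiniteDimensional ℝ F] {x : M} [TopologicalSpace (LeafCarrier (accessibleSet H x))]
    [ChartedSpace F (LeafCarrier (accessibleSet H x))]
    (hat : ∀ e ∈ atlas F (LeafCarrier (accessibleSet H x)), ∀ u ∈ e.target,
      IsPlaqueAt (stableSpan H) (LeafCarrier.incl ∘ e.symm) u) :
    ConnectedSpace (LeafCarrier (accessibleSet H x)) := by
  let x₀ : LeafCarrier (accessibleSet H x) := ⟨x, mem_accessibleSet_self x⟩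
  have key : ∀ y, Relation.ReflTransGen (IsJoined H) x y → ∀ hy : y ∈ accessibleSet H x,
      (⟨y, hy⟩ : LeafCarrier (accessibleSet H x)) ∈ connectedComponent x₀ := by
    intro y h
    induction h with
    | refl => exact fun _ => mem_connectedComponent
    | @tail y z hxy hyz ih =>
      intro hz
      have hy := mem_accessibleSet_iff.2 hxy
      have h1 := connectedComponent_eq (ih hy)
      rw [h1]
      obtain ⟨γ, a, b, k, X, hab, hX, hγ, rfl, rfl⟩ := hyz
      -- Initial pieces of a controlled curve are controlled, so the whole curve lifts to the
      -- accessible set. The lift is continuous, hence stays in one component.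
      have hmem : ∀ t ∈ Icc a b, γ t ∈ accessibleSet H x := fun t ht =>
        mem_accessibleSet_trans hy (mem_accessibleSet_iff.2 (.single
          ⟨γ, a, t, k, X, ht.1, hX, hγ.mono le_rfl ht.2, rfl, rfl⟩))
      classical
      let ζ : ℝ → LeafCarrier (accessibleSet H x) := fun t =>
        if h : γ t ∈ accessibleSet H x then ⟨γ t, h⟩ else x₀
      have hζ : ∀ t (ht : t ∈ Icc a b), ζ t = ⟨γ t, hmem t ht⟩ := fun t ht => dif_pos _
      have hc := hγ.continuousOn_lift hat LeafCarrier.incl_injective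
        (fun j => horizontalFields_subset_stableSpan (hX j)) (ζ := ζ) fun t ht => by
          rw [hζ t ht]
      refine (isPreconnected_Icc.image ζ hc).subset_connectedComponent
        ⟨a, left_mem_Icc.2 hab, hζ a (left_mem_Icc.2 hab)⟩ ⟨b, right_mem_Icc.2 hab, ?_⟩
      exact hζ b (right_mem_Icc.2 hab)
  have : PreconnectedSpace (LeafCarrier (accessibleSet H x)) := by
    refine ⟨?_⟩
    have h1 : connectedComponent x₀ = univ :=
      eq_univ_of_forall fun y => key y.1 (mem_accessibleSet_iff.1 y.mem) y.mem
    exact h1 ▸ isPreconnected_connectedComponent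
  exact ⟨⟨x₀⟩⟩

variable (H) in
/-- Accessible sets are integral manifolds. -/
theorem exists_integralManifold_accessibleSet [ParacompactSpace M] (x : M) :
    ∃ N : IntegralManifold (stableSpan H), range N.incl = accessibleSet H x := by
  obtain ⟨top, ch, hat⟩ := exists_chartedSpace_of_plaques LeafCarrier.incl_injective
    (exists_plaque_in_leaf (H := H) (x := x))
  set F := EuclideanSpace ℝ (Fin (Module.finrank ℝ ((stableSpan H).fiber x))) with hF
  have hman : IsManifold 𝓘(ℝ, F) ∞ (LeafCarrier (accessibleSet H x)) :=
    isManifold_of_plaques LeafCarrier.incl_injective hat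
  have himm := immersion_of_plaques hat
  have hc : Continuous (LeafCarrier.incl (A := accessibleSet H x)) :=
    continuous_iff_continuousAt.2 fun p => (himm p).1.continuousAt
  have ht2 : T2Space (LeafCarrier (accessibleSet H x)) :=
    T2Space.of_injective_continuous LeafCarrier.incl_injective hc
  have hconn := connectedSpace_accessibleSet hat
  -- Together with local compactness and the Hausdorff property, σ-compactness yields
  -- paracompactness by instance search.
  have hsig : SigmaCompactSpace (LeafCarrier (accessibleSet H x)) :=
    sigmaCompactSpace_of_injective E F hc LeafCarrier.incl_injective
  have hlc : LocallyCompactSpace (LeafCarrier (accessibleSet H x)) :=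
    ChartedSpace.locallyCompactSpace F _
  exact ⟨{ carrier := LeafCarrier (accessibleSet H x)
           dim := Module.finrank ℝ ((stableSpan H).fiber x)
           incl := LeafCarrier.incl
           injective := LeafCarrier.incl_injective
           smooth := fun p => (himm p).1
           immersion := fun p => (himm p).2.1
           tangent := fun p => (himm p).2.2 }, LeafCarrier.range_incl⟩

/-- Integral manifolds are contained in accessible sets. -/
theorem IntegralManifold.range_incl_subset [ParacompactSpace M]
    (N : IntegralManifold (stableSpan H)) {x : M} (hx : x ∈ range N.incl) :
    range N.incl ⊆ accessibleSet H x := by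
  obtain ⟨p₀, rfl⟩ := hx
  -- Near `p`, `N` factors through the integral manifold on the accessible set of `N.incl p`.
  have hloc : ∀ p, ∀ᶠ q in 𝓝 p, N.incl q ∈ accessibleSet H (N.incl p) := by
    intro p
    obtain ⟨L, hL⟩ := exists_integralManifold_accessibleSet H (N.incl p)
    obtain ⟨p', hp'⟩ : N.incl p ∈ range L.incl := hL ▸ mem_accessibleSet_self _
    obtain ⟨φ, -, -, hφ⟩ := exists_local_factorization N.isPlaqueAt L.isPlaqueAt hp'
    filter_upwards [hφ] with q hq
    rw [← hL, ← hq]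
    exact mem_range_self _
  -- Accessibility is an equivalence relation with open classes in `N`, so each class is also
  -- closed.
  have hclopen : IsClopen {q | N.incl q ∈ accessibleSet H (N.incl p₀)} := by
    refine ⟨⟨isOpen_iff_mem_nhds.2 fun p hp => ?_⟩, isOpen_iff_mem_nhds.2 fun p hp => ?_⟩
    · filter_upwards [hloc p] with q hq hmem
      exact hp (mem_accessibleSet_trans hmem (mem_accessibleSet_symm hq))
    · filter_upwards [hloc p] with q hq using mem_accessibleSet_trans hp hq
  have huniv := hclopen.eq_univ ⟨p₀, mem_accessibleSet_self _⟩
  rintro _ ⟨q, rfl⟩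
  exact eq_univ_iff_forall.1 huniv q

/-- Continuity of `φ` is not needed: a smooth local factorization exists near each point, and
injectivity of `N'.incl` forces `φ` to coincide with it. -/
theorem IntegralManifold.contMDiff_of_comp_eq {N N' : IntegralManifold (spannedBy V)}
    {φ : N.carrier → N'.carrier} (h : ∀ p, N'.incl (φ p) = N.incl p) :
    ContMDiff (𝓡 N.dim) (𝓡 N'.dim) ∞ φ := by
  intro p
  obtain ⟨g, -, hg, hgi⟩ := exists_local_factorization N.isPlaqueAt N'.isPlaqueAt (h p)
  refine hg.congr_of_eventuallyEq ?_
  filter_upwards [hgi] with q hq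
  exact N'.injective ((h q).trans hq.symm)

/-- Two integral manifolds with the same underlying set are diffeomorphic over the ambient
manifold. -/
theorem IntegralManifold.exists_diffeomorph {N N' : IntegralManifold (spannedBy V)}
    (h : range N.incl = range N'.incl) :
    ∃ φ : Diffeomorph (𝓡 N.dim) (𝓡 N'.dim) N.carrier N'.carrier ∞,
      ∀ p, N'.incl (φ p) = N.incl p := by
  choose f hf using fun p : N.carrier => (h ▸ mem_range_self p : N.incl p ∈ range N'.incl)
  choose g hg using fun p : N'.carrier => (h ▸ mem_range_self p : N'.incl p ∈ range N.incl)
  exact ⟨⟨⟨f, g, fun p => N.injective ((hg _).trans (hf p)),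
    fun p => N'.injective ((hf _).trans (hg p))⟩, contMDiff_of_comp_eq hf,
    contMDiff_of_comp_eq hg⟩, hf⟩

/-- A larger integral manifold still contains `x`, so it lies in the accessible set of `x`. -/
theorem IntegralManifold.isLeafThrough [ParacompactSpace M] {N : IntegralManifold (stableSpan H)}
    {x : M} (h : range N.incl = accessibleSet H x) : N.IsLeafThrough x := by
  have hx : x ∈ range N.incl := h ▸ mem_accessibleSet_self x
  exact ⟨fun N' hN' => (N'.range_incl_subset (hN' hx)).trans h.ge |>.antisymm hN', hx⟩

/-- Maximality is tested against the integral manifold carried by the accessible set, which contains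
every integral manifold through `x`. -/
theorem IntegralManifold.IsLeafThrough.range_incl [ParacompactSpace M]
    {N : IntegralManifold (stableSpan H)} {x : M} (h : N.IsLeafThrough x) :
    range N.incl = accessibleSet H x := by
  obtain ⟨L, hL⟩ := exists_integralManifold_accessibleSet H x
  exact (h.1 L ((N.range_incl_subset h.2).trans hL.ge)).symm.trans hL

end Leaves
end SubRiem

/-! ### The theorem -/

theorem mainTheorem6
    {E : Type v} [NormedAddCommGroup E] [NormedSpace ℝ E] [FiniteDimensional ℝ E]
    {M : Type u} [TopologicalSpace M] [ChartedSpace E M] [IsManifold 𝓘(ℝ, E) ∞ M]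
    [T2Space M] [ParacompactSpace M]
    (H : SubRiem.TangentDistribution E M)
    (hsmooth : SubRiem.IsSmoothDistribution H) (hregular : SubRiem.IsRegular H) (x : M) :
    -- the distribution spanned by `𝒮(𝔛_{loc,H}(M))` is integrable,
    SubRiem.IsIntegrable
      (SubRiem.spannedBy (SubRiem.stableHull (SubRiem.horizontalFields H))) ∧
    -- it has a leaf through `x`,
    (∃ L : SubRiem.IntegralManifold
        (SubRiem.spannedBy (SubRiem.stableHull (SubRiem.horizontalFields H))),
      L.IsLeafThrough x) ∧
    -- which is unique up to a diffeomorphism over `M`,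
    (∀ L L' : SubRiem.IntegralManifold
        (SubRiem.spannedBy (SubRiem.stableHull (SubRiem.horizontalFields H))),
      L.IsLeafThrough x → L'.IsLeafThrough x →
        ∃ φ : Diffeomorph (𝓡 L.dim) (𝓡 L'.dim) L.carrier L'.carrier ∞,
          ∀ p, L'.incl (φ p) = L.incl p) ∧
    -- and whose underlying set is the accessible set of `x`.
    (∀ L : SubRiem.IntegralManifold
        (SubRiem.spannedBy (SubRiem.stableHull (SubRiem.horizontalFields H))),
      L.IsLeafThrough x → SubRiem.accessibleSet H x = range L.incl) := by
  refine ⟨fun y => ?_, ?_, fun L L' hL hL' => ?_, fun L hL => hL.range_incl.symm⟩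
  · obtain ⟨N, hN⟩ := SubRiem.exists_integralManifold_accessibleSet H y
    exact ⟨N, hN ▸ SubRiem.mem_accessibleSet_self y⟩
  · obtain ⟨N, hN⟩ := SubRiem.exists_integralManifold_accessibleSet H x
    exact ⟨N, SubRiem.IntegralManifold.isLeafThrough hN⟩
  · exact SubRiem.IntegralManifold.exists_diffeomorph (hL.range_incl.trans hL'.range_incl.symm)
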